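/- Let $\mathbb T=\mathbb R/\mathbb Z$, let $\varphi:\mathbb T\to(0,\infty)$ be a $C^3$ function with Fourier series $\varphi(x)=\sum_{m\in\mathbb Z}c_m e^{2\pi i m x}$, and let $\alpha\in\mathbb R\setminus\mathbb Q$. For $y\in\mathbb R$ put $\|y\|=\inf_{p\in\mathbb Z}|y-p|$. Assume [H1] there exist real numbers $C_m$, $m\ge 1$, with $\sum_{m=1}^\infty C_m<\infty$ and $\sum_{l=2}^\infty|c_{lm}|^2\le C_m|c_m|^2$ for all $m\ge1$. Suppose that $$\lim_{m\to\infty}\frac{|c_m|}{\|m\alpha\|}=0\qquad\text{and}\qquad \sum_{m\in\mathbb Z\setminus\{0\}}\Bigl(\frac{|c_m|}{\|m\alpha\|}\Bigr)^2=\infty .$$ Then the special flow $T^t_{(\alpha,\varphi)}$ over the rotation $x\mapsto x+\alpha$ of $\mathbb T$ and under the roof function $\varphi$ is weak mixing. Here the special flow acts on $X_\varphi=\{(x,s):x\in\mathbb T,\ 0\le s<\varphi(x)\}$, equipped with the normalized Lebesgue measure $\mu$, by $T^t(x,s)=(x+n\alpha,\ s+t-S_n\varphi(x))$, where $S_n\varphi$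 ($n\in\mathbb Z$) are the Birkhoff sums, i.e. $S_0\varphi=0$ and $S_{n+1}\varphi(x)=S_n\varphi(x)+\varphi(x+n\alpha)$, and $n\in\mathbb Z$ is determined by $S_n\varphi(x)\le s+t<S_{n+1}\varphi(x)$. A flow $(T^t)$ is weak mixing if it preserves $\mu$ and $\frac1\tau\int_0^\tau|\mu(A\cap T^{-t}B)-\mu(A)\mu(B)|\,dt\to0$ as $\tau\to\infty$ for all measurable $A,B$. -/

import Mathlib

open MeasureTheory Filter Topology ProbabilityTheory

noncomputable section

/-- The Birkhoff sums `S_n φ` over the rotation by `α` on `𝕋 = ℝ/ℤ`, for all `n : ℤ`: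
`S_n φ (x) = ∑_{k=0}^{n-1} φ (x + k α)` for `n ≥ 0` and
`S_{-n} φ (x) = -∑_{k=1}^{n} φ (x - k α)` for `n ≥ 1`, so that
`S_{m+n} φ (x) = S_m φ (x) + S_n φ (x + m α)`. -/
def rotationSum (α : ℝ) (φ : UnitAddCircle → ℝ) : ℤ → UnitAddCircle → ℝ
  | Int.ofNat n, x => ∑ k ∈ Finset.range n, φ (x + k • (α : UnitAddCircle))
  | Int.negSucc n, x => -∑ k ∈ Finset.range (n + 1), φ (x - (k + 1) • (α : UnitAddCircle))

/-- The phase space `{(x, s) : 0 ≤ s < φ x}` of the special flow under the roof `φ`. -/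
def specialSpace (φ : UnitAddCircle → ℝ) : Set (UnitAddCircle × ℝ) :=
  {p | 0 ≤ p.2 ∧ p.2 < φ p.1}

/-- Lebesgue measure on the phase space, normalized to be a probability measure. It is
regarded as a measure on `𝕋 × ℝ` which is concentrated on the phase space. -/
def specialMeasure (φ : UnitAddCircle → ℝ) : Measure (UnitAddCircle × ℝ) :=
  ProbabilityTheory.cond volume (specialSpace φ)

/-- The number of passages through the roof: the largest `n : ℤ` with `S_n φ (x) ≤ s + t`.
For a continuous `φ > 0` it exists, and it is the only `n` with
`S_n φ (x) ≤ s + t < S_{n+1} φ (x)`. -/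
def specialIndex (α : ℝ) (φ : UnitAddCircle → ℝ) (t : ℝ) (p : UnitAddCircle × ℝ) : ℤ :=
  sSup {n : ℤ | rotationSum α φ n p.1 ≤ p.2 + t}

/-- The special flow over the rotation by `α` and under the roof `φ`:
`T^t (x, s) = (x + n α, s + t - S_n φ (x))`, where `S_n φ (x) ≤ s + t < S_{n+1} φ (x)`. -/
def specialFlow (α : ℝ) (φ : UnitAddCircle → ℝ) (t : ℝ) (p : UnitAddCircle × ℝ) :
    UnitAddCircle × ℝ :=
  (p.1 + specialIndex α φ t p • (α : UnitAddCircle),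
    p.2 + t - rotationSum α φ (specialIndex α φ t p) p.1)

/-- A flow `T` is weak mixing for the probability measure `μ`: it preserves `μ`, and
`(1/τ) ∫_0^τ |μ (A ∩ T^{-t} B) - μ A μ B| dt → 0` as `τ → ∞` for all measurable `A`, `B`. -/
def IsWeakMixingFlow {X : Type*} [MeasurableSpace X] (μ : Measure X) (T : ℝ → X → X) : Prop :=
  (∀ t, MeasurePreserving (T t) μ μ) ∧
    ∀ A B : Set X, MeasurableSet A → MeasurableSet B →
      Tendsto (fun τ : ℝ => τ⁻¹ * ∫ t in (0 : ℝ)..τ,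
        |μ.real (A ∩ T t ⁻¹' B) - μ.real A * μ.real B|) atTop (𝓝 0)

/-- The `m`-th Fourier coefficient `c_m = ∫ φ (x) e^{-2π i m x} dx` of `φ : 𝕋 → ℝ`. -/
def roofCoeff (φ : UnitAddCircle → ℝ) (m : ℤ) : ℂ :=
  fourierCoeff (fun x : UnitAddCircle => (φ x : ℂ)) m

/-- The regularity condition: there are `C_m` with `∑_{m ≥ 1} C_m < ∞` and
`∑_{l ≥ 2} |c_{l m}|² ≤ C_m |c_m|²` for all `m ≥ 1`. -/
def RegularCoeffs (c : ℤ → ℂ) : Prop :=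
  ∃ C : ℕ → ℝ, Summable C ∧
    ∀ m : ℕ, 1 ≤ m → ∑' l : ℕ, ‖c (((l + 2) * m : ℕ) : ℤ)‖ ^ 2 ≤ C m * ‖c (m : ℤ)‖ ^ 2

end

/-! By Koopman and von Neumann, a measure preserving flow is weak mixing as soon as it has no
nonconstant eigenfunction (`isWeakMixingFlow_of_no_eigenfunction`). An eigenfunction of the special
flow with frequency `ν` is an exponential along fibres, hence is given by a function `ψ` on the
circle with `ψ(x + α) = exp(iνφ(x)) ψ(x)`. Ergodicity of the rotation makes `|ψ|` constant and
settles `ν = 0`, so it remains to exclude unimodular `ψ` for `ν ≠ 0`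
(`isWeakMixingFlow_specialFlow`).

The formal additive solution has coefficients `c_m / (e(mα) - 1)`, of size comparable to `|c_m| /
‖mα‖`. If `‖mα‖ ≥ 1 / (2m²)`, the decay `|c_m| ≤ K / |m|³` makes this at most `2K / m`. Otherwise `m
= lq` with `q` a good denominator and `‖mα‖ = l ‖qα‖`; the terms with `l ≥ 2` are controlled by
[H1]. So the ratios are square summable off the good denominators (`summable_coeffRatio_sq`), and
modulo an `L²` coboundary and its mean `φ` is a series over good denominators `q_n` only
(`exists_cohomologous_lacunary`). These satisfy `q_n² ≤ q_{n+1}`, and the remaining transfer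
coefficients `b_n` tend to `0` with `∑ |b_n|² = ∞`.

Such a lacunary cocycle has no unimodular transfer function (`SuperLacunary.not_cocycle`). One finds
a time `t` with `tα` close to `0` but `q_n tα` at distance at least `1/4` from `0` for all `N ≤ n <
M` (`SuperLacunary.exists_time`). Continuity of translations in `L²` keeps `|∫ ψ(x + tα) conj ψ(x)|`
at least `3/4`. But this modulus is that of a characteristic function of a sum of almost independent
waves of amplitude at least `|b_n|`, bounded by `exp(-∑ |b_n|² / 8)` plus small errors
(`SuperLacunary.norm_integral_cexp_sum_wave_le`). It drops below `3/4` once `M` is large. -/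

open scoped InnerProductSpace ContDiff

/-! ### Positive operators of finite trace, and joint eigenvectors of commuting families. -/

section CompactOperators

variable {H : Type*} [NormedAddCommGroup H] [InnerProductSpace ℂ H]

/-- A positive operator `A` satisfies `‖A x‖² ≤ ‖A‖ ⟪A x, x⟫`. -/
theorem ContinuousLinearMap.IsPositive.norm_apply_sq_le {A : H →L[ℂ] H} (hA : A.IsPositive)
    (x : H) : ‖A x‖ ^ 2 ≤ ‖A‖ * (⟪A x, x⟫_ℂ).re := by
  -- `⟪A x, y⟫` is a semi-inner product; its Cauchy–Schwarz inequality is applied to `x` and `A x`.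
  let c : PreInnerProductSpace.Core ℂ H :=
    { inner := fun x y => ⟪A x, y⟫_ℂ
      conj_inner_symm := fun x y => by
        rw [inner_conj_symm, hA.inner_left_eq_inner_right]
      re_inner_nonneg := fun x => hA.re_inner_nonneg_left x
      add_left := fun x y z => by simp
      smul_left := fun x y r => by simp [mul_comm] }
  have h := @InnerProductSpace.Core.inner_mul_inner_self_le ℂ H _ _ _ c x (A x)
  change ‖⟪A x, A x⟫_ℂ‖ * ‖⟪A (A x), x⟫_ℂ‖ ≤ (⟪A x, x⟫_ℂ).re * (⟪A (A x), A x⟫_ℂ).re at h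
  rw [hA.inner_left_eq_inner_right (A x) x] at h
  have h0 : 0 ≤ (⟪A x, x⟫_ℂ).re := hA.re_inner_nonneg_left x
  have h1 : (⟪A (A x), A x⟫_ℂ).re ≤ ‖A‖ * ‖A x‖ * ‖A x‖ :=
    (Complex.re_le_norm _).trans ((norm_inner_le_norm _ _).trans
      (mul_le_mul_of_nonneg_right (A.le_opNorm _) (norm_nonneg _)))
  have h2 : ‖⟪A x, A x⟫_ℂ‖ = ‖A x‖ ^ 2 := by
    rw [inner_self_eq_norm_sq_to_K]; simp
  rw [h2] at h
  rcases eq_or_lt_of_le (sq_nonneg ‖A x‖) with h3 | h3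
  · rw [← h3]; positivity
  · refine le_of_mul_le_mul_right ?_ h3
    nlinarith [mul_le_mul_of_nonneg_left h1 h0]

/-- A positive operator with finite trace is compact. -/
theorem ContinuousLinearMap.IsPositive.isCompactOperator_of_sum_le [CompleteSpace H]
    {A : H →L[ℂ] H} (hA : A.IsPositive) {K : ℝ}
    (hK : ∀ s : Finset H, Orthonormal ℂ ((↑) : s → H) → ∑ x ∈ s, (⟪A x, x⟫_ℂ).re ≤ K) :
    IsCompactOperator A := by
  classical
  let S : Set ℝ := {y | ∃ s : Finset H, Orthonormal ℂ ((↑) : s → H) ∧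
    y = ∑ x ∈ s, (⟪A x, x⟫_ℂ).re}
  have hne : S.Nonempty := ⟨0, ∅, by simp [Orthonormal, Pairwise], by simp⟩
  have hbdd : BddAbove S := ⟨K, by rintro _ ⟨s, hs, rfl⟩; exact hK s hs⟩
  have key : ∀ ε : ℝ, 0 < ε → ∃ B : H →L[ℂ] H, IsCompactOperator B ∧ dist A B < ε := by
    intro ε hε
    -- A bound `η` for the quadratic form becomes the bound `‖A‖ * η` for `‖A x‖ ^ 2`.
    obtain ⟨η, hη, hηε⟩ : ∃ η : ℝ, 0 < η ∧ ‖A‖ * η ≤ (ε / 2) ^ 2 := by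
      refine ⟨(ε / 2) ^ 2 / (‖A‖ + 1), by positivity, ?_⟩
      rw [mul_div_assoc', div_le_iff₀ (by positivity)]
      nlinarith [norm_nonneg A, sq_nonneg (ε / 2)]
    -- Take a finite orthonormal set whose trace is within `η` of the supremum. A unit vector
    -- orthogonal to it can then add at most `η`, so `A` is small off the span and close to the
    -- finite rank operator `A ∘ P_V`.
    obtain ⟨_, ⟨s, hs, rfl⟩, hlt⟩ := exists_lt_of_lt_csSup hne (sub_lt_self (sSup S) hη)
    let V : Submodule ℂ H := Submodule.span ℂ (s : Set H)
    have : FiniteDimensional ℂ V := FiniteDimensional.span_finset ℂ s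
    have : ProperSpace V := FiniteDimensional.proper_rclike ℂ V
    have hperp : ∀ h ∈ Vᗮ, ‖h‖ = 1 → (⟪A h, h⟫_ℂ).re ≤ η := by
      intro h hh h1
      have hin : ∀ v ∈ s, ⟪v, h⟫_ℂ = 0 := fun v hv =>
        (Submodule.mem_orthogonal V h).1 hh v (Submodule.subset_span hv)
      have hns : h ∉ s := fun hm => by
        have := hin h hm
        rw [inner_self_eq_zero] at this
        simp [this] at h1
      have ho : Orthonormal ℂ ((↑) : ((insert h s : Finset H)) → H) := by
        have hs' := (orthonormal_subtype_iff_ite (𝕜 := ℂ) (s := (s : Set H))).1 hs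
        refine (orthonormal_subtype_iff_ite (𝕜 := ℂ) (s := ((insert h s : Finset H) : Set H))).2 ?_
        intro v hv w hw
        simp only [Finset.coe_insert, Set.mem_insert_iff, Finset.mem_coe] at hv hw
        rcases hv with rfl | hv <;> rcases hw with rfl | hw
        · simp [inner_self_eq_norm_sq_to_K, h1]
        · rw [if_neg (by rintro rfl; exact hns hw), ← inner_conj_symm, hin w hw, map_zero]
        · rw [if_neg (by rintro rfl; exact hns hv), hin v hv]
        · exact hs' v hv w hw
      have := le_csSup hbdd ⟨_, ho, rfl⟩
      rw [Finset.sum_insert hns] at this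
      linarith
    have hperp' : ∀ h ∈ Vᗮ, (⟪A h, h⟫_ℂ).re ≤ η * ‖h‖ ^ 2 := by
      intro h hh
      rcases eq_or_ne h 0 with rfl | h0
      · simp
      · have hn : ‖h‖ ≠ 0 := norm_ne_zero_iff.2 h0
        have := hperp (((‖h‖⁻¹ : ℝ) : ℂ) • h) (Submodule.smul_mem _ _ hh) (by
          rw [norm_smul]; simp [hn])
        rw [map_smul, inner_smul_left, inner_smul_right, Complex.conj_ofReal, Complex.re_ofReal_mul,
          Complex.re_ofReal_mul] at this
        have hp : 0 < ‖h‖ := norm_pos_iff.2 h0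
        rw [← mul_assoc, ← mul_inv, inv_mul_le_iff₀ (by positivity)] at this
        linarith
    refine ⟨A.comp V.starProjection, ?_, ?_⟩
    · have h1 : IsCompactOperator (A.comp V.subtypeL) :=
        isCompactOperator_of_locallyCompactSpace_rng (A.comp V.subtypeL)
      exact h1.comp_clm V.orthogonalProjectionOnto
    · rw [dist_eq_norm]
      refine lt_of_le_of_lt (ContinuousLinearMap.opNorm_le_bound _ (half_pos hε).le fun h => ?_)
        (half_lt_self hε)
      have hm : h - V.starProjection h ∈ Vᗮ := V.sub_starProjection_mem_orthogonal h
      have h1 : (A - A.comp V.starProjection) h = A (h - V.starProjection h) := by simp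
      rw [h1]
      have h2 : ‖h - V.starProjection h‖ ≤ ‖h‖ := by
        rw [← Submodule.starProjection_orthogonal_val]
        exact Submodule.norm_starProjection_apply_le _ _
      refine abs_le_of_sq_le_sq' ?_ (by positivity) |>.2
      calc _ ≤ ‖A‖ * (⟪A (h - V.starProjection h), h - V.starProjection h⟫_ℂ).re :=
            hA.norm_apply_sq_le _
        _ ≤ ‖A‖ * (η * ‖h‖ ^ 2) := by
            gcongr
            exact (hperp' _ hm).trans (by gcongr)
        _ ≤ (ε / 2 * ‖h‖) ^ 2 := by
            rw [← mul_assoc, mul_pow]; gcongr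
  have hcl : A ∈ closure {f : H →L[ℂ] H | IsCompactOperator f} :=
    Metric.mem_closure_iff.2 fun ε hε => by
      obtain ⟨B, hB, hd⟩ := key ε hε
      exact ⟨B, hB, hd⟩
  have hc := isClosed_setOfPred_isCompactOperator (σ₁₂ := RingHom.id ℂ) (M₁ := H) (M₂ := H)
  exact hc.closure_subset hcl

/-- A commuting family of operators which leaves a nonzero finite-dimensional subspace invariant
has a joint eigenvector there. -/
theorem Submodule.exists_joint_eigenvector {V : Type*} [AddCommGroup V] [Module ℂ V] {ι : Type*}
    (U : ι → Module.End ℂ V) (hU : ∀ i j, Commute (U i) (U j)) (E : Submodule ℂ V)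
    [FiniteDimensional ℂ E] (hE : E ≠ ⊥) (hinv : ∀ i, ∀ x ∈ E, U i x ∈ E) :
    ∃ h ∈ E, h ≠ 0 ∧ ∃ χ : ι → ℂ, ∀ i, U i h = χ i • h := by
  -- On an invariant subspace of minimal dimension every `U i` is scalar: by commutation, an
  -- eigenspace of one member is invariant under all the others.
  obtain ⟨W, ⟨hWE, hW0, hWinv⟩, hmin⟩ := WellFounded.has_min
    (InvImage.wf (fun W : Submodule ℂ V => Module.finrank ℂ W) Nat.lt_wfRel.wf)
    {W : Submodule ℂ V | W ≤ E ∧ W ≠ ⊥ ∧ ∀ i, ∀ x ∈ W, U i x ∈ W} ⟨E, le_rfl, hE, hinv⟩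
  have hfin : FiniteDimensional ℂ W := Submodule.finiteDimensional_of_le hWE
  have hnt : Nontrivial W := Submodule.nontrivial_iff_ne_bot.2 hW0
  have key : ∀ i, ∃ μ : ℂ, ∀ x ∈ W, U i x = μ • x := by
    intro i
    obtain ⟨μ, hμ⟩ := Module.End.exists_eigenvalue ((U i).restrict (hWinv i))
    obtain ⟨w, hw⟩ := hμ.exists_hasEigenvector
    let W' : Submodule ℂ V := W ⊓ Module.End.eigenspace (U i) μ
    have hle : W' ≤ W := inf_le_left
    have hW' : W' ≠ ⊥ := by
      intro hbot
      have hmem : (w : V) ∈ W' := by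
        refine ⟨w.2, ?_⟩
        rw [SetLike.mem_coe, Module.End.mem_eigenspace_iff]
        exact congrArg Subtype.val hw.apply_eq_smul
      rw [hbot, Submodule.mem_bot] at hmem
      exact hw.2 (Subtype.ext hmem)
    have hinv' : ∀ j, ∀ x ∈ W', U j x ∈ W' := by
      rintro j x ⟨hx, hx'⟩
      refine ⟨hWinv j x hx, ?_⟩
      rw [SetLike.mem_coe, Module.End.mem_eigenspace_iff] at hx' ⊢
      have h1 : U i (U j x) = U j (U i x) := congrArg (fun B : Module.End ℂ V => B x) (hU i j)
      rw [h1, hx', map_smul]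
    have hnot := hmin W' ⟨hle.trans hWE, hW', hinv'⟩
    have heq : W' = W := Submodule.eq_of_le_of_finrank_le hle (not_lt.1 hnot)
    refine ⟨μ, fun x hx => ?_⟩
    rw [← heq] at hx
    exact Module.End.mem_eigenspace_iff.1 hx.2
  choose χ hχ using key
  obtain ⟨h, hh, hh0⟩ := Submodule.exists_mem_ne_zero_of_ne_bot hW0
  exact ⟨h, hWE hh, hh0, χ, fun i => hχ i h hh⟩

/-- A commuting family of operators which commutes with a nonzero positive compact
operator `A` has a joint eigenvector in an eigenspace of `A` with nonzero eigenvalue. -/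
theorem exists_joint_eigenvector_of_commute_compact [CompleteSpace H] {ι : Type*}
    (U : ι → H →L[ℂ] H) (hU : ∀ i j, Commute (U i) (U j)) {A : H →L[ℂ] H} (hA : A.IsPositive)
    (hc : IsCompactOperator A) (h0 : A ≠ 0) (hAU : ∀ i, Commute A (U i)) :
    ∃ (h : H) (a : ℂ) (χ : ι → ℂ), h ≠ 0 ∧ a ≠ 0 ∧ A h = a • h ∧ ∀ i, U i h = χ i • h := by
  obtain ⟨a, ha, ha0⟩ : ∃ a, Module.End.HasEigenvalue (A : Module.End ℂ H) a ∧ a ≠ 0 := by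
    by_contra! hcon
    exact h0 ((ContinuousLinearMap.eq_zero_of_forall_hasEigenvalue_eq_zero hc hA.isSymmetric).1 hcon)
  let E : Submodule ℂ H := Module.End.eigenspace (A : Module.End ℂ H) a
  have hfin : FiniteDimensional ℂ E := ContinuousLinearMap.finite_dimensional_eigenspace hc a ha0
  have hmaps : ∀ i, ∀ x ∈ E, (U i : Module.End ℂ H) x ∈ E := by
    intro i x hx
    rw [Module.End.mem_eigenspace_iff] at hx ⊢
    have h1 : A (U i x) = U i (A x) := congrArg (fun B : H →L[ℂ] H => B x) (hAU i)
    change A (U i x) = a • U i x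
    rw [h1, show A x = a • x from hx, map_smul]
  obtain ⟨h, hh, hh0, χ, hχ⟩ := E.exists_joint_eigenvector (fun i => (U i : Module.End ℂ H))
    (fun i j => by
      ext x
      exact congrArg (fun B : H →L[ℂ] H => B x) (hU i j)) ha hmaps
  exact ⟨h, a, χ, hh0, ha0, Module.End.mem_eigenspace_iff.1 hh, hχ⟩

end CompactOperators

/-! ### Mean square correlations and eigenvectors of one-parameter isometry groups. -/

section KoopmanVonNeumann

variable {H : Type*} [NormedAddCommGroup H] [InnerProductSpace ℂ H]

/-- The average over `[0, τ]` of the rank one forms attached to the orbit of `f`. -/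
noncomputable def orbitForm (U : ℝ → H →ₗᵢ[ℂ] H) (f : H) (τ : ℝ) (g h : H) : ℂ :=
  (τ : ℂ)⁻¹ * ∫ t in (0 : ℝ)..τ, ⟪g, U t f⟫_ℂ * ⟪U t f, h⟫_ℂ

variable {U : ℝ → H →ₗᵢ[ℂ] H}

theorem measurable_orbit_inner_mul (hmeas : ∀ f g : H, Measurable fun t => ⟪g, U t f⟫_ℂ)
    (f g h : H) : Measurable fun t => ⟪g, U t f⟫_ℂ * ⟪U t f, h⟫_ℂ := by
  refine (hmeas f g).mul ?_
  have : (fun t => ⟪U t f, h⟫_ℂ) = fun t => starRingEnd ℂ ⟪h, U t f⟫_ℂ := by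
    funext t; rw [inner_conj_symm]
  rw [this]
  exact Complex.continuous_conj.measurable.comp (hmeas f h)

theorem norm_orbit_inner_mul_le (f g h : H) (t : ℝ) :
    ‖⟪g, U t f⟫_ℂ * ⟪U t f, h⟫_ℂ‖ ≤ ‖f‖ ^ 2 * ‖g‖ * ‖h‖ := by
  rw [norm_mul]
  calc _ ≤ (‖g‖ * ‖U t f‖) * (‖U t f‖ * ‖h‖) := by
        gcongr <;> exact norm_inner_le_norm _ _
    _ = _ := by rw [(U t).norm_map]; ring

theorem intervalIntegrable_orbit_inner_mul
    (hmeas : ∀ f g : H, Measurable fun t => ⟪g, U t f⟫_ℂ) (f g h : H) (a b : ℝ) :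
    IntervalIntegrable (fun t => ⟪g, U t f⟫_ℂ * ⟪U t f, h⟫_ℂ) volume a b := by
  refine (intervalIntegrable_const (c := ‖f‖ ^ 2 * ‖g‖ * ‖h‖)).mono_fun
    (measurable_orbit_inner_mul hmeas f g h).aestronglyMeasurable (ae_of_all _ fun t => ?_)
  exact (norm_orbit_inner_mul_le f g h t).trans (Real.le_norm_self _)

theorem norm_orbitForm_le (f g h : H) {τ : ℝ} (hτ : 0 < τ) :
    ‖orbitForm U f τ g h‖ ≤ ‖f‖ ^ 2 * ‖g‖ * ‖h‖ := by
  have := intervalIntegral.norm_integral_le_of_norm_le_const (a := 0) (b := τ)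
    (fun t _ => norm_orbit_inner_mul_le (U := U) f g h t)
  rw [orbitForm, norm_mul, norm_inv, Complex.norm_real, Real.norm_of_nonneg hτ.le,
    inv_mul_le_iff₀ hτ]
  rw [sub_zero, abs_of_pos hτ] at this
  linarith

/-- Translation by the group changes the averaged form only by a boundary term. -/
theorem tendsto_orbitForm_sub (hadd : ∀ s t x, U (s + t) x = U s (U t x))
    (hmeas : ∀ f g : H, Measurable fun t => ⟪g, U t f⟫_ℂ) (f g h : H) (s : ℝ) :
    Tendsto (fun τ => orbitForm U f τ (U s g) (U s h) - orbitForm U f τ g h) atTop (𝓝 0) := by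
  have hk : ∀ t, ⟪U s g, U t f⟫_ℂ * ⟪U t f, U s h⟫_ℂ =
      ⟪g, U (t - s) f⟫_ℂ * ⟪U (t - s) f, h⟫_ℂ := by
    intro t
    have : U t f = U s (U (t - s) f) := by rw [← hadd]; congr 2; ring
    rw [this, (U s).inner_map_map, (U s).inner_map_map]
  set k : ℝ → ℂ := fun t => ⟪g, U t f⟫_ℂ * ⟪U t f, h⟫_ℂ with hkdef
  set C := ‖f‖ ^ 2 * ‖g‖ * ‖h‖ with hC
  have hInt : ∀ a b, IntervalIntegrable k volume a b :=
    intervalIntegrable_orbit_inner_mul hmeas f g h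
  have hb : ∀ a b, ‖∫ t in a..b, k t‖ ≤ C * |b - a| := fun a b =>
    intervalIntegral.norm_integral_le_of_norm_le_const fun t _ => norm_orbit_inner_mul_le f g h t
  refine squeeze_zero_norm' (a := fun τ : ℝ => (2 * (C * |s|)) * τ⁻¹) ?_ ?_
  · filter_upwards [eventually_gt_atTop 0] with τ hτ
    -- Substituting `t - s` for `t` moves the window `[0, τ]` to `[-s, τ - s]`; only two end pieces
    -- of length `|s|` survive.
    have h1 : orbitForm U f τ (U s g) (U s h) - orbitForm U f τ g h =
        (τ : ℂ)⁻¹ * ((∫ t in (-s)..0, k t) - ∫ t in (τ - s)..τ, k t) := by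
      rw [orbitForm, orbitForm, ← mul_sub]
      congr 1
      simp_rw [hk]
      rw [intervalIntegral.integral_comp_sub_right (fun t => k t) s, zero_sub]
      have e1 := intervalIntegral.integral_add_adjacent_intervals (hInt (-s) 0) (hInt 0 τ)
      have e2 := intervalIntegral.integral_add_adjacent_intervals (hInt (-s) (τ - s))
        (hInt (τ - s) τ)
      linear_combination e2 - e1
    rw [h1, norm_mul, norm_inv, Complex.norm_real, Real.norm_of_nonneg hτ.le, mul_comm]
    gcongr
    refine (norm_sub_le _ _).trans ?_
    have := hb (-s) 0
    have := hb (τ - s) τ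
    simp only [sub_neg_eq_add, zero_add, sub_sub_cancel] at *
    linarith
  · simpa using tendsto_inv_atTop_zero.const_mul (2 * (C * |s|))

/-- The diagonal values are the mean squared correlations. They make the limit form nonnegative, and
nonzero at `g` when these means do not tend to zero. -/
theorem orbitForm_self (f g : H) (τ : ℝ) :
    orbitForm U f τ g g = ((τ⁻¹ * ∫ t in (0 : ℝ)..τ, ‖⟪g, U t f⟫_ℂ‖ ^ 2 : ℝ) : ℂ) := by
  rw [orbitForm, Complex.ofReal_mul, ← intervalIntegral.integral_ofReal, Complex.ofReal_inv]
  congr 1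
  refine intervalIntegral.integral_congr fun t _ => ?_
  rw [← inner_conj_symm (U t f) g, Complex.mul_conj, Complex.normSq_eq_norm_sq]

/-- The trace of the averaged form is at most `‖f‖²`. -/
theorem sum_orbitForm_le (hmeas : ∀ f g : H, Measurable fun t => ⟪g, U t f⟫_ℂ) (f : H)
    {s : Finset H} (hs : Orthonormal ℂ ((↑) : s → H)) {τ : ℝ} (hτ : 0 < τ) :
    ∑ x ∈ s, (orbitForm U f τ x x).re ≤ ‖f‖ ^ 2 := by
  have hInt : ∀ x ∈ s, IntervalIntegrable (fun t => ‖⟪x, U t f⟫_ℂ‖ ^ 2) volume 0 τ := by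
    intro x _
    refine (intervalIntegrable_const (c := (‖x‖ * ‖f‖) ^ 2)).mono_fun
      ((hmeas f x).norm.pow_const 2).aestronglyMeasurable (ae_of_all _ fun t => ?_)
    have h1 : ‖⟪x, U t f⟫_ℂ‖ ≤ ‖x‖ * ‖f‖ := by simpa using norm_inner_le_norm x (U t f)
    simp only [norm_pow, norm_norm]
    exact pow_le_pow_left₀ (norm_nonneg _) (h1.trans (Real.le_norm_self _)) 2
  simp_rw [orbitForm_self, Complex.ofReal_re]
  rw [← Finset.mul_sum, ← intervalIntegral.integral_finsetSum hInt, inv_mul_le_iff₀ hτ]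
  have hle : ∀ t ∈ Set.Icc 0 τ, ∑ x ∈ s, ‖⟪x, U t f⟫_ℂ‖ ^ 2 ≤ ‖f‖ ^ 2 := by
    intro t _
    have := hs.sum_inner_products_le (U t f) (s := Finset.univ)
    rw [(U t).norm_map] at this
    rwa [← Finset.sum_coe_sort]
  have := intervalIntegral.integral_mono_on hτ.le
    (by simpa only [Finset.sum_fn] using IntervalIntegrable.sum s hInt)
    (intervalIntegrable_const (c := ‖f‖ ^ 2)) hle
  simpa using this

/-- Koopman and von Neumann: if the correlations of `f` and `g` do not vanish in mean square, the
unitary group has an eigenvector, in the cyclic subspace generated by `f`. -/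
theorem exists_joint_eigenvector_of_not_tendsto [CompleteSpace H]
    (hadd : ∀ s t x, U (s + t) x = U s (U t x))
    (hmeas : ∀ f g : H, Measurable fun t => ⟪g, U t f⟫_ℂ) (f g : H)
    (hnot : ¬ Tendsto (fun τ : ℝ => τ⁻¹ * ∫ t in (0 : ℝ)..τ, ‖⟪g, U t f⟫_ℂ‖ ^ 2) atTop (𝓝 0)) :
    ∃ (h : H) (χ : ℝ → ℂ), h ≠ 0 ∧ (∀ t, U t h = χ t • h) ∧
      ∀ v, (∀ t, ⟪v, U t f⟫_ℂ = 0) → ⟪v, h⟫_ℂ = 0 := by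
  obtain ⟨ε, hε, hfreq⟩ : ∃ ε : ℝ, 0 < ε ∧
      ∃ᶠ τ in atTop, ε ≤ ‖τ⁻¹ * ∫ t in (0 : ℝ)..τ, ‖⟪g, U t f⟫_ℂ‖ ^ 2‖ := by
    by_contra! hcon
    refine hnot (Metric.tendsto_nhds.2 fun ε hε => ?_)
    filter_upwards [hcon ε hε] with τ hτ
    simpa using hτ
  have hne := frequently_iff_neBot.1 hfreq
  -- Along an ultrafilter the bounded forms converge for all pairs of vectors at once, and this one
  -- keeps the mean squares at least `ε`.
  let 𝓕 : Ultrafilter ℝ := Ultrafilter.of (atTop ⊓ 𝓟 {τ : ℝ | ε ≤ ‖τ⁻¹ * ∫ t in (0 : ℝ)..τ,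
    ‖⟪g, U t f⟫_ℂ‖ ^ 2‖})
  have h𝓕 : (𝓕 : Filter ℝ) ≤ atTop := (Ultrafilter.of_le _).trans inf_le_left
  have h𝓕ε : ∀ᶠ τ in (𝓕 : Filter ℝ), ε ≤ ‖τ⁻¹ * ∫ t in (0 : ℝ)..τ, ‖⟪g, U t f⟫_ℂ‖ ^ 2‖ :=
    ((Ultrafilter.of_le _).trans inf_le_right) (mem_principal_self _)
  have h𝓕0 : ∀ᶠ τ in (𝓕 : Filter ℝ), 0 < τ := h𝓕 (eventually_gt_atTop 0)
  have hex : ∀ x y : H, ∃ b : ℂ, Tendsto (fun τ => orbitForm U f τ x y) 𝓕 (𝓝 b) := by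
    intro x y
    obtain ⟨b, _, hb⟩ := (isCompact_closedBall (0 : ℂ) (‖f‖ ^ 2 * ‖x‖ * ‖y‖)).ultrafilter_le_nhds
      (𝓕.map fun τ => orbitForm U f τ x y) (by
        rw [le_principal_iff, Ultrafilter.mem_coe, Ultrafilter.mem_map, ← Ultrafilter.mem_coe]
        filter_upwards [h𝓕0] with τ hτ
        simpa using norm_orbitForm_le f x y hτ)
    exact ⟨b, hb⟩
  choose b hb using hex
  have hbound : ∀ x y, ‖b x y‖ ≤ ‖f‖ ^ 2 * ‖x‖ * ‖y‖ := fun x y =>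
    le_of_tendsto (hb x y).norm (by
      filter_upwards [h𝓕0] with τ hτ using norm_orbitForm_le f x y hτ)
  have hInt := intervalIntegrable_orbit_inner_mul hmeas f
  have hadd_left : ∀ x x' y, b (x + x') y = b x y + b x' y := fun x x' y => by
    refine tendsto_nhds_unique (hb _ _) (((hb x y).add (hb x' y)).congr fun τ => ?_)
    rw [orbitForm, orbitForm, orbitForm, ← mul_add,
      ← intervalIntegral.integral_add (hInt x y 0 τ) (hInt x' y 0 τ)]
    simp only [inner_add_left, add_mul]
  have hsmul_left : ∀ (c : ℂ) x y, b (c • x) y = starRingEnd ℂ c * b x y := fun c x y => by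
    refine tendsto_nhds_unique (hb _ _) (((hb x y).const_mul _).congr fun τ => ?_)
    rw [orbitForm, orbitForm, mul_left_comm, ← intervalIntegral.integral_const_mul]
    simp only [inner_smul_left, mul_assoc]
  have hadd_right : ∀ x y y', b x (y + y') = b x y + b x y' := fun x y y' => by
    refine tendsto_nhds_unique (hb _ _) (((hb x y).add (hb x y')).congr fun τ => ?_)
    rw [orbitForm, orbitForm, orbitForm, ← mul_add,
      ← intervalIntegral.integral_add (hInt x y 0 τ) (hInt x y' 0 τ)]
    simp only [inner_add_right, mul_add]
  have hsmul_right : ∀ (c : ℂ) x y, b x (c • y) = c * b x y := fun c x y => by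
    refine tendsto_nhds_unique (hb _ _) (((hb x y).const_mul _).congr fun τ => ?_)
    rw [orbitForm, orbitForm, mul_left_comm, ← intervalIntegral.integral_const_mul]
    simp only [inner_smul_right, mul_left_comm]
  let B₀ : H →ₗ⋆[ℂ] H →ₗ[ℂ] ℂ := LinearMap.mk₂'ₛₗ (starRingEnd ℂ) (RingHom.id ℂ) b hadd_left
    hsmul_left hadd_right hsmul_right
  let B : H →L⋆[ℂ] H →L[ℂ] ℂ := B₀.mkContinuous₂ (‖f‖ ^ 2) hbound
  let A : H →L[ℂ] H := InnerProductSpace.continuousLinearMapOfBilin B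
  have hA : ∀ x y, ⟪A x, y⟫_ℂ = b x y := fun x y =>
    InnerProductSpace.continuousLinearMapOfBilin_apply B x y
  have hself : ∀ x, 0 ≤ (b x x).re ∧ (b x x).im = 0 := by
    intro x
    constructor
    · refine ge_of_tendsto ((Complex.continuous_re.tendsto _).comp (hb x x)) ?_
      filter_upwards [h𝓕0] with τ hτ
      rw [Function.comp_apply, orbitForm_self, Complex.ofReal_re]
      exact mul_nonneg (inv_nonneg.2 hτ.le)
        (intervalIntegral.integral_nonneg hτ.le fun t _ => sq_nonneg _)
    · refine tendsto_nhds_unique ((Complex.continuous_im.tendsto _).comp (hb x x))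
        (tendsto_const_nhds.congr fun τ => ?_)
      rw [Function.comp_apply, orbitForm_self, Complex.ofReal_im]
  have hpos : A.IsPositive := by
    rw [← ContinuousLinearMap.isPositive_toLinearMap_iff, LinearMap.isPositive_iff_complex]
    intro x
    have h1 : ⟪A.toLinearMap x, x⟫_ℂ = b x x := hA x x
    rw [h1]
    exact ⟨Complex.ext (by simp) (by simp [(hself x).2]), (hself x).1⟩
  have hcomp : IsCompactOperator A := by
    refine hpos.isCompactOperator_of_sum_le (K := ‖f‖ ^ 2) fun s hs => ?_
    simp_rw [hA]
    refine le_of_tendsto (tendsto_finsetSum s fun x _ =>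
      (Complex.continuous_re.tendsto _).comp (hb x x)) ?_
    filter_upwards [h𝓕0] with τ hτ using sum_orbitForm_le hmeas f hs hτ
  have hA0 : A ≠ 0 := by
    intro h0
    have h1 : b g g = 0 := by rw [← hA, h0]; simp
    have h2 : ε ≤ ‖b g g‖ := by
      refine ge_of_tendsto (hb g g).norm ?_
      filter_upwards [h𝓕ε] with τ hτ
      rwa [orbitForm_self, Complex.norm_real]
    rw [h1, norm_zero] at h2
    linarith
  have hU0 : ∀ x, U 0 x = x := fun x => (U 0).injective (by rw [← hadd, add_zero])
  have hinv : ∀ s x y, b (U s x) (U s y) = b x y := by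
    intro s x y
    have h1 := ((hb (U s x) (U s y)).sub (hb x y))
    have h2 := (tendsto_orbitForm_sub hadd hmeas f x y s).mono_left h𝓕
    exact sub_eq_zero.1 (tendsto_nhds_unique h1 h2)
  obtain ⟨h, a, χ, hh0, ha0, hAh, hχ⟩ := exists_joint_eigenvector_of_commute_compact
    (fun t => (U t).toContinuousLinearMap) (fun s t => by
      ext x
      change U s (U t x) = U t (U s x)
      rw [← hadd, ← hadd, add_comm]) hpos hcomp hA0 (fun s => by
      ext x
      change A (U s x) = U s (A x)
      refine ext_inner_right ℂ fun y => ?_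
      have hy : y = U s (U (-s) y) := by rw [← hadd, add_neg_cancel, hU0]
      rw [hA, hy, hinv, (U s).inner_map_map, hA])
  -- Since `A h = a • h` with `a ≠ 0`, the product `⟪h, v⟫` is a multiple of `b h v`, and this
  -- vanishes when `v` is orthogonal to the orbit of `f`.
  refine ⟨h, χ, hh0, hχ, fun v hv => ?_⟩
  have h1 : b h v = 0 := by
    refine tendsto_nhds_unique (hb h v) (tendsto_const_nhds.congr fun τ => ?_)
    rw [orbitForm]
    have : ∀ t, ⟪U t f, v⟫_ℂ = 0 := fun t => by rw [← inner_conj_symm, hv, map_zero]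
    simp [this]
  rw [← hA, hAh, inner_smul_left] at h1
  rw [← inner_conj_symm, (mul_eq_zero.1 h1).resolve_left (by simpa using ha0), map_zero]

end KoopmanVonNeumann

/-! ### Measurable characters of the real line. -/

/-- A measurable character of `ℝ` with values in the unit circle is an exponential. -/
theorem exists_eq_exp_of_measurable_character {χ : ℝ → ℂ} (hm : Measurable χ)
    (hadd : ∀ s t, χ (s + t) = χ s * χ t) (hnorm : ∀ t, ‖χ t‖ = 1) :
    ∃ ν : ℝ, ∀ t, χ t = Complex.exp (ν * t * Complex.I) := by
  have hloc : LocallyIntegrable χ :=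
    (locallyIntegrable_const (1 : ℝ)).mono hm.aestronglyMeasurable
      (ae_of_all _ fun t => by simp [hnorm])
  have hloc' : LocallyIntegrable fun t => χ (-t) :=
    (locallyIntegrable_const (1 : ℝ)).mono (hm.comp measurable_neg).aestronglyMeasurable
      (ae_of_all _ fun t => by simp [hnorm])
  -- Convolving a character with `g` multiplies it by the constant `∫ g u • χ (-u)`. When this is
  -- nonzero, `χ` inherits the smoothness of `g` and solves `χ' = z χ`.
  obtain ⟨g, hg, hgc, hc⟩ : ∃ g : ℝ → ℝ, ContDiff ℝ ∞ g ∧ HasCompactSupport g ∧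
      ∫ u, g u • χ (-u) ≠ 0 := by
    by_contra! hcon
    obtain ⟨t, ht⟩ := (ae_eq_zero_of_integral_contDiff_smul_eq_zero hloc' hcon).exists
    have := hnorm (-t)
    rw [ht, norm_zero] at this
    exact zero_ne_one this
  set c := ∫ u, g u • χ (-u) with hcdef
  have hdiff : Differentiable ℝ χ := by
    have h1 : ContDiff ℝ ∞ (convolution g χ (ContinuousLinearMap.lsmul ℝ ℝ) volume) :=
      hgc.contDiff_convolution_left _ hg hloc
    have h2 : χ = fun t => c⁻¹ * (convolution g χ (ContinuousLinearMap.lsmul ℝ ℝ) volume) t := by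
      funext t
      have : (convolution g χ (ContinuousLinearMap.lsmul ℝ ℝ) volume) t = c * χ t := by
        rw [convolution_lsmul, hcdef, ← integral_mul_const]
        refine integral_congr_ae (ae_of_all _ fun u => ?_)
        simp only [sub_eq_add_neg, hadd]
        rw [mul_comm, smul_mul_assoc]
      rw [this, inv_mul_cancel_left₀ hc]
    rw [h2]
    exact (h1.differentiable (by simp)).const_mul _
  have h00 : χ 0 = 1 := by
    have h1 := hadd 0 0
    have h2 : χ 0 ≠ 0 := fun h => by have := hnorm 0; simp [h] at this
    rw [add_zero] at h1
    exact (mul_right_cancel₀ h2 (by rw [one_mul, ← h1])).symm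
  set z := deriv χ 0 with hz
  have hder : ∀ t, HasDerivAt χ (z * χ t) t := by
    intro t
    have h1 : HasDerivAt (fun s => χ (s - t) * χ t) (z * χ t) t := by
      refine HasDerivAt.mul_const ?_ _
      have h2 : HasDerivAt χ z (t - t) := by rw [sub_self]; exact (hdiff 0).hasDerivAt
      exact h2.comp_sub_const t t
    refine h1.congr_of_eventuallyEq (Eventually.of_forall fun s => ?_)
    simp only
    rw [← hadd, sub_add_cancel]
  have hexp : ∀ t : ℝ, χ t = Complex.exp (z * t) := by
    have hconst : ∀ t : ℝ, HasDerivAt (fun t : ℝ => χ t * Complex.exp (-(z * t))) 0 t := by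
      intro t
      have h1 : HasDerivAt (fun t : ℝ => Complex.exp (-(z * t)))
          (Complex.exp (-(z * t)) * (-(z * 1))) t := by
        refine HasDerivAt.cexp ?_
        exact ((Complex.ofRealCLM.hasDerivAt (x := t)).const_mul z).neg
      have h2 := (hder t).mul h1
      convert! h2 using 1
      ring
    intro t
    have h1 := is_const_of_deriv_eq_zero (fun t => (hconst t).differentiableAt)
      (fun t => (hconst t).deriv) t 0
    simp only [Complex.ofReal_zero, mul_zero, neg_zero, Complex.exp_zero, mul_one, h00] at h1
    rw [Complex.exp_neg] at h1
    field_simp at h1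
    exact h1
  have hre : z.re = 0 := by
    have h1 := hnorm 1
    rw [hexp, Complex.norm_exp] at h1
    simpa using h1
  refine ⟨z.im, fun t => ?_⟩
  rw [hexp]
  congr 1
  apply Complex.ext <;> simp [hre]

/-! ### The special flow as a quotient of the vertical translation. -/

section SpecialFlow

variable {α : ℝ} {φ : UnitAddCircle → ℝ}

theorem rotationSum_zero (x : UnitAddCircle) : rotationSum α φ 0 x = 0 := by
  change rotationSum α φ (Int.ofNat 0) x = 0
  simp [rotationSum]

theorem rotationSum_add_one (n : ℤ) (x : UnitAddCircle) :
    rotationSum α φ (n + 1) x = rotationSum α φ n x + φ (x + n • (α : UnitAddCircle)) := by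
  rcases n with n | n
  · change rotationSum α φ (Int.ofNat (n + 1)) x = _
    simp [rotationSum, Finset.sum_range_succ]
  · rcases n with _ | n
    · change rotationSum α φ 0 x = _
      rw [rotationSum_zero]
      simp [rotationSum, sub_eq_add_neg]
    · have : Int.negSucc (n + 1) + 1 = Int.negSucc n := rfl
      rw [this]
      simp only [rotationSum, negSucc_zsmul]
      rw [Finset.sum_range_succ _ (n + 1), ← sub_eq_add_neg]
      ring_nf

theorem rotationSum_add (m n : ℤ) (x : UnitAddCircle) :
    rotationSum α φ (m + n) x =
      rotationSum α φ m x + rotationSum α φ n (x + m • (α : UnitAddCircle)) := by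
  induction n using Int.induction_on with
  | zero => simp [rotationSum_zero]
  | succ n ih =>
    rw [← add_assoc, rotationSum_add_one, ih, rotationSum_add_one, add_assoc, add_smul, add_assoc]
  | pred n ih =>
    have h1 := rotationSum_add_one (α := α) (φ := φ) (m + (-n - 1)) x
    have h2 := rotationSum_add_one (α := α) (φ := φ) (-n - 1) (x + m • (α : UnitAddCircle))
    rw [show m + (-(n : ℤ) - 1) + 1 = m + -n by ring, ih] at h1
    rw [show -(n : ℤ) - 1 + 1 = -n by ring] at h2
    rw [add_smul m, ← add_assoc] at h1
    linarith

theorem continuous_rotationSum (hφ : Continuous φ) (n : ℤ) : Continuous (rotationSum α φ n) := by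
  rcases n with n | n
  · change Continuous fun x => ∑ k ∈ Finset.range n, φ (x + k • (α : UnitAddCircle))
    fun_prop
  · change Continuous fun x => -∑ k ∈ Finset.range (n + 1), φ (x - (k + 1) • (α : UnitAddCircle))
    fun_prop

/-- The action of `ℤ` on `𝕋 × ℝ` for which the phase space is a fundamental domain. -/
def towerShift (α : ℝ) (φ : UnitAddCircle → ℝ) (n : ℤ) (p : UnitAddCircle × ℝ) :
    UnitAddCircle × ℝ :=
  (p.1 + n • (α : UnitAddCircle), p.2 - rotationSum α φ n p.1)

theorem towerShift_towerShift (m n : ℤ) (p : UnitAddCircle × ℝ) :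
    towerShift α φ m (towerShift α φ n p) = towerShift α φ (n + m) p := by
  ext
  · simp [towerShift, add_smul, add_assoc]
  · simp only [towerShift, rotationSum_add]; ring

theorem towerShift_zero (p : UnitAddCircle × ℝ) : towerShift α φ 0 p = p := by
  simp [towerShift, rotationSum_zero]

/-- Vertical translation commutes with the shifts and so descends to the orbit space; the special
flow is this quotient flow read in the fundamental domain `specialSpace φ`. -/
theorem towerShift_add_vertical (n : ℤ) (p : UnitAddCircle × ℝ) (t : ℝ) :
    towerShift α φ n (p + (0, t)) = towerShift α φ n p + (0, t) := by
  ext <;> simp [towerShift]; ring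

theorem specialFlow_eq_towerShift (t : ℝ) (p : UnitAddCircle × ℝ) :
    specialFlow α φ t p = towerShift α φ (specialIndex α φ t p) (p + (0, t)) := by
  simp [specialFlow, towerShift]

theorem measurable_towerShift (hφ : Continuous φ) (n : ℤ) : Measurable (towerShift α φ n) := by
  have := (continuous_rotationSum (α := α) hφ n)
  unfold towerShift
  fun_prop

theorem measurePreserving_towerShift (hφ : Continuous φ) (n : ℤ) :
    MeasurePreserving (towerShift α φ n) := by
  refine MeasurePreserving.skew_product (f := fun x => x + n • (α : UnitAddCircle))
    (g := fun x s => s - rotationSum α φ n x) (measurePreserving_add_right _ _) ?_ ?_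
  · exact (measurable_towerShift (α := α) hφ n).snd
  · exact ae_of_all _ fun x => (measurePreserving_sub_right volume (rotationSum α φ n x)).map_eq

theorem strictMono_rotationSum (hpos : ∀ x, 0 < φ x) (x : UnitAddCircle) :
    StrictMono fun n : ℤ => rotationSum α φ n x :=
  strictMono_int_of_lt_succ fun n => by
    simp only [rotationSum_add_one]
    linarith [hpos (x + n • (α : UnitAddCircle))]

/-- A continuous positive roof function is bounded below by a positive constant. -/
theorem exists_pos_le_roof (hφ : Continuous φ) (hpos : ∀ x, 0 < φ x) :
    ∃ c : ℝ, 0 < c ∧ ∀ x, c ≤ φ x := by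
  obtain ⟨x₀, _, hx₀⟩ := isCompact_univ.exists_isMinOn Set.univ_nonempty hφ.continuousOn
  exact ⟨φ x₀, hpos x₀, fun x => hx₀ (Set.mem_univ x)⟩

theorem exists_rotationSum_le_lt (hφ : Continuous φ) (hpos : ∀ x, 0 < φ x) (x : UnitAddCircle)
    (u : ℝ) : ∃ n : ℤ, rotationSum α φ n x ≤ u ∧ u < rotationSum α φ (n + 1) x := by
  obtain ⟨c, hc, hcφ⟩ := exists_pos_le_roof hφ hpos
  have hup : ∀ n : ℕ, c * n ≤ rotationSum α φ n x := by
    intro n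
    induction n with
    | zero => simp [rotationSum_zero]
    | succ n ih =>
      push_cast
      rw [rotationSum_add_one]
      linarith [hcφ (x + (n : ℤ) • (α : UnitAddCircle))]
  have hdown : ∀ n : ℕ, rotationSum α φ (-n) x ≤ -(c * n) := by
    intro n
    induction n with
    | zero => simp [rotationSum_zero]
    | succ n ih =>
      have h1 := rotationSum_add_one (α := α) (φ := φ) (-(n + 1 : ℕ)) x
      rw [show (-((n + 1 : ℕ) : ℤ)) + 1 = -n by push_cast; ring] at h1
      have h2 := hcφ (x + (-((n + 1 : ℕ) : ℤ)) • (α : UnitAddCircle))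
      push_cast at h1 h2 ⊢
      linarith
  have hmono := strictMono_rotationSum (α := α) hpos x
  obtain ⟨n, hn, hmax⟩ := Int.exists_greatest_of_bdd
    (P := fun n : ℤ => rotationSum α φ n x ≤ u) (by
      obtain ⟨N, hN⟩ := exists_nat_gt (u / c)
      refine ⟨N, fun z hz => ?_⟩
      by_contra! hlt
      have h1 := hmono hlt
      have h2 := hup N
      rw [div_lt_iff₀ hc] at hN
      simp only at h1
      linarith) (by
      obtain ⟨N, hN⟩ := exists_nat_gt (-u / c)
      refine ⟨-N, (hdown N).trans ?_⟩
      rw [div_lt_iff₀ hc] at hN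
      linarith)
  refine ⟨n, hn, ?_⟩
  by_contra! hle
  have := hmax _ hle
  omega

theorem specialIndex_eq_iff (hφ : Continuous φ) (hpos : ∀ x, 0 < φ x) (t : ℝ)
    (p : UnitAddCircle × ℝ) (n : ℤ) : specialIndex α φ t p = n ↔
      rotationSum α φ n p.1 ≤ p.2 + t ∧ p.2 + t < rotationSum α φ (n + 1) p.1 := by
  have hmono := strictMono_rotationSum (α := α) hpos p.1
  have key : ∀ n : ℤ, rotationSum α φ n p.1 ≤ p.2 + t →
      p.2 + t < rotationSum α φ (n + 1) p.1 → specialIndex α φ t p = n := by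
    intro n h1 h2
    refine IsGreatest.csSup_eq ⟨h1, fun m hm => ?_⟩
    have := hmono.lt_iff_lt.1 (lt_of_le_of_lt hm h2)
    omega
  constructor
  · rintro rfl
    obtain ⟨n, h1, h2⟩ := exists_rotationSum_le_lt (α := α) hφ hpos p.1 (p.2 + t)
    rw [key n h1 h2]
    exact ⟨h1, h2⟩
  · exact fun h => key n h.1 h.2

theorem towerShift_mem_specialSpace_iff (n : ℤ) (p : UnitAddCircle × ℝ) :
    towerShift α φ n p ∈ specialSpace φ ↔
      rotationSum α φ n p.1 ≤ p.2 ∧ p.2 < rotationSum α φ (n + 1) p.1 := by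
  simp only [specialSpace, towerShift, Set.mem_ofPred_eq, rotationSum_add_one]
  constructor <;> rintro ⟨h1, h2⟩ <;> constructor <;> linarith

theorem specialIndex_eq_iff_mem (hφ : Continuous φ) (hpos : ∀ x, 0 < φ x) (t : ℝ)
    (p : UnitAddCircle × ℝ) (n : ℤ) :
    specialIndex α φ t p = n ↔ towerShift α φ n (p + (0, t)) ∈ specialSpace φ := by
  rw [specialIndex_eq_iff hφ hpos, towerShift_mem_specialSpace_iff]
  simp

theorem specialFlow_mem (hφ : Continuous φ) (hpos : ∀ x, 0 < φ x) (t : ℝ)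
    (p : UnitAddCircle × ℝ) : specialFlow α φ t p ∈ specialSpace φ := by
  rw [specialFlow_eq_towerShift]
  exact (specialIndex_eq_iff_mem hφ hpos t p _).1 rfl

/-- The flow is determined by lying in the orbit of `p + (0, t)` and in the phase space. -/
theorem specialFlow_eq_of_mem (hφ : Continuous φ) (hpos : ∀ x, 0 < φ x) {t : ℝ}
    {p : UnitAddCircle × ℝ} {n : ℤ} (h : towerShift α φ n (p + (0, t)) ∈ specialSpace φ) :
    specialFlow α φ t p = towerShift α φ n (p + (0, t)) := by
  rw [specialFlow_eq_towerShift, (specialIndex_eq_iff_mem hφ hpos t p n).2 h]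

/-- Both sides lie in the phase space and in the shift orbit of `p + (0, s + t)`, which meets the
phase space only once. -/
theorem specialFlow_add (hφ : Continuous φ) (hpos : ∀ x, 0 < φ x) (s t : ℝ)
    (p : UnitAddCircle × ℝ) :
    specialFlow α φ (s + t) p = specialFlow α φ s (specialFlow α φ t p) := by
  have h1 : specialFlow α φ s (specialFlow α φ t p) = towerShift α φ
      (specialIndex α φ t p + specialIndex α φ s (specialFlow α φ t p)) (p + (0, s + t)) := by
    rw [specialFlow_eq_towerShift s, specialFlow_eq_towerShift t, ← towerShift_add_vertical,
      towerShift_towerShift, add_assoc]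
    simp [add_comm]
  rw [h1]
  refine specialFlow_eq_of_mem hφ hpos ?_
  rw [← h1]
  exact specialFlow_mem hφ hpos _ _

/-- This identifies the roof point `(x, φ x)` with the base point `(x + α, 0)`, the source of the
cocycle equation. -/
theorem specialFlow_towerShift (hφ : Continuous φ) (hpos : ∀ x, 0 < φ x) (t : ℝ) (n : ℤ)
    (p : UnitAddCircle × ℝ) :
    specialFlow α φ t (towerShift α φ n p) = specialFlow α φ t p := by
  have h1 : specialFlow α φ t (towerShift α φ n p) = towerShift α φ
      (n + specialIndex α φ t (towerShift α φ n p)) (p + (0, t)) := by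
    rw [specialFlow_eq_towerShift t, ← towerShift_add_vertical, towerShift_towerShift]
  rw [h1]
  refine (specialFlow_eq_of_mem hφ hpos ?_).symm
  rw [← h1]
  exact specialFlow_mem hφ hpos _ _

/-- The formula for the flow makes sense on all of `𝕋 × ℝ`, so no membership in the phase space is
needed, and fibres can be parametrized by the time elapsed from `(x, 0)`. -/
theorem specialFlow_add_vertical (s t : ℝ) (p : UnitAddCircle × ℝ) :
    specialFlow α φ s (p + (0, t)) = specialFlow α φ (t + s) p := by
  simp [specialFlow, specialIndex, add_assoc]

theorem specialFlow_of_mem (hφ : Continuous φ) (hpos : ∀ x, 0 < φ x) {t : ℝ}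
    {p : UnitAddCircle × ℝ} (h : p + (0, t) ∈ specialSpace φ) :
    specialFlow α φ t p = p + (0, t) := by
  have := specialFlow_eq_of_mem (α := α) (n := 0) hφ hpos (t := t) (p := p)
    (by rwa [towerShift_zero])
  rwa [towerShift_zero] at this

theorem measurable_specialIndex (hφ : Continuous φ) (hpos : ∀ x, 0 < φ x) :
    Measurable fun z : ℝ × UnitAddCircle × ℝ => specialIndex α φ z.1 z.2 := by
  refine measurable_to_countable' fun n => ?_
  have : (fun z : ℝ × UnitAddCircle × ℝ => specialIndex α φ z.1 z.2) ⁻¹' {n} =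
      {z | rotationSum α φ n z.2.1 ≤ z.2.2 + z.1} ∩
        {z | z.2.2 + z.1 < rotationSum α φ (n + 1) z.2.1} := by
    ext z
    exact specialIndex_eq_iff hφ hpos z.1 z.2 n
  rw [this]
  have h1 := continuous_rotationSum (α := α) hφ n
  have h2 := continuous_rotationSum (α := α) hφ (n + 1)
  exact (measurableSet_le (by fun_prop) (by fun_prop)).inter
    (measurableSet_lt (by fun_prop) (by fun_prop))

theorem measurable_uncurry_specialFlow (hφ : Continuous φ) (hpos : ∀ x, 0 < φ x) :
    Measurable (Function.uncurry (specialFlow α φ)) := by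
  have h1 : Measurable fun w : (UnitAddCircle × ℝ) × ℤ => towerShift α φ w.2 w.1 :=
    measurable_from_prod_countable_left fun n => measurable_towerShift hφ n
  have h2 : Function.uncurry (specialFlow α φ) = fun z : ℝ × UnitAddCircle × ℝ =>
      towerShift α φ (specialIndex α φ z.1 z.2) (z.2 + (0, z.1)) := by
    funext z
    exact specialFlow_eq_towerShift z.1 z.2
  rw [h2]
  refine h1.comp (Measurable.prodMk ?_ (measurable_specialIndex hφ hpos))
  fun_prop

theorem measurable_specialFlow (hφ : Continuous φ) (hpos : ∀ x, 0 < φ x) (t : ℝ) :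
    Measurable (specialFlow α φ t) :=
  (measurable_uncurry_specialFlow hφ hpos).of_uncurry_left

theorem measurableSet_specialSpace (hφ : Continuous φ) : MeasurableSet (specialSpace φ) := by
  have h1 : MeasurableSet {p : UnitAddCircle × ℝ | 0 ≤ p.2} :=
    measurableSet_le (by fun_prop) (by fun_prop)
  have h2 : MeasurableSet {p : UnitAddCircle × ℝ | p.2 < φ p.1} :=
    measurableSet_lt (by fun_prop) (by fun_prop)
  exact h1.inter h2

/-- The special flow preserves Lebesgue measure on the phase space. -/
theorem measurePreserving_specialFlow_restrict (hφ : Continuous φ) (hpos : ∀ x, 0 < φ x) (t : ℝ) :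
    MeasurePreserving (specialFlow α φ t) (volume.restrict (specialSpace φ))
      (volume.restrict (specialSpace φ)) := by
  have hS := measurableSet_specialSpace hφ
  refine ⟨measurable_specialFlow hφ hpos t, ?_⟩
  ext B hB
  rw [Measure.map_apply (measurable_specialFlow hφ hpos t) hB, Measure.restrict_apply hB,
    Measure.restrict_apply (measurable_specialFlow hφ hpos t hB)]
  have hvert : ∀ u : ℝ, MeasurePreserving (fun p : UnitAddCircle × ℝ => p + (0, u)) := fun u =>
    measurePreserving_add_right ((volume : Measure UnitAddCircle).prod (volume : Measure ℝ)) (0, u)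
  have hmp : ∀ n : ℤ, MeasurePreserving fun p => towerShift α φ n (p + (0, t)) := fun n =>
    (measurePreserving_towerShift hφ n).comp (hvert t)
  have hinv : ∀ (n : ℤ) (p : UnitAddCircle × ℝ),
      towerShift α φ n (towerShift α φ (-n) (p + (0, -t)) + (0, t)) = p := by
    intro n p
    rw [← towerShift_add_vertical, towerShift_towerShift, neg_add_cancel, towerShift_zero,
      add_assoc]
    simp
  have hinv' : ∀ (n : ℤ) (p : UnitAddCircle × ℝ),
      towerShift α φ (-n) (towerShift α φ n (p + (0, t)) + (0, -t)) = p := by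
    intro n p
    rw [← towerShift_add_vertical, towerShift_towerShift, add_neg_cancel, towerShift_zero,
      add_assoc]
    simp
  -- Cut by passage number: on each piece the flow is a single measure preserving map, and the
  -- images are the pieces of `B ∩ specialSpace φ` cut by the passage number for time `-t`.
  have e1 : specialFlow α φ t ⁻¹' B ∩ specialSpace φ = ⋃ n : ℤ,
      (fun p => towerShift α φ n (p + (0, t))) ⁻¹' (B ∩ specialSpace φ ∩
        (fun p => towerShift α φ (-n) (p + (0, -t))) ⁻¹' specialSpace φ) := by
    ext p
    simp only [Set.mem_inter_iff, Set.mem_preimage, Set.mem_iUnion, hinv']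
    constructor
    · rintro ⟨h1, h2⟩
      refine ⟨specialIndex α φ t p, ⟨?_, ?_⟩, h2⟩
      · rwa [← specialFlow_eq_towerShift]
      · exact (specialIndex_eq_iff_mem hφ hpos t p _).1 rfl
    · rintro ⟨n, ⟨h1, h2⟩, h3⟩
      rw [specialFlow_eq_of_mem hφ hpos h2]
      exact ⟨h1, h3⟩
  have e2 : B ∩ specialSpace φ = ⋃ n : ℤ, (B ∩ specialSpace φ ∩
        (fun p => towerShift α φ (-n) (p + (0, -t))) ⁻¹' specialSpace φ) := by
    rw [← Set.inter_iUnion]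
    refine (Set.inter_eq_left.2 fun p _ => Set.mem_iUnion.2
      ⟨-specialIndex α φ (-t) p, ?_⟩).symm
    rw [Set.mem_preimage, neg_neg]
    exact (specialIndex_eq_iff_mem hφ hpos (-t) p _).1 rfl
  have hms : ∀ n : ℤ, MeasurableSet (B ∩ specialSpace φ ∩
      (fun p => towerShift α φ (-n) (p + (0, -t))) ⁻¹' specialSpace φ) := fun n =>
    (hB.inter hS).inter (((measurable_towerShift hφ (-n)).comp (measurable_add_const _)) hS)
  rw [e1, measure_iUnion, congrArg volume e2, measure_iUnion]
  · exact tsum_congr fun n => (hmp n).measure_preimage (hms n).nullMeasurableSet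
  · intro m n hmn
    refine Set.disjoint_left.2 fun p hm hn => hmn ?_
    have h1 := (specialIndex_eq_iff_mem hφ hpos (-t) p _).2 hm.2
    have h2 := (specialIndex_eq_iff_mem hφ hpos (-t) p _).2 hn.2
    omega
  · exact hms
  · intro m n hmn
    refine Set.disjoint_left.2 fun p hm hn => hmn ?_
    have h1 := (specialIndex_eq_iff_mem hφ hpos t p _).2 hm.1.2
    have h2 := (specialIndex_eq_iff_mem hφ hpos t p _).2 hn.1.2
    omega
  · exact fun n => (hmp n).measurable (hms n)

theorem measurePreserving_specialFlow (hφ : Continuous φ) (hpos : ∀ x, 0 < φ x) (t : ℝ) :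
    MeasurePreserving (specialFlow α φ t) (specialMeasure φ) (specialMeasure φ) := by
  have h := measurePreserving_specialFlow_restrict (α := α) hφ hpos t
  exact h.smul_measure _

/-- The phase space has positive and finite volume. -/
theorem volume_specialSpace_ne (hφ : Continuous φ) (hpos : ∀ x, 0 < φ x) :
    volume (specialSpace φ) ≠ 0 ∧ volume (specialSpace φ) ≠ ⊤ := by
  obtain ⟨c, hc, hcφ⟩ := exists_pos_le_roof hφ hpos
  obtain ⟨x₁, _, hx₁⟩ := isCompact_univ.exists_isMaxOn Set.univ_nonempty hφ.continuousOn
  constructor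
  · have hsub : (Set.univ : Set UnitAddCircle) ×ˢ Set.Ico 0 c ⊆ specialSpace φ :=
      fun p hp => ⟨hp.2.1, hp.2.2.trans_le (hcφ _)⟩
    refine (lt_of_lt_of_le ?_ (measure_mono hsub)).ne'
    rw [Measure.volume_eq_prod, Measure.prod_prod]
    simp [hc]
  · have hsub : specialSpace φ ⊆ (Set.univ : Set UnitAddCircle) ×ˢ Set.Icc 0 (φ x₁) :=
      fun p hp => ⟨Set.mem_univ _, hp.1, hp.2.le.trans (hx₁ (Set.mem_univ _))⟩
    refine (lt_of_le_of_lt (measure_mono hsub) ?_).ne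
    rw [Measure.volume_eq_prod, Measure.prod_prod]
    simp

theorem isProbabilityMeasure_specialMeasure (hφ : Continuous φ) (hpos : ∀ x, 0 < φ x) :
    IsProbabilityMeasure (specialMeasure φ) :=
  cond_isProbabilityMeasure_of_finite (volume_specialSpace_ne hφ hpos).1
    (volume_specialSpace_ne hφ hpos).2

end SpecialFlow

open scoped InnerProductSpace ENNReal

/-! ### Koopman operators, and weak mixing from the absence of eigenfunctions. -/

section WeakMixingCriterion

/-- Convergence to zero in quadratic mean implies convergence to zero in mean. -/
theorem tendsto_average_abs_of_sq {r : ℝ → ℝ} (hr : Measurable r) (hb : ∀ t, |r t| ≤ 1)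
    (h : Tendsto (fun τ : ℝ => τ⁻¹ * ∫ t in (0 : ℝ)..τ, r t ^ 2) atTop (𝓝 0)) :
    Tendsto (fun τ : ℝ => τ⁻¹ * ∫ t in (0 : ℝ)..τ, |r t|) atTop (𝓝 0) := by
  have hi1 : ∀ τ, IntervalIntegrable (fun t => |r t|) volume 0 τ := fun τ =>
    (intervalIntegrable_const (c := (1 : ℝ))).mono_fun hr.abs.aestronglyMeasurable
      (ae_of_all _ fun t => by simpa using hb t)
  have hi2 : ∀ τ, IntervalIntegrable (fun t => r t ^ 2) volume 0 τ := fun τ =>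
    (intervalIntegrable_const (c := (1 : ℝ))).mono_fun (hr.pow_const 2).aestronglyMeasurable
      (ae_of_all _ fun t => by simpa using hb t)
  rw [Metric.tendsto_nhds] at h ⊢
  intro ε hε
  filter_upwards [h (ε * (ε / 2)) (by positivity), eventually_gt_atTop 0] with τ h1 hτ
  have hnn : 0 ≤ ∫ t in (0 : ℝ)..τ, |r t| :=
    intervalIntegral.integral_nonneg hτ.le fun t _ => abs_nonneg _
  rw [Real.dist_eq, sub_zero] at h1 ⊢
  rw [abs_of_nonneg (mul_nonneg (inv_nonneg.2 hτ.le) hnn)]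
  -- Young's inequality `|r| ≤ ε / 2 + r² / (2ε)`; the threshold `ε * (ε / 2)` then leaves less than
  -- `ε / 2 + ε / 4`.
  have h2 : ∫ t in (0 : ℝ)..τ, |r t| ≤ ∫ t in (0 : ℝ)..τ, (ε / 2 + (2 * ε)⁻¹ * r t ^ 2) := by
    refine intervalIntegral.integral_mono_on hτ.le (hi1 τ)
      (intervalIntegrable_const.add ((hi2 τ).const_mul _)) fun t _ => ?_
    rw [← sq_abs]
    have : ε / 2 + (2 * ε)⁻¹ * |r t| ^ 2 - |r t| = (2 * ε)⁻¹ * (|r t| - ε) ^ 2 := by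
      field_simp; ring
    nlinarith [mul_nonneg (inv_nonneg.2 (by positivity : (0 : ℝ) ≤ 2 * ε)) (sq_nonneg (|r t| - ε))]
  rw [intervalIntegral.integral_add intervalIntegrable_const ((hi2 τ).const_mul _),
    intervalIntegral.integral_const, intervalIntegral.integral_const_mul, sub_zero,
    smul_eq_mul] at h2
  have h3 := (le_abs_self _).trans_lt h1
  have h4 : τ⁻¹ * ∫ t in (0 : ℝ)..τ, |r t| ≤
      ε / 2 + (2 * ε)⁻¹ * (τ⁻¹ * ∫ t in (0 : ℝ)..τ, r t ^ 2) := by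
    calc _ ≤ τ⁻¹ * (τ * (ε / 2) + (2 * ε)⁻¹ * ∫ t in (0 : ℝ)..τ, r t ^ 2) := by gcongr
      _ = _ := by field_simp
  have h5 : (2 * ε)⁻¹ * (τ⁻¹ * ∫ t in (0 : ℝ)..τ, r t ^ 2) < (2 * ε)⁻¹ * (ε * (ε / 2)) := by
    gcongr
  have h6 : (2 * ε)⁻¹ * (ε * (ε / 2)) = ε / 4 := by field_simp; norm_num
  linarith

variable {X : Type*} [MeasurableSpace X] {μ : Measure X} {T : ℝ → X → X}

/-- The Koopman operators of a measure preserving flow. -/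
noncomputable def koopman (hT : ∀ t, MeasurePreserving (T t) μ μ) (t : ℝ) :
    Lp ℂ 2 μ →ₗᵢ[ℂ] Lp ℂ 2 μ :=
  Lp.compMeasurePreservingₗᵢ ℂ (T t) (hT t)

theorem coeFn_koopman (hT : ∀ t, MeasurePreserving (T t) μ μ) (t : ℝ) (f : Lp ℂ 2 μ) :
    koopman hT t f =ᵐ[μ] f ∘ T t :=
  Lp.coeFn_compMeasurePreserving f (hT t)

theorem koopman_add (hT : ∀ t, MeasurePreserving (T t) μ μ)
    (hadd : ∀ s t x, T (s + t) x = T s (T t x)) (s t : ℝ) (f : Lp ℂ 2 μ) :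
    koopman hT (s + t) f = koopman hT s (koopman hT t f) := by
  refine Lp.ext ?_
  have h1 := coeFn_koopman hT (s + t) f
  have h2 := coeFn_koopman hT s (koopman hT t f)
  have h3 := (hT s).quasiMeasurePreserving.ae (coeFn_koopman hT t f)
  filter_upwards [h1, h2, h3] with x h1 h2 h3
  rw [h1, h2, Function.comp_apply, Function.comp_apply, h3, Function.comp_apply, add_comm, hadd]

theorem inner_koopman (hT : ∀ t, MeasurePreserving (T t) μ μ) (t : ℝ) (f g : Lp ℂ 2 μ) :
    ⟪g, koopman hT t f⟫_ℂ = ∫ x, f (T t x) * starRingEnd ℂ (g x) ∂μ := by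
  rw [L2.inner_def]
  refine integral_congr_ae ?_
  filter_upwards [coeFn_koopman hT t f] with x hx
  rw [hx]
  rfl

theorem measurable_inner_koopman [SFinite μ] (hT : ∀ t, MeasurePreserving (T t) μ μ)
    (hjoint : Measurable (Function.uncurry T)) (f g : Lp ℂ 2 μ) :
    Measurable fun t => ⟪g, koopman hT t f⟫_ℂ := by
  simp_rw [inner_koopman]
  have hf : StronglyMeasurable (fun z : ℝ × X => f (T z.1 z.2)) :=
    (Lp.stronglyMeasurable f).comp_measurable hjoint
  have hg : StronglyMeasurable (fun z : ℝ × X => starRingEnd ℂ (g z.2)) :=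
    Complex.continuous_conj.comp_stronglyMeasurable
      ((Lp.stronglyMeasurable g).comp_measurable measurable_snd)
  exact (StronglyMeasurable.integral_prod_right (hf.mul hg)).measurable

/-- A measure preserving flow without nonconstant eigenfunctions is weak mixing. -/
theorem isWeakMixingFlow_of_no_eigenfunction [IsProbabilityMeasure μ]
    (hT : ∀ t, MeasurePreserving (T t) μ μ)
    (hjoint : Measurable (Function.uncurry T)) (hadd : ∀ s t x, T (s + t) x = T s (T t x))
    (hno : ∀ (h : X → ℂ) (ν : ℝ), Measurable h → Integrable h μ →
      (∀ t, ∀ᵐ x ∂μ, h (T t x) = Complex.exp (ν * t * Complex.I) * h x) →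
      ∫ x, h x ∂μ = 0 → h =ᵐ[μ] 0) :
    IsWeakMixingFlow μ T := by
  refine ⟨hT, fun A B hA hB => ?_⟩
  -- Centring the indicator of `B` turns its correlation with the indicator of `A` into the
  -- difference in the definition of weak mixing.
  have hmB : MemLp (fun x => B.indicator (fun _ => (1 : ℂ)) x - (μ.real B : ℂ)) 2 μ :=
    (memLp_indicator_const 2 hB 1 (Or.inr (measure_ne_top _ _))).sub (memLp_const _)
  have hmA : MemLp (A.indicator (fun _ => (1 : ℂ))) 2 μ :=
    memLp_indicator_const 2 hA 1 (Or.inr (measure_ne_top _ _))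
  have hm1 : MemLp (fun _ : X => (1 : ℂ)) 2 μ := memLp_const _
  let f : Lp ℂ 2 μ := hmB.toLp _
  let g : Lp ℂ 2 μ := hmA.toLp _
  let e : Lp ℂ 2 μ := hm1.toLp _
  have hcorr : ∀ t, ⟪g, koopman hT t f⟫_ℂ =
      ((μ.real (A ∩ T t ⁻¹' B) - μ.real A * μ.real B : ℝ) : ℂ) := by
    intro t
    rw [inner_koopman]
    have h1 : (fun x => f (T t x) * starRingEnd ℂ (g x)) =ᵐ[μ] fun x =>
        (A ∩ T t ⁻¹' B).indicator (fun _ => (1 : ℂ)) x -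
          A.indicator (fun _ => (μ.real B : ℂ)) x := by
      filter_upwards [(hT t).quasiMeasurePreserving.ae hmB.coeFn_toLp, hmA.coeFn_toLp]
        with x h1 h2
      rw [h1, h2]
      by_cases hxA : x ∈ A <;> by_cases hxB : T t x ∈ B <;> simp [hxA, hxB, Set.indicator]
    rw [integral_congr_ae h1, integral_sub, integral_indicator (hA.inter ((hT t).measurable hB)),
      integral_indicator hA]
    · simp
    · exact (integrable_const _).indicator (hA.inter ((hT t).measurable hB))
    · exact (integrable_const _).indicator hA
  -- The orbit of `f` stays orthogonal to the constants, so an eigenvector from its cyclic subspace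
  -- has mean zero, as `hno` requires.
  have hconst : ∀ t, ⟪e, koopman hT t f⟫_ℂ = 0 := by
    intro t
    rw [inner_koopman]
    have h1 : (fun x => f (T t x) * starRingEnd ℂ (e x)) =ᵐ[μ] fun x =>
        (T t ⁻¹' B).indicator (fun _ => (1 : ℂ)) x - (μ.real B : ℂ) := by
      filter_upwards [(hT t).quasiMeasurePreserving.ae hmB.coeFn_toLp, hm1.coeFn_toLp]
        with x h1 h2
      rw [h1, h2]
      by_cases hxB : T t x ∈ B <;> simp [hxB, Set.indicator]
    rw [integral_congr_ae h1, integral_sub, integral_indicator ((hT t).measurable hB)]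
    · simp [measureReal_def, (hT t).measure_preimage hB.nullMeasurableSet]
    · exact (integrable_const _).indicator ((hT t).measurable hB)
    · exact integrable_const _
  have hmeas := measurable_inner_koopman hT hjoint (μ := μ)
  set r : ℝ → ℝ := fun t => μ.real (A ∩ T t ⁻¹' B) - μ.real A * μ.real B with hr
  have hmr : Measurable r := by
    have h1 : r = fun t => (⟪g, koopman hT t f⟫_ℂ).re := by
      funext t; rw [hcorr, Complex.ofReal_re]
    rw [h1]
    exact Complex.measurable_re.comp (hmeas f g)
  have hbr : ∀ t, |r t| ≤ 1 := by
    intro t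
    have h1 : μ.real A * μ.real B ≤ 1 := mul_le_one₀ measureReal_le_one measureReal_nonneg
      measureReal_le_one
    have h2 : 0 ≤ μ.real A * μ.real B := by positivity
    have h3 : μ.real (A ∩ T t ⁻¹' B) ≤ 1 := measureReal_le_one
    have h4 : 0 ≤ μ.real (A ∩ T t ⁻¹' B) := measureReal_nonneg
    rw [abs_le]
    constructor <;> simp only [hr] <;> linarith
  refine tendsto_average_abs_of_sq hmr hbr ?_
  by_contra hnot
  obtain ⟨h, χ, hh0, hχ, horth⟩ := exists_joint_eigenvector_of_not_tendsto
    (koopman_add hT hadd) hmeas f g (by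
      convert! hnot using 6 with τ t
      rw [hcorr, Complex.norm_real, Real.norm_eq_abs, sq_abs])
  have hnorm : ∀ t, ‖χ t‖ = 1 := by
    intro t
    have h1 := (koopman hT t).norm_map h
    rw [hχ, norm_smul] at h1
    exact mul_right_cancel₀ (norm_ne_zero_iff.2 hh0) (by rw [h1, one_mul])
  have hmul : ∀ s t, χ (s + t) = χ s * χ t := by
    intro s t
    refine smul_left_injective ℂ hh0 ?_
    simp only
    rw [← hχ, koopman_add hT hadd, hχ, map_smul, hχ, smul_smul, mul_comm]
  have hχm : Measurable χ := by
    have h1 : χ = fun t => ⟪h, koopman hT t h⟫_ℂ / ⟪h, h⟫_ℂ := by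
      funext t
      rw [hχ, inner_smul_right, mul_div_cancel_right₀ _ (inner_self_ne_zero.2 hh0)]
    rw [h1]
    exact (hmeas h h).div_const _
  obtain ⟨ν, hν⟩ := exists_eq_exp_of_measurable_character hχm hmul hnorm
  refine hh0 (Lp.ext ((hno h ν (Lp.stronglyMeasurable h).measurable
    ((Lp.memLp h).integrable one_le_two) (fun t => ?_) ?_).trans (Lp.coeFn_zero _ _ _).symm))
  · have h1 := coeFn_koopman hT t h
    rw [hχ] at h1
    filter_upwards [h1, Lp.coeFn_smul (χ t) h] with x h1 h2
    rw [h2, Pi.smul_apply, smul_eq_mul, hν] at h1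
    exact h1.symm
  · have h1 := horth e hconst
    rw [L2.inner_def] at h1
    rw [← h1]
    refine integral_congr_ae ?_
    filter_upwards [hm1.coeFn_toLp] with x hx
    rw [hx]
    simp

end WeakMixingCriterion

/-! ### From eigenfunctions of the special flow to a cocycle equation over the rotation. -/

section SpecialFlowEigenfunctions

variable {α : ℝ} {φ : UnitAddCircle → ℝ}

theorem measurable_specialFlow_comp {Y : Type*} [MeasurableSpace Y] (hφ : Continuous φ)
    (hpos : ∀ x, 0 < φ x) {f : Y → ℝ} {g : Y → UnitAddCircle × ℝ} (hf : Measurable f)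
    (hg : Measurable g) : Measurable fun y => specialFlow α φ (f y) (g y) := by
  have h1 := (measurable_uncurry_specialFlow (α := α) hφ hpos).comp (hf.prodMk hg)
  rwa [Function.comp_def] at h1

theorem ergodic_rotation (hα : Irrational α) :
    Ergodic fun x : UnitAddCircle => x + (α : UnitAddCircle) := by
  rw [AddCircle.ergodic_add_right, ← AddCircle.denseRange_zsmul_iff,
    AddCircle.denseRange_zsmul_coe_iff]
  simpa using hα

/-- A measurable eigenfunction of the special flow is, along a.e. fibre, an exponential. -/
theorem exists_eigenfunction_base (hφ : Continuous φ) (hpos : ∀ x, 0 < φ x)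
    {h : UnitAddCircle × ℝ → ℂ} (hm : Measurable h) {ν : ℝ}
    (heig : ∀ t, ∀ᵐ p ∂specialMeasure φ,
      h (specialFlow α φ t p) = Complex.exp (ν * t * Complex.I) * h p) :
    ∃ ψ : UnitAddCircle → ℂ, Measurable ψ ∧ ∀ᵐ x, ∀ᵐ u : ℝ,
      h (specialFlow α φ u (x, 0)) = Complex.exp (ν * u * Complex.I) * ψ x := by
  have hT := measurable_uncurry_specialFlow (α := α) hφ hpos
  have hS := measurableSet_specialSpace hφ
  have hexp : Measurable fun u : ℝ => Complex.exp (ν * u * Complex.I) := by fun_prop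
  have h1 : ∀ᵐ p : UnitAddCircle × ℝ, p ∈ specialSpace φ → ∀ᵐ t : ℝ,
      h (specialFlow α φ t p) = Complex.exp (ν * t * Complex.I) * h p := by
    rw [← ae_restrict_iff' hS]
    have h2 : ∀ t, ∀ᵐ p ∂volume.restrict (specialSpace φ),
        h (specialFlow α φ t p) = Complex.exp (ν * t * Complex.I) * h p := by
      intro t
      have := heig t
      rwa [specialMeasure, ProbabilityTheory.cond, Measure.ae_ennreal_smul_measure_iff
        (ENNReal.inv_ne_zero.2 (volume_specialSpace_ne hφ hpos).2)] at this
    -- The eigenvalue equation has an exceptional null set depending on `t`; Fubini exchanges the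
    -- quantifiers.
    rw [← Measure.ae_ae_comm (p := fun t p =>
      h (specialFlow α φ t p) = Complex.exp (ν * t * Complex.I) * h p)]
    · exact ae_of_all _ h2
    · exact measurableSet_eq_fun (hm.comp hT)
        ((hexp.comp measurable_fst).mul (hm.comp measurable_snd))
  have h2 : ∀ᵐ x, ∃ w : ℂ, ∀ᵐ u : ℝ,
      h (specialFlow α φ u (x, 0)) = Complex.exp (ν * u * Complex.I) * w := by
    filter_upwards [Measure.ae_ae_of_ae_prod h1] with x hx
    obtain ⟨s, hs, hs'⟩ : ∃ s, s ∈ Set.Ico 0 (φ x) ∧ ((x, s) ∈ specialSpace φ → ∀ᵐ t : ℝ,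
        h (specialFlow α φ t (x, s)) = Complex.exp (ν * t * Complex.I) * h (x, s)) := by
      by_contra hcon
      have h3 : volume (Set.Ico 0 (φ x)) = 0 := measure_eq_zero_iff_ae_notMem.2
        (hx.mono fun s hs hs' => hcon ⟨s, hs', hs⟩)
      simp [(hpos x).not_ge] at h3
    refine ⟨Complex.exp (-(ν * s * Complex.I)) * h (x, s), ?_⟩
    have h4 := (measurePreserving_sub_right volume s).quasiMeasurePreserving.ae (hs' hs)
    filter_upwards [h4] with u hu
    have h5 : specialFlow α φ (u - s) (x, s) = specialFlow α φ u (x, 0) := by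
      have := specialFlow_add_vertical (α := α) (φ := φ) (u - s) s (x, 0)
      simpa using this
    rw [← h5, hu, ← mul_assoc, ← Complex.exp_add]
    congr 2
    push_cast
    ring
  -- Averaging over a time interval of length one recovers the constant of almost every fibre,
  -- measurably in `x`.
  refine ⟨fun x => ∫ u in Set.Ioc (0 : ℝ) 1,
    Complex.exp (-(ν * u * Complex.I)) * h (specialFlow α φ u (x, 0)), ?_, ?_⟩
  · refine (StronglyMeasurable.integral_prod_right (f := fun (x : UnitAddCircle)
      (u : ℝ) => Complex.exp (-(ν * u * Complex.I)) * h (specialFlow α φ u (x, 0))) ?_).measurable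
    have h3 : Measurable fun z : UnitAddCircle × ℝ => specialFlow α φ z.2 (z.1, 0) :=
      measurable_specialFlow_comp hφ hpos measurable_snd (measurable_fst.prodMk measurable_const)
    have h4 : Measurable fun z : UnitAddCircle × ℝ => h (specialFlow α φ z.2 (z.1, 0)) :=
      hm.comp h3
    have h5 : Measurable fun z : UnitAddCircle × ℝ => Complex.exp (-(ν * z.2 * Complex.I)) := by
      fun_prop
    exact (h5.mul h4).stronglyMeasurable
  · filter_upwards [h2] with x ⟨w, hw⟩
    have h3 : ∫ u in Set.Ioc (0 : ℝ) 1,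
        Complex.exp (-(ν * u * Complex.I)) * h (specialFlow α φ u (x, 0)) = w := by
      have : ∫ u in Set.Ioc (0 : ℝ) 1,
          Complex.exp (-(ν * u * Complex.I)) * h (specialFlow α φ u (x, 0)) =
          ∫ u in Set.Ioc (0 : ℝ) 1, w := by
        refine integral_congr_ae (ae_restrict_of_ae ?_)
        filter_upwards [hw] with u hu
        rw [hu, ← mul_assoc, ← Complex.exp_add, neg_add_cancel, Complex.exp_zero, one_mul]
      rw [this]
      simp
    rw [h3]
    exact hw

/-- The special flow is weak mixing if the exponentials of the roof function are not
multiplicative coboundaries over the rotation. -/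
theorem isWeakMixingFlow_specialFlow (hφ : Continuous φ) (hpos : ∀ x, 0 < φ x)
    (hα : Irrational α)
    (hno : ∀ (ν : ℝ) (ψ : UnitAddCircle → ℂ), ν ≠ 0 → Measurable ψ → (∀ᵐ x, ‖ψ x‖ = 1) →
      ¬ ∀ᵐ x, ψ (x + (α : UnitAddCircle)) = Complex.exp (ν * φ x * Complex.I) * ψ x) :
    IsWeakMixingFlow (specialMeasure φ) (specialFlow α φ) := by
  have := isProbabilityMeasure_specialMeasure hφ hpos
  refine isWeakMixingFlow_of_no_eigenfunction (measurePreserving_specialFlow hφ hpos)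
    (measurable_uncurry_specialFlow hφ hpos) (specialFlow_add hφ hpos) ?_
  intro h ν hm hInt heig hmean
  obtain ⟨ψ, hψm, hψ⟩ := exists_eigenfunction_base hφ hpos hm heig
  have hrot := ergodic_rotation hα
  have hcocycle : ∀ᵐ x, ψ (x + (α : UnitAddCircle)) = Complex.exp (ν * φ x * Complex.I) * ψ x := by
    filter_upwards [hψ, hrot.quasiMeasurePreserving.ae hψ] with x h1 h2
    have h3 := (measurePreserving_add_left volume (φ x)).quasiMeasurePreserving.ae h1
    -- The fibre formulas from `(x + α, 0)` and from `(x, 0)`, the latter delayed by `φ x`, are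
    -- compared at one time where both hold.
    obtain ⟨u, h4, h5⟩ := (h2.and h3).exists
    have h6 : specialFlow α φ u (x + (α : UnitAddCircle), 0) = specialFlow α φ (φ x + u) (x, 0) := by
      have e1 : towerShift α φ 1 ((x, 0) + (0, φ x)) = (x + (α : UnitAddCircle), 0) := by
        have : rotationSum α φ 1 x = φ x := by
          have := rotationSum_add_one (α := α) (φ := φ) 0 x
          simpa [rotationSum_zero] using this
        simp [towerShift, this]
      rw [← e1, specialFlow_towerShift hφ hpos, specialFlow_add_vertical]
    rw [h6, h5] at h4
    have h7 : Complex.exp (ν * (φ x + u : ℝ) * Complex.I) =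
        Complex.exp (ν * u * Complex.I) * Complex.exp (ν * φ x * Complex.I) := by
      rw [← Complex.exp_add]; congr 1; push_cast; ring
    rw [h7, mul_assoc] at h4
    exact (mul_left_cancel₀ (Complex.exp_ne_zero _) h4).symm
  have hfib : ∀ᵐ p : UnitAddCircle × ℝ, p ∈ specialSpace φ →
      h p = Complex.exp (ν * p.2 * Complex.I) * ψ p.1 := by
    refine (Measure.ae_prod_iff_ae_ae (μ := (volume : Measure UnitAddCircle))
      (ν := (volume : Measure ℝ)) ?_).2 ?_
    · have h1 : MeasurableSet {p : UnitAddCircle × ℝ |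
          h p = Complex.exp (ν * p.2 * Complex.I) * ψ p.1} :=
        measurableSet_eq_fun hm (Measurable.mul (by fun_prop) (hψm.comp measurable_fst))
      exact (measurableSet_specialSpace hφ).imp h1
    · filter_upwards [hψ] with x hx
      filter_upwards [hx] with u hu hmem
      rw [specialFlow_of_mem hφ hpos (by simpa using hmem)] at hu
      simpa using hu
  have hfib' : ∀ᵐ p ∂specialMeasure φ, h p = Complex.exp (ν * p.2 * Complex.I) * ψ p.1 := by
    refine Measure.ae_smul_measure ?_ _
    rwa [ae_restrict_iff' (measurableSet_specialSpace hφ)]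
  have hae : ∀ {P : UnitAddCircle → Prop}, (∀ᵐ x, P x) → ∀ᵐ p ∂specialMeasure φ, P p.1 := by
    intro P hP
    refine cond_absolutelyContinuous.ae_le ?_
    exact Measure.quasiMeasurePreserving_fst.ae hP
  -- The modulus is rotation invariant, hence a constant `c`. If `c = 0` then `h` vanishes; if `ν =
  -- 0` then `h` is constant with mean zero; otherwise `ψ / c` is a forbidden unimodular solution.
  obtain ⟨c, hc⟩ := hrot.ae_eq_const_of_ae_eq_comp_ae (g := fun x => ‖ψ x‖)
    hψm.norm.aestronglyMeasurable (by
      filter_upwards [hcocycle] with x hx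
      rw [Function.comp_apply, hx, norm_mul, Complex.norm_exp]
      simp)
  rcases eq_or_ne c 0 with rfl | hc0
  · filter_upwards [hfib', hae hc] with p h1 h2
    have h3 : ψ p.1 = 0 := by simpa using h2
    rw [h1, h3, mul_zero, Pi.zero_apply]
  · rcases eq_or_ne ν 0 with rfl | hν
    · obtain ⟨w, hw⟩ := hrot.ae_eq_const_of_ae_eq_comp_ae (g := ψ)
        hψm.aestronglyMeasurable (by
          filter_upwards [hcocycle] with x hx
          simpa using hx)
      have h1 : h =ᵐ[specialMeasure φ] fun _ => w := by
        filter_upwards [hfib', hae hw] with p h1 h2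
        rw [h1, h2]
        simp
      rw [integral_congr_ae h1] at hmean
      have hw0 : w = 0 := by simpa using hmean
      rw [hw0] at h1
      exact h1
    · refine absurd ?_ (hno ν (fun x => (c : ℂ)⁻¹ * ψ x) hν (hψm.const_mul _) ?_)
      · filter_upwards [hcocycle] with x hx
        rw [hx]; ring
      · filter_upwards [hc] with x hx
        have h1 : ‖ψ x‖ = c := hx
        have h2 : 0 ≤ c := h1 ▸ norm_nonneg _
        rw [norm_mul, norm_inv, Complex.norm_real, Real.norm_of_nonneg h2, h1, inv_mul_cancel₀ hc0]

end SpecialFlowEigenfunctions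

/-! ### Very good rational approximations and the growth of their denominators. -/

section RationalApproximation

/-- The denominators `q` of the reduced fractions `p / q` with `|q α - p| < 1 / (2 q²)`. -/
def goodDenominators (α : ℝ) : Set ℕ :=
  {q | 1 ≤ q ∧ ∃ p : ℤ, IsCoprime p (q : ℤ) ∧ |(q : ℝ) * α - p| < 1 / (2 * (q : ℝ) ^ 2)}

theorem unitAddCircle_norm_le (x : ℝ) (p : ℤ) : ‖(x : UnitAddCircle)‖ ≤ |x - p| := by
  rw [UnitAddCircle.norm_eq]
  exact round_le x p

theorem unitAddCircle_norm_eq_of_lt {x : ℝ} {p : ℤ} (h : |x - p| < 1 / 2) :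
    ‖(x : UnitAddCircle)‖ = |x - p| := by
  rw [UnitAddCircle.norm_eq]
  have h1 : round x = p := by
    rw [round_eq, Int.floor_eq_iff]
    rw [abs_lt] at h
    constructor <;> linarith
  rw [h1]

theorem norm_nat_mul_pos {α : ℝ} (hα : Irrational α) {m : ℕ} (hm : 1 ≤ m) :
    0 < ‖(((m : ℝ) * α : ℝ) : UnitAddCircle)‖ := by
  rw [UnitAddCircle.norm_eq, abs_pos, sub_ne_zero]
  exact (hα.natCast_mul (by omega)).ne_int _

variable {α : ℝ}

theorem exists_of_mem_goodDenominators {q : ℕ} (hq : q ∈ goodDenominators α) :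
    ∃ p : ℤ, IsCoprime p (q : ℤ) ∧ ‖(((q : ℝ) * α : ℝ) : UnitAddCircle)‖ = |(q : ℝ) * α - p| ∧
      |(q : ℝ) * α - p| < 1 / (2 * (q : ℝ) ^ 2) := by
  obtain ⟨h1, p, hp, hlt⟩ := hq
  refine ⟨p, hp, unitAddCircle_norm_eq_of_lt (hlt.trans_le ?_), hlt⟩
  have : (1 : ℝ) ≤ q := by exact_mod_cast h1
  rw [div_le_div_iff₀ (by positivity) (by norm_num)]
  nlinarith

theorem norm_lt_of_mem_goodDenominators {q : ℕ} (hq : q ∈ goodDenominators α) :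
    ‖(((q : ℝ) * α : ℝ) : UnitAddCircle)‖ < 1 / (2 * (q : ℝ) ^ 2) := by
  obtain ⟨p, -, h1, h2⟩ := exists_of_mem_goodDenominators hq
  rwa [h1]

/-- Good denominators are rapidly increasing. -/
theorem goodDenominators_separation {q q' : ℕ} (hq : q ∈ goodDenominators α)
    (hq' : q' ∈ goodDenominators α) (hlt : q < q') :
    q ^ 2 ≤ q' ∧ 1 / (2 * (q' : ℝ)) ≤ ‖(((q : ℝ) * α : ℝ) : UnitAddCircle)‖ := by
  have h1 := hq.1
  obtain ⟨p, hp, hn, hb⟩ := exists_of_mem_goodDenominators hq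
  obtain ⟨p', hp', -, hb'⟩ := exists_of_mem_goodDenominators hq'
  -- Equal fractions in lowest terms would have equal denominators, so this integer has absolute
  -- value at least one.
  have hne : p * q' - p' * q ≠ 0 := by
    intro h0
    have e : p * q' = p' * q := sub_eq_zero.1 h0
    have d1 : (q : ℤ) ∣ q' := hp.symm.dvd_of_dvd_mul_left (Dvd.intro_left p' e.symm)
    have d2 : (q' : ℤ) ∣ q := hp'.symm.dvd_of_dvd_mul_left (Dvd.intro_left p e)
    have := Nat.dvd_antisymm (Int.natCast_dvd_natCast.1 d1) (Int.natCast_dvd_natCast.1 d2)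
    omega
  have hone : (1 : ℝ) ≤ |(p : ℝ) * q' - p' * q| := by
    have := Int.one_le_abs hne
    exact_mod_cast this
  have q1 : (1 : ℝ) ≤ q := by exact_mod_cast h1
  have qq : (q : ℝ) + 1 ≤ q' := by exact_mod_cast hlt
  set d := |(q : ℝ) * α - p| with hd
  set d' := |(q' : ℝ) * α - p'| with hd'
  have htri : |(p : ℝ) * q' - p' * q| ≤ q' * d + q * d' := by
    have e : (p : ℝ) * q' - p' * q = -(q' * (q * α - p)) + q * (q' * α - p') := by ring
    rw [e]
    refine (abs_add_le _ _).trans ?_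
    rw [abs_neg, abs_mul, abs_mul, Nat.abs_cast, Nat.abs_cast]
  have q'0 : (0 : ℝ) < q' := by linarith
  -- In `1 ≤ q' d + q d'` the second term is at most `1 / 2`, so `q' d ≥ 1 / 2`; with `d < 1 / (2
  -- q²)` this forces `q² ≤ q'`.
  have hd'1 : (q : ℝ) * d' ≤ 1 / 2 := by
    rw [lt_div_iff₀ (by positivity)] at hb'
    have h0 : 0 ≤ d' := abs_nonneg _
    nlinarith [mul_nonneg h0 (by nlinarith : (0 : ℝ) ≤ (q' : ℝ) ^ 2 - q)]
  have hhalf : 1 / 2 ≤ q' * d := by linarith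
  constructor
  · rw [lt_div_iff₀ (by positivity)] at hb
    have h3 : (q : ℝ) ^ 2 ≤ q' := by
      by_contra! hcon
      have h0 : 0 ≤ d := abs_nonneg _
      nlinarith
    exact_mod_cast h3
  · rw [hn, div_le_iff₀ (by positivity)]
    linarith

/-- Every very good approximation is a multiple of a good denominator. -/
theorem exists_goodDenominator_of_lt {m : ℕ} (hm : 1 ≤ m)
    (h : ‖(((m : ℝ) * α : ℝ) : UnitAddCircle)‖ < 1 / (2 * (m : ℝ) ^ 2)) :
    ∃ q ∈ goodDenominators α, ∃ l : ℕ, 1 ≤ l ∧ m = l * q ∧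
      ‖(((m : ℝ) * α : ℝ) : UnitAddCircle)‖ = l * ‖(((q : ℝ) * α : ℝ) : UnitAddCircle)‖ := by
  rw [UnitAddCircle.norm_eq] at h ⊢
  set p := round ((m : ℝ) * α) with hp
  have hg : 0 < Int.gcd p m := Int.gcd_pos_of_ne_zero_right _ (by omega)
  -- Passing to lowest terms divides the error by `g` and enlarges the permitted bound by `g²`, so
  -- the reduced denominator is good.
  obtain ⟨g, p₀, q₀, hg0, hcop, hp₀, hq₀⟩ := Int.exists_gcd_one' hg
  have hq0 : 0 < q₀ := by
    by_contra! hcon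
    have : q₀ * g ≤ 0 := mul_nonpos_of_nonpos_of_nonneg hcon (by positivity)
    omega
  lift q₀ to ℕ using hq0.le
  have hmq : m = g * q₀ := by
    have : (m : ℤ) = (g * q₀ : ℕ) := by rw [hq₀]; push_cast; ring
    exact_mod_cast this
  have hmR : (m : ℝ) = g * q₀ := by rw [hmq]; push_cast; ring
  have hpR : (p : ℝ) = g * p₀ := by rw [hp₀]; push_cast; ring
  have e : |(m : ℝ) * α - p| = g * |(q₀ : ℝ) * α - p₀| := by
    rw [hmR, hpR, show (g : ℝ) * q₀ * α - g * p₀ = g * (q₀ * α - p₀) by ring, abs_mul, Nat.abs_cast]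
  have g1 : (1 : ℝ) ≤ g := by exact_mod_cast hg0
  have q1 : (1 : ℝ) ≤ q₀ := by exact_mod_cast hq0
  have hmem : q₀ ∈ goodDenominators α := by
    refine ⟨by omega, p₀, Int.isCoprime_iff_gcd_eq_one.2 hcop, ?_⟩
    rw [e, hmR, lt_div_iff₀ (by positivity)] at h
    rw [lt_div_iff₀ (by positivity)]
    have h0 := abs_nonneg ((q₀ : ℝ) * α - p₀)
    have g3 : (1 : ℝ) ≤ g ^ 3 := one_le_pow₀ g1
    nlinarith [mul_nonneg h0 (sq_nonneg (q₀ : ℝ))]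
  obtain ⟨p₁, -, hn, hb⟩ := exists_of_mem_goodDenominators hmem
  refine ⟨q₀, hmem, g, hg0, hmq, ?_⟩
  rw [e]
  congr 1
  symm
  refine unitAddCircle_norm_eq_of_lt ?_
  have h0 := abs_nonneg ((q₀ : ℝ) * α - p₀)
  rw [e, lt_div_iff₀ (by positivity)] at h
  have m1 : (1 : ℝ) ≤ m ^ 2 := one_le_pow₀ (by exact_mod_cast hm)
  nlinarith [mul_nonneg (by positivity : (0 : ℝ) ≤ g) h0]

end RationalApproximation

/-! ### Cubic decay of the Fourier coefficients. -/

section FourierDecay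

/-- Integration by parts; the boundary term cancels by `hper`, and the spare factor `1 / (2π)` is
dropped. -/
theorem norm_fourierCoeffOn_le_deriv {f f' : ℝ → ℂ} (hf : ∀ x, HasDerivAt f (f' x) x)
    (hf' : Continuous f') (hper : f 1 = f 0) {n : ℤ} (hn : n ≠ 0) :
    ‖fourierCoeffOn zero_lt_one f n‖ ≤ ‖fourierCoeffOn zero_lt_one f' n‖ / |(n : ℝ)| := by
  rw [fourierCoeffOn_of_hasDerivAt zero_lt_one hn (fun x _ => hf x)
    (hf'.intervalIntegrable _ _), hper]
  have h1 : (0 : ℝ) < |(n : ℝ)| := abs_pos.2 (by exact_mod_cast hn)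
  simp only [sub_self, mul_zero, zero_sub, norm_mul, norm_div, norm_neg, norm_one, Complex.ofReal_one,
    Complex.ofReal_zero, sub_zero, one_mul, Complex.norm_I, mul_one, Complex.norm_intCast]
  rw [div_mul_eq_mul_div, one_mul]
  gcongr
  rw [Complex.norm_real, Real.norm_of_nonneg Real.pi_pos.le]
  have := Real.pi_gt_three
  simp
  nlinarith

/-- The Fourier coefficients of a `C³` function decay like `m⁻³`. -/
theorem exists_roofCoeff_le {φ : UnitAddCircle → ℝ}
    (hφ : ContDiff ℝ 3 (fun x : ℝ => φ (x : UnitAddCircle))) :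
    ∃ K : ℝ, 0 ≤ K ∧ ∀ m : ℤ, m ≠ 0 → ‖roofCoeff φ m‖ ≤ K / |(m : ℝ)| ^ 3 := by
  set f : ℝ → ℂ := fun x => ((φ (x : UnitAddCircle) : ℝ) : ℂ) with hf
  have hfC : ContDiff ℝ 3 f := Complex.ofRealCLM.contDiff.comp hφ
  have hper : ∀ k : ℕ, iteratedDeriv k f 1 = iteratedDeriv k f 0 := by
    intro k
    have h1 : (fun x => f (x + 1)) = f := by
      funext x
      simp [hf]
    have h2 := congrFun (iteratedDeriv_comp_add_const k f 1) 0
    rw [h1, zero_add] at h2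
    exact h2.symm
  have hder : ∀ k : ℕ, k < 3 → ∀ x, HasDerivAt (iteratedDeriv k f) (iteratedDeriv (k + 1) f x) x := by
    intro k hk x
    rw [iteratedDeriv_succ]
    refine DifferentiableAt.hasDerivAt ?_
    exact (hfC.differentiable_iteratedDeriv k (by exact_mod_cast hk)) x
  have hcont : ∀ k : ℕ, k ≤ 3 → Continuous (iteratedDeriv k f) := fun k hk =>
    hfC.continuous_iteratedDeriv k (by exact_mod_cast hk)
  have hstep : ∀ k : ℕ, k < 3 → ∀ m : ℤ, m ≠ 0 →
      ‖fourierCoeffOn zero_lt_one (iteratedDeriv k f) m‖ ≤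
        ‖fourierCoeffOn zero_lt_one (iteratedDeriv (k + 1) f) m‖ / |(m : ℝ)| := fun k hk m hm =>
    norm_fourierCoeffOn_le_deriv (hder k hk) (hcont (k + 1) hk) (hper k) hm
  obtain ⟨K, hK⟩ := isCompact_Icc.exists_bound_of_continuousOn (s := Set.Icc (0 : ℝ) 1)
    (hcont 3 le_rfl).continuousOn
  have hK0 : 0 ≤ K := (norm_nonneg _).trans (hK 0 (by simp))
  have hlast : ∀ m : ℤ, ‖fourierCoeffOn zero_lt_one (iteratedDeriv 3 f) m‖ ≤ K := by
    intro m
    rw [fourierCoeffOn_eq_integral]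
    simp only [sub_zero, one_div, inv_one, one_smul]
    have := intervalIntegral.norm_integral_le_of_norm_le_const (a := 0) (b := 1) (C := K)
      (f := fun x : ℝ => (fourier (-m) (x : AddCircle (1 - 0 : ℝ)) : ℂ) • iteratedDeriv 3 f x)
      (fun x hx => by
        rw [norm_smul]
        rw [Set.uIoc_of_le zero_le_one] at hx
        have h1 : ‖(fourier (-m) (x : AddCircle (1 - 0 : ℝ)) : ℂ)‖ = 1 := Circle.norm_coe _
        rw [h1, one_mul]
        exact hK x ⟨hx.1.le, hx.2⟩)
    simpa using this
  refine ⟨K, hK0, fun m hm => ?_⟩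
  have h0 : roofCoeff φ m = fourierCoeffOn zero_lt_one (iteratedDeriv 0 f) m := by
    rw [roofCoeff, fourierCoeff_eq_intervalIntegral _ _ 0, fourierCoeffOn_eq_integral]
    simp [hf]
  have hm' : (0 : ℝ) < |(m : ℝ)| := abs_pos.2 (by exact_mod_cast hm)
  rw [h0]
  calc _ ≤ _ := hstep 0 (by norm_num) m hm
    _ ≤ (‖fourierCoeffOn zero_lt_one (iteratedDeriv 2 f) m‖ / |(m : ℝ)|) / |(m : ℝ)| := by
        gcongr; exact hstep 1 (by norm_num) m hm
    _ ≤ ((K / |(m : ℝ)|) / |(m : ℝ)|) / |(m : ℝ)| := by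
        gcongr; exact (hstep 2 (by norm_num) m hm).trans (by gcongr; exact hlast m)
    _ = K / |(m : ℝ)| ^ 3 := by field_simp

end FourierDecay

/-! ### Characters of the circle and the distance to zero. -/

section CircleCharacters

/-- Two-sided comparison of `|e(z) - 1|` with the distance of `z` to zero. -/
theorem norm_fourier_one_sub_one (z : UnitAddCircle) :
    4 * ‖z‖ ≤ ‖fourier 1 z - 1‖ ∧ ‖fourier 1 z - 1‖ ≤ 2 * Real.pi * ‖z‖ := by
  induction z using QuotientAddGroup.induction_on with
  | H x =>
    change 4 * ‖(x : UnitAddCircle)‖ ≤ ‖fourier 1 (x : UnitAddCircle) - 1‖ ∧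
      ‖fourier 1 (x : UnitAddCircle) - 1‖ ≤ 2 * Real.pi * ‖(x : UnitAddCircle)‖
    set y := x - round x with hy
    have hxy : (x : UnitAddCircle) = (y : UnitAddCircle) := by
      rw [hy, AddCircle.coe_sub, eq_comm, sub_eq_self]
      exact AddCircle.coe_eq_zero_iff 1 |>.2 ⟨round x, by simp⟩
    have habs : |y| ≤ 1 / 2 := abs_sub_round x
    have h1 : ‖(x : UnitAddCircle)‖ = |y| := UnitAddCircle.norm_eq
    have h2 : ‖fourier 1 (x : UnitAddCircle) - 1‖ = 2 * |Real.sin (Real.pi * y)| := by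
      rw [hxy, fourier_coe_apply]
      have := Complex.norm_exp_I_mul_ofReal_sub_one (2 * Real.pi * y)
      rw [show (2 * Real.pi * y) / 2 = Real.pi * y by ring] at this
      rw [Real.norm_eq_abs, abs_mul, abs_two] at this
      rw [← this]
      congr 3
      push_cast
      ring
    rw [h1, h2]
    have hpi := Real.pi_pos
    have h3 : |Real.pi * y| = Real.pi * |y| := by rw [abs_mul, abs_of_pos hpi]
    constructor
    · have := Real.mul_abs_le_abs_sin (x := Real.pi * y) (by rw [h3]; nlinarith)
      rw [h3, ← mul_assoc, div_mul_cancel₀ _ hpi.ne'] at this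
      linarith
    · have := Real.abs_sin_le_abs (x := Real.pi * y)
      rw [h3] at this
      linarith

theorem fourier_eq_fourier_one (m : ℤ) (z : UnitAddCircle) : fourier m z = fourier 1 (m • z) := by
  simp [fourier_apply]

theorem fourier_apply_add (m : ℤ) (x y : UnitAddCircle) :
    (fourier m (x + y) : ℂ) = fourier m x * fourier m y := by
  simp [fourier_apply, smul_add, AddCircle.toCircle_add]

theorem norm_fourier_apply (m : ℤ) (x : UnitAddCircle) : ‖(fourier m x : ℂ)‖ = 1 :=
  Circle.norm_coe _

theorem zsmul_coe_unitAddCircle (m : ℤ) (α : ℝ) :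
    m • (α : UnitAddCircle) = (((m : ℝ) * α : ℝ) : UnitAddCircle) := by
  rw [← AddCircle.coe_zsmul, zsmul_eq_mul]

theorem norm_fourier_sub_one (m : ℤ) (α : ℝ) :
    4 * ‖(((m : ℝ) * α : ℝ) : UnitAddCircle)‖ ≤ ‖fourier m (α : UnitAddCircle) - 1‖ ∧
      ‖fourier m (α : UnitAddCircle) - 1‖ ≤
        2 * Real.pi * ‖(((m : ℝ) * α : ℝ) : UnitAddCircle)‖ := by
  rw [fourier_eq_fourier_one, zsmul_coe_unitAddCircle]
  exact norm_fourier_one_sub_one _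

end CircleCharacters

/-! ### Square summability of the small divisor ratios off the good denominators. -/

section RoofCoefficients

variable {α : ℝ} {φ : UnitAddCircle → ℝ}

/-- The ratio `|c_m| / ‖m α‖`. -/
noncomputable def coeffRatio (α : ℝ) (φ : UnitAddCircle → ℝ) (m : ℤ) : ℝ :=
  ‖roofCoeff φ m‖ / ‖(((m : ℝ) * α : ℝ) : UnitAddCircle)‖

theorem coeffRatio_nonneg (m : ℤ) : 0 ≤ coeffRatio α φ m := by
  unfold coeffRatio; positivity

theorem roofCoeff_neg (m : ℤ) : roofCoeff φ (-m) = starRingEnd ℂ (roofCoeff φ m) := by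
  rw [roofCoeff, roofCoeff, fourierCoeff, fourierCoeff, ← integral_conj]
  refine integral_congr_ae (ae_of_all _ fun x => ?_)
  simp only [smul_eq_mul, map_mul, Complex.conj_ofReal, ← fourier_neg, neg_neg]

/-- `φ` is real; sums over `ℤ` thereby reduce to sums over `ℕ`. -/
theorem coeffRatio_neg (m : ℤ) : coeffRatio α φ (-m) = coeffRatio α φ m := by
  rw [coeffRatio, coeffRatio, roofCoeff_neg, RCLike.norm_conj]
  congr 1
  rw [← norm_neg, ← AddCircle.coe_neg]
  push_cast
  ring_nf

theorem coeffRatio_natCast (m : ℕ) : coeffRatio α φ m =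
    ‖roofCoeff φ m‖ / ‖(((m : ℝ) * α : ℝ) : UnitAddCircle)‖ := by
  rw [coeffRatio, Int.cast_natCast]

theorem summable_norm_roofCoeff_sq {K : ℝ}
    (hK : ∀ m : ℤ, m ≠ 0 → ‖roofCoeff φ m‖ ≤ K / |(m : ℝ)| ^ 3) :
    Summable fun m : ℕ => ‖roofCoeff φ m‖ ^ 2 := by
  have h1 : Summable fun m : ℕ => K ^ 2 * (1 / (m : ℝ) ^ 6) :=
    (Real.summable_one_div_nat_pow.2 (by norm_num)).mul_left _
  rw [← summable_nat_add_iff 1] at h1 ⊢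
  refine h1.of_nonneg_of_le (fun _ => by positivity) fun m => ?_
  have h2 := hK ((m + 1 : ℕ) : ℤ) (by omega)
  calc _ ≤ (K / |(((m + 1 : ℕ) : ℤ) : ℝ)| ^ 3) ^ 2 := by gcongr
    _ = _ := by
      rw [Int.cast_natCast, Nat.abs_cast, div_pow, ← pow_mul]
      ring

/-- Outside the good denominators the ratios are square summable. -/
theorem summable_coeffRatio_sq (hα : Irrational α) {K : ℝ}
    (hK : ∀ m : ℤ, m ≠ 0 → ‖roofCoeff φ m‖ ≤ K / |(m : ℝ)| ^ 3)
    (hreg : RegularCoeffs (roofCoeff φ)) {b : ℝ} (hb : ∀ m : ℕ, coeffRatio α φ m ≤ b) :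
    Summable fun m : ℕ => (goodDenominators α)ᶜ.indicator (fun m : ℕ => coeffRatio α φ m ^ 2) m := by
  classical
  obtain ⟨C, hC, hCle⟩ := hreg
  set d : ℕ → ℝ := fun m => ‖(((m : ℝ) * α : ℝ) : UnitAddCircle)‖ with hd
  set P := goodDenominators α
  -- The well approximated indices that are not good denominators, hence proper multiples of good
  -- ones.
  set B : Set ℕ := {m | 1 ≤ m ∧ m ∉ P ∧ d m < 1 / (2 * (m : ℝ) ^ 2)} with hB
  have hratio : ∀ m : ℕ, coeffRatio α φ m = ‖roofCoeff φ m‖ / d m := coeffRatio_natCast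
  have hc2 := summable_norm_roofCoeff_sq hK
  -- `(q, l)` stands for the index `(l + 2) * q`, as in `RegularCoeffs`. The divisor is `d q`, a
  -- lower bound for `d ((l + 2) * q)` where the index lies in `B`; the sum over `l` is then at most
  -- `C q` times a bounded ratio squared.
  let G : ℕ × ℕ → ℝ := fun z => P.indicator
    (fun q => ‖roofCoeff φ (((z.2 + 2) * q : ℕ) : ℤ)‖ ^ 2 / d q ^ 2) z.1
  have hG0 : 0 ≤ G := fun z => Set.indicator_nonneg (fun q _ => by positivity) _
  have hinj : ∀ q ∈ P, Summable fun l : ℕ => ‖roofCoeff φ (((l + 2) * q : ℕ) : ℤ)‖ ^ 2 := by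
    intro q hq
    refine hc2.comp_injective (i := fun l : ℕ => (l + 2) * q) fun l l' h => ?_
    have h1 : (l + 2) * q = (l' + 2) * q := h
    have := Nat.eq_of_mul_eq_mul_right (by have := hq.1; omega) h1
    omega
  have hG : Summable G := by
    rw [summable_prod_of_nonneg hG0]
    constructor
    · intro q
      by_cases hq : q ∈ P
      · simp only [G, Set.indicator_of_mem hq]
        exact (hinj q hq).div_const _
      · simp only [G, Set.indicator_of_notMem hq]
        exact summable_zero
    · refine (hC.abs.mul_right (b ^ 2)).of_nonneg_of_le (fun q => tsum_nonneg fun l => hG0 (q, l))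
        fun q => ?_
      by_cases hq : q ∈ P
      · simp only [G, Set.indicator_of_mem hq]
        rw [tsum_div_const]
        have h1 := hCle q hq.1
        calc _ ≤ (C q * ‖roofCoeff φ q‖ ^ 2) / d q ^ 2 := by gcongr
          _ = C q * coeffRatio α φ q ^ 2 := by rw [hratio, div_pow, mul_div_assoc]
          _ ≤ |C q| * b ^ 2 := by
            gcongr
            · exact le_abs_self _
            · exact coeffRatio_nonneg _
            · exact hb q
      · simp only [G, Set.indicator_of_notMem hq, tsum_zero]
        positivity
  have hbad : Summable (B.indicator fun m : ℕ => coeffRatio α φ m ^ 2) := by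
    rw [← summable_subtype_iff_indicator]
    have hex : ∀ m : B, ∃ z : ℕ × ℕ, z.1 ∈ P ∧ (m : ℕ) = (z.2 + 2) * z.1 ∧
        d m = (z.2 + 2 : ℕ) * d z.1 := by
      rintro ⟨m, hm1, hmP, hmd⟩
      obtain ⟨q, hq, l, hl, hml, hdl⟩ := exists_goodDenominator_of_lt hm1 hmd
      have hl2 : 2 ≤ l := by
        by_contra! hcon
        have : l = 1 := by omega
        rw [this, one_mul] at hml
        exact hmP (hml ▸ hq)
      refine ⟨(q, l - 2), hq, ?_, ?_⟩
      · simp only [Nat.sub_add_cancel hl2, hml]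
      · simp only [Nat.sub_add_cancel hl2]
        exact hdl
    choose i hiP him hid using hex
    have hi : Function.Injective i := by
      intro m m' h
      apply Subtype.ext
      rw [him, him, h]
    refine (hG.comp_injective hi).of_nonneg_of_le (fun m => sq_nonneg _) fun m => ?_
    simp only [Function.comp_apply, G, Set.indicator_of_mem (hiP m)]
    rw [hratio, div_pow, ← him m]
    have hdpos : 0 < d (i m).1 := norm_nat_mul_pos hα (hiP m).1
    gcongr
    rw [hid m]
    have : (1 : ℝ) ≤ ((i m).2 + 2 : ℕ) := by push_cast; linarith [(Nat.cast_nonneg (i m).2 : (0 : ℝ) ≤ _)]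
    nlinarith
  have hrest : Summable fun m : ℕ => (2 * K) ^ 2 * (1 / (m : ℝ) ^ 2) :=
    (Real.summable_one_div_nat_pow.2 (by norm_num)).mul_left _
  refine (hbad.add hrest).of_nonneg_of_le
    (fun m => Set.indicator_nonneg (fun _ _ => sq_nonneg _) _) fun m => ?_
  have hnn : 0 ≤ (2 * K) ^ 2 * (1 / (m : ℝ) ^ 2) := by positivity
  have hnn' : 0 ≤ B.indicator (fun m : ℕ => coeffRatio α φ m ^ 2) m :=
    Set.indicator_nonneg (fun _ _ => sq_nonneg _) _
  by_cases hmP : m ∈ P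
  · rw [Set.indicator_of_notMem (by simpa using hmP)]
    linarith
  rw [Set.indicator_of_mem (by simpa using hmP)]
  -- At `m = 0` the divisor vanishes and the ratio is `0` by the convention for division.
  rcases Nat.eq_zero_or_pos m with rfl | hm
  · rw [hratio]
    have : d 0 = 0 := by simp [hd]
    rw [this, div_zero]
    simpa using hnn'
  by_cases hmB : d m < 1 / (2 * (m : ℝ) ^ 2)
  · rw [Set.indicator_of_mem (show m ∈ B from ⟨hm, hmP, hmB⟩)]
    linarith
  · push Not at hmB
    have hm0 : (0 : ℝ) < m := by exact_mod_cast hm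
    have h1 := hK m (by omega)
    rw [Int.cast_natCast, Nat.abs_cast] at h1
    -- Cubic decay of the coefficient against a divisor of size at least `1 / (2 m²)`.
    have h2 : coeffRatio α φ m ≤ 2 * K / m := by
      rw [hratio]
      calc _ ≤ (K / (m : ℝ) ^ 3) / (1 / (2 * (m : ℝ) ^ 2)) :=
            div_le_div₀ ((norm_nonneg _).trans h1) h1 (by positivity) hmB
        _ = _ := by field_simp
    have h3 : coeffRatio α φ m ^ 2 ≤ (2 * K / m) ^ 2 := by
      gcongr
      exact coeffRatio_nonneg _
    have h4 : (2 * K / (m : ℝ)) ^ 2 = (2 * K) ^ 2 * (1 / (m : ℝ) ^ 2) := by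
      rw [div_pow]; ring
    linarith

/-- Over the good denominators the squares of the ratios are not summable. -/
theorem not_summable_coeffRatio_sq
    (hS : Summable fun m : ℕ =>
      (goodDenominators α)ᶜ.indicator (fun m : ℕ => coeffRatio α φ m ^ 2) m)
    (hsum : ¬ Summable (fun m : {m : ℤ // m ≠ 0} =>
      (‖roofCoeff φ (m : ℤ)‖ / ‖(((((m : ℤ) : ℝ) * α : ℝ)) : UnitAddCircle)‖) ^ 2)) :
    ¬ Summable fun m : ℕ =>
      (goodDenominators α).indicator (fun m : ℕ => coeffRatio α φ m ^ 2) m := by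
  intro hP
  apply hsum
  have h1 : Summable fun m : ℕ => coeffRatio α φ m ^ 2 := by
    refine (hP.add hS).congr fun m => ?_
    exact congrFun (Set.indicator_self_add_compl (goodDenominators α)
      (fun m : ℕ => coeffRatio α φ m ^ 2)) m
  have h2 : Summable fun m : ℤ => coeffRatio α φ m ^ 2 :=
    Summable.of_nat_of_neg h1 (by simpa only [coeffRatio_neg] using h1)
  exact h2.comp_injective Subtype.val_injective

/-- The ratios over all integers whose absolute value is not a good denominator are square
summable. -/
theorem summable_coeffRatio_sq_int (hS : Summable fun m : ℕ =>
      (goodDenominators α)ᶜ.indicator (fun m : ℕ => coeffRatio α φ m ^ 2) m) :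
    Summable fun m : ℤ =>
      {m : ℤ | m.natAbs ∉ goodDenominators α}.indicator (fun m : ℤ => coeffRatio α φ m ^ 2) m := by
  refine Summable.of_nat_of_neg (hS.congr fun m => ?_) (hS.congr fun m => ?_)
  · by_cases hm : m ∈ goodDenominators α <;> simp [hm]
  · by_cases hm : m ∈ goodDenominators α <;> simp [hm, coeffRatio_neg]

end RoofCoefficients

open scoped ENNReal

/-! ### Removing an `L²` coboundary from the roof. -/

section Cohomology

variable {α : ℝ} {φ : UnitAddCircle → ℝ}

theorem haarAddCircle_eq_volume :
    (AddCircle.haarAddCircle : Measure UnitAddCircle) = volume := by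
  rw [AddCircle.volume_eq_smul_haarAddCircle]
  simp

/-- If `r m = w m (e(m α) - 1)` with `r` summable and `w` square summable, then `∑ r m e(m x)` is
the coboundary of an `L²` function. -/
theorem exists_coboundary_of_coeffs (α : ℝ) {r w : ℤ → ℂ} (hr : Summable fun m => ‖r m‖)
    (hw : Summable fun m => ‖w m‖ ^ 2)
    (hrw : ∀ m, r m = w m * (fourier m (α : UnitAddCircle) - 1)) :
    ∃ W : UnitAddCircle → ℂ, Measurable W ∧
      ∀ᵐ x : UnitAddCircle, ∑' m, r m * fourier m x = W (x + (α : UnitAddCircle)) - W x := by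
  let μ : Measure UnitAddCircle := AddCircle.haarAddCircle
  have hmem : Memℓp w 2 := memℓp_gen (by simpa using hw)
  -- `W` has Fourier coefficients `w`. Rotation multiplies the `m`-th one by `e(mα)`, so `R W - W`
  -- has coefficients `r`.
  let W : Lp ℂ 2 μ := fourierBasis.repr.symm ⟨w, hmem⟩
  have hW : HasSum (fun m => w m • (fourierLp 2 m : Lp ℂ 2 μ)) W := by
    have := (fourierBasis (T := 1)).hasSum_repr W
    simpa [W, coe_fourierBasis] using this
  have hmp : MeasurePreserving (fun x : UnitAddCircle => x + (α : UnitAddCircle)) μ μ :=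
    measurePreserving_add_right _ _
  let R : Lp ℂ 2 μ →L[ℂ] Lp ℂ 2 μ :=
    (Lp.compMeasurePreservingₗᵢ ℂ _ hmp).toContinuousLinearMap
  have hRcoe : ∀ f : Lp ℂ 2 μ, R f =ᵐ[μ] fun x => f (x + (α : UnitAddCircle)) := fun f =>
    Lp.coeFn_compMeasurePreserving f hmp
  have hRf : ∀ m : ℤ, R (fourierLp 2 m) = (fourier m (α : UnitAddCircle) : ℂ) • fourierLp 2 m := by
    intro m
    refine Lp.ext ?_
    filter_upwards [hRcoe (fourierLp 2 m), Lp.coeFn_smul (fourier m (α : UnitAddCircle) : ℂ)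
      (fourierLp 2 m : Lp ℂ 2 μ), coeFn_fourierLp 2 m,
      hmp.quasiMeasurePreserving.ae (coeFn_fourierLp 2 m)] with x h1 h2 h3 h4
    rw [h1, h2, Pi.smul_apply, h3, h4, fourier_apply_add, smul_eq_mul, mul_comm]
  have h1 : HasSum (fun m => r m • (fourierLp 2 m : Lp ℂ 2 μ)) (R W - W) := by
    refine ((R.hasSum hW).sub hW).congr_fun ?_
    intro m
    rw [map_smul, hRf, hrw, smul_smul, ← sub_smul]
    congr 1
    ring
  let ρ : C(UnitAddCircle, ℂ) := ∑' m, r m • fourier m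
  have hρ : HasSum (fun m => r m • (fourier m : C(UnitAddCircle, ℂ))) ρ := by
    refine Summable.hasSum (Summable.of_norm ?_)
    simpa only [norm_smul, fourier_norm, mul_one] using hr
  have h2 : HasSum (fun m => r m • (fourierLp 2 m : Lp ℂ 2 μ))
      (ContinuousMap.toLp (E := ℂ) 2 μ ℂ ρ) := by
    refine ((ContinuousMap.toLp (E := ℂ) 2 μ ℂ).hasSum hρ).congr_fun ?_
    intro m
    rw [map_smul]
  -- The series converges uniformly to `ρ` and in `L²` to `R W - W`; this gives the pointwise
  -- identity.
  have h3 : ContinuousMap.toLp (E := ℂ) 2 μ ℂ ρ = R W - W := h2.unique h1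
  refine ⟨W, (Lp.stronglyMeasurable W).measurable, ?_⟩
  rw [← haarAddCircle_eq_volume]
  have h4 := ContinuousMap.coeFn_toLp (p := 2) (𝕜 := ℂ) μ ρ
  rw [h3] at h4
  filter_upwards [h4, Lp.coeFn_sub (R W) W, hRcoe W] with x h4 h5 h6
  have h7 : ρ x = ∑' m, r m * fourier m x := by
    have := ((ContinuousMap.evalCLM ℂ x).hasSum hρ).tsum_eq
    simpa using this.symm
  rw [← h7, ← h4, h5, Pi.sub_apply, h6]

/-- Up to an `L²` coboundary, only the good denominators contribute to the Fourier series. -/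
theorem exists_cohomologous_lacunary (hα : Irrational α) (hφ : Continuous φ) {K : ℝ}
    (hK : ∀ m : ℤ, m ≠ 0 → ‖roofCoeff φ m‖ ≤ K / |(m : ℝ)| ^ 3)
    (hS : Summable fun m : ℤ =>
      {m : ℤ | m.natAbs ∉ goodDenominators α}.indicator (fun m : ℤ => coeffRatio α φ m ^ 2) m) :
    ∃ W : UnitAddCircle → ℝ, Measurable W ∧ ∀ᵐ x, φ x = (roofCoeff φ 0).re +
      ∑' m : ℕ, (goodDenominators α).indicator
        (fun m : ℕ => 2 * (roofCoeff φ m * fourier (m : ℤ) x).re) m +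
      (W (x + (α : UnitAddCircle)) - W x) := by
  classical
  set c := roofCoeff φ with hc
  set P := goodDenominators α with hP
  have h0P : 0 ∉ P := fun h => by have := h.1; omega
  have hcs : Summable fun m : ℤ => ‖c m‖ := by
    have h1 : Summable fun m : ℤ => |K| * |(m : ℝ)| ^ (-3 : ℝ) := by
      refine Summable.mul_left _ ?_
      exact Real.summable_abs_int_rpow (by norm_num)
    rw [← (Set.finite_singleton (0 : ℤ)).summable_compl_iff] at h1 ⊢
    refine h1.of_nonneg_of_le (fun _ => norm_nonneg _) fun m => ?_
    have hm : (m : ℤ) ≠ 0 := m.2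
    refine (hK m hm).trans ?_
    rw [Function.comp_apply, Real.rpow_neg (abs_nonneg _), div_eq_mul_inv]
    norm_cast
    gcongr
    exact le_abs_self _
  -- The part to be removed: all frequencies except zero and the good denominators with either sign.
  set r : ℤ → ℂ := fun m => if m = 0 ∨ m.natAbs ∈ P then 0 else c m with hr
  set w : ℤ → ℂ := fun m => r m / (fourier m (α : UnitAddCircle) - 1) with hw
  have hrle : ∀ m, ‖r m‖ ≤ ‖c m‖ := by
    intro m
    simp only [hr]
    split_ifs <;> simp
  have hd : ∀ m : ℤ, m ≠ 0 → 0 < ‖(((m : ℝ) * α : ℝ) : UnitAddCircle)‖ := by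
    intro m hm
    rw [UnitAddCircle.norm_eq, abs_pos, sub_ne_zero]
    exact (hα.intCast_mul hm).ne_int _
  have hd' : ∀ m : ℤ, m ≠ 0 → fourier m (α : UnitAddCircle) - 1 ≠ 0 := by
    intro m hm h
    have h1 := (norm_fourier_sub_one m α).1
    have h2 := hd m hm
    rw [h, norm_zero] at h1
    linarith
  obtain ⟨W, hWm, hW⟩ := exists_coboundary_of_coeffs α (r := r) (w := w)
    (hcs.of_nonneg_of_le (fun _ => norm_nonneg _) hrle)
    (by
      refine hS.of_nonneg_of_le (fun _ => by positivity) fun m => ?_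
      by_cases hm : m = 0 ∨ m.natAbs ∈ P
      · have : w m = 0 := by simp [hw, hr, hm]
        rw [this]
        simpa using Set.indicator_nonneg (fun _ _ => sq_nonneg _) _
      · push Not at hm
        rw [Set.indicator_of_mem (show m ∈ {m : ℤ | m.natAbs ∉ P} from hm.2)]
        have h1 : r m = c m := by simp [hr, hm]
        have h2 := hd m hm.1
        have h3 := (norm_fourier_sub_one m α).1
        simp only [hw]
        rw [h1, norm_div, coeffRatio]
        gcongr
        linarith)
    (by
      intro m
      by_cases hm : m = 0
      · simp [hr, hm]
      · simp only [hw]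
        rw [div_mul_cancel₀ _ (hd' m hm)])
  refine ⟨fun x => (W x).re, Complex.measurable_re.comp hWm, ?_⟩
  let f : C(UnitAddCircle, ℂ) := ⟨fun x => (φ x : ℂ), by fun_prop⟩
  filter_upwards [hW] with x hx
  have hf : HasSum (fun m : ℤ => c m * fourier m x) (φ x : ℂ) :=
    has_pointwise_sum_fourier_series_of_summable (f := f) hcs.of_norm x
  have hrs : HasSum (fun m : ℤ => r m * fourier m x) (W (x + (α : UnitAddCircle)) - W x) := by
    rw [← hx]
    refine Summable.hasSum (Summable.of_norm ?_)
    simp only [norm_mul, norm_fourier_apply, mul_one]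
    exact hcs.of_nonneg_of_le (fun _ => norm_nonneg _) hrle
  have hsub := hf.sub hrs
  have hnat := hsub.nat_add_neg
  -- Pairing `n` with `-n` counts the zero mode twice, which is corrected here.
  have hsingle : HasSum (fun n : ℕ => if n = 0 then 2 * c 0 else 0) (2 * c 0) := by
    simpa using hasSum_ite_eq 0 (2 * c 0)
  have hfin : HasSum (fun n : ℕ => P.indicator
      (fun n : ℕ => ((2 * (c n * fourier (n : ℤ) x).re : ℝ) : ℂ)) n)
      ((φ x : ℂ) - (W (x + (α : UnitAddCircle)) - W x) - c 0) := by
    convert! hnat.sub hsingle using 1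
    · funext n
      rcases Nat.eq_zero_or_pos n with rfl | hn
      · rw [Set.indicator_of_notMem h0P]
        simp [hr]
        ring
      have hn0 : n ≠ 0 := by omega
      by_cases hnP : n ∈ P
      · have e1 : r n = 0 := by simp [hr, hnP]
        have e2 : r (-n) = 0 := by simp [hr, hnP]
        have e3 : c (-n) * fourier (-n : ℤ) x = starRingEnd ℂ (c n * fourier (n : ℤ) x) := by
          rw [map_mul, hc, roofCoeff_neg, fourier_neg]
        rw [Set.indicator_of_mem hnP, e1, e2, e3, if_neg hn0, zero_mul, zero_mul, sub_zero, sub_zero,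
          sub_zero, Complex.add_conj]
      · have e1 : r n = c n := by simp [hr, hnP, hn0]
        have e2 : r (-n) = c (-n) := by simp [hr, hnP, hn0]
        rw [Set.indicator_of_notMem hnP, e1, e2, if_neg hn0]
        ring
    · simp [hr]
      ring
  have hre := Complex.hasSum_re hfin
  have hre' : HasSum (fun n : ℕ => P.indicator
      (fun n : ℕ => 2 * (c n * fourier (n : ℤ) x).re) n)
      (φ x - ((W (x + (α : UnitAddCircle))).re - (W x).re) - (c 0).re) := by
    convert! hre using 1
    funext n
    by_cases hnP : n ∈ P
    · rw [Set.indicator_of_mem hnP, Set.indicator_of_mem hnP, Complex.ofReal_re]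
    · rw [Set.indicator_of_notMem hnP, Set.indicator_of_notMem hnP, Complex.zero_re]
  rw [hre'.tsum_eq]
  ring

end Cohomology

/-! ### Decorrelation of fast oscillations, and the characteristic function of one wave. -/

section OscillatoryIntegrals

theorem volume_real_univ_unitAddCircle : (volume : Measure UnitAddCircle).real Set.univ = 1 := by
  rw [measureReal_def, UnitAddCircle.measure_univ, ENNReal.toReal_one]

/-- A function which oscillates at frequency `q` is almost uncorrelated with a Lipschitz
function. -/
theorem norm_integral_mul_sub_le {A B : UnitAddCircle → ℂ} (hA : Continuous A) (hB : Continuous B)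
    {L : ℝ} (hL : 0 ≤ L) (hLip : ∀ x y, ‖A x - A y‖ ≤ L * ‖x - y‖) (hB1 : ∀ x, ‖B x‖ ≤ 1)
    {q : ℕ} (hq : 1 ≤ q)
    (hper : ∀ x, B (x + (((q : ℝ)⁻¹ : ℝ) : UnitAddCircle)) = B x) :
    ‖(∫ x, A x * B x) - (∫ x, A x) * ∫ x, B x‖ ≤ L / q := by
  set e : UnitAddCircle := (((q : ℝ)⁻¹ : ℝ) : UnitAddCircle) with he
  have hq0 : (0 : ℝ) < q := by exact_mod_cast hq
  have hperz : ∀ (j : ℤ) (x), B (x + j • e) = B x := by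
    intro j x
    have hp : Function.Periodic B e := hper
    exact hp.zsmul j x
  have hInt : ∀ {f : UnitAddCircle → ℂ}, Continuous f → Integrable f := fun hf =>
    hf.integrable_of_hasCompactSupport (HasCompactSupport.of_compactSpace _)
  have hshift : ∀ u : UnitAddCircle,
      ‖(∫ x, A x * B x) - ∫ x, A (x + u) * B x‖ ≤ L / q := by
    intro u
    -- Shifts by multiples of `1 / q` do not affect `B`, so any translation of `A` can be replaced
    -- by one of length at most `1 / q`.
    obtain ⟨j, hj⟩ : ∃ j : ℤ, ‖u - j • e‖ ≤ (q : ℝ)⁻¹ := by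
      induction u using QuotientAddGroup.induction_on with
      | H y =>
        refine ⟨⌊y * q⌋, ?_⟩
        change ‖(y : UnitAddCircle) - ⌊y * q⌋ • e‖ ≤ (q : ℝ)⁻¹
        rw [he, zsmul_coe_unitAddCircle, ← AddCircle.coe_sub]
        refine (unitAddCircle_norm_le _ 0).trans ?_
        have h1 := Int.floor_le (y * q)
        have h2 := (Int.lt_floor_add_one (y * q)).le
        have h3 : y - (⌊y * q⌋ : ℝ) * (q : ℝ)⁻¹ - ((0 : ℤ) : ℝ) = (y * q - ⌊y * q⌋) * (q : ℝ)⁻¹ := by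
          field_simp; simp
        rw [h3, abs_mul, abs_of_nonneg (by linarith), abs_of_pos (inv_pos.2 hq0)]
        exact mul_le_of_le_one_left (by positivity) (by linarith)
    have h1 : ∫ x, A (x + u) * B x = ∫ x, A (x + (u - j • e)) * B x := by
      rw [← integral_add_right_eq_self (fun x => A (x + (u - j • e)) * B x) (j • e)]
      refine integral_congr_ae (ae_of_all _ fun x => ?_)
      simp only [hperz]
      congr 2
      abel
    rw [h1, ← integral_sub (hInt (by fun_prop)) (hInt (by fun_prop))]
    refine (norm_integral_le_of_norm_le_const (C := L / q) (ae_of_all _ fun x => ?_)).trans ?_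
    · rw [← sub_mul, norm_mul]
      calc _ ≤ ‖A x - A (x + (u - j • e))‖ * 1 := by gcongr; exact hB1 x
        _ ≤ L * ‖x - (x + (u - j • e))‖ := by rw [mul_one]; exact hLip _ _
        _ = L * ‖u - j • e‖ := by rw [← norm_neg]; congr 2; abel
        _ ≤ L / q := by rw [div_eq_mul_inv]; gcongr
    · rw [volume_real_univ_unitAddCircle, mul_one]
  -- Averaging over all translations decouples the two factors exactly.
  have hfub : ∫ u, ∫ x, A (x + u) * B x = (∫ x, A x) * ∫ x, B x := by
    rw [integral_integral_swap]
    · simp_rw [integral_mul_const, integral_add_left_eq_self A]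
      rw [integral_const_mul]
    · exact Continuous.integrable_of_hasCompactSupport (by fun_prop)
        (HasCompactSupport.of_compactSpace _)
  have hcont : Continuous fun u => ∫ x, A (x + u) * B x := by
    have := continuous_parametric_integral_of_continuous (μ := volume)
      (f := fun u x => A (x + u) * B x) (by fun_prop) isCompact_univ
    simpa using this
  rw [← hfub]
  have h1 : (∫ x, A x * B x) - ∫ u, ∫ x, A (x + u) * B x =
      ∫ u, ((∫ x, A x * B x) - ∫ x, A (x + u) * B x) := by
    rw [integral_sub (integrable_const _) (hInt hcont), integral_const,
      volume_real_univ_unitAddCircle, one_smul]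
  rw [h1]
  refine (norm_integral_le_of_norm_le_const (C := L / q) (ae_of_all _ hshift)).trans ?_
  rw [volume_real_univ_unitAddCircle, mul_one]

theorem integral_fourier_eq_zero {m : ℤ} (hm : m ≠ 0) :
    ∫ x : UnitAddCircle, (fourier m x : ℂ) = 0 := by
  have h1 := congrFun (fourierCoeff_fourier (T := 1) m) 0
  rw [fourierCoeff, haarAddCircle_eq_volume, Pi.single_eq_of_ne hm.symm] at h1
  simpa using h1

/-- The oscillation `Re (d e^{2π i q x})`. -/
noncomputable def wave (d : ℂ) (q : ℕ) (x : UnitAddCircle) : ℝ := (d * fourier (q : ℤ) x).re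

theorem continuous_wave (d : ℂ) (q : ℕ) : Continuous (wave d q) := by
  unfold wave
  fun_prop

theorem abs_wave_le (d : ℂ) (q : ℕ) (x : UnitAddCircle) : |wave d q x| ≤ ‖d‖ := by
  refine (Complex.abs_re_le_norm _).trans ?_
  rw [norm_mul, norm_fourier_apply, mul_one]

theorem abs_wave_sub_le (d : ℂ) (q : ℕ) (x y : UnitAddCircle) :
    |wave d q x - wave d q y| ≤ ‖d‖ * (2 * Real.pi * q) * ‖x - y‖ := by
  have h1 : wave d q x - wave d q y =
      (d * (fourier (q : ℤ) y * (fourier 1 ((q : ℤ) • (x - y)) - 1))).re := by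
    rw [← fourier_eq_fourier_one]
    have : (fourier (q : ℤ) x : ℂ) = fourier (q : ℤ) y * fourier (q : ℤ) (x - y) := by
      rw [← fourier_apply_add, add_sub_cancel]
    rw [wave, wave, ← Complex.sub_re, this]
    congr 1
    ring
  rw [h1]
  refine (Complex.abs_re_le_norm _).trans ?_
  rw [norm_mul, norm_mul, norm_fourier_apply, one_mul, mul_assoc]
  gcongr
  refine (norm_fourier_one_sub_one _).2.trans ?_
  rw [natCast_zsmul, mul_assoc (2 * Real.pi)]
  gcongr
  exact norm_nsmul_le

theorem wave_add_inv (d : ℂ) {q : ℕ} (hq : 1 ≤ q) (x : UnitAddCircle) :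
    wave d q (x + (((q : ℝ)⁻¹ : ℝ) : UnitAddCircle)) = wave d q x := by
  have hq0 : (q : ℝ) ≠ 0 := by positivity
  rw [wave, wave, fourier_apply_add, fourier_eq_fourier_one _ (((q : ℝ)⁻¹ : ℝ) : UnitAddCircle),
    zsmul_coe_unitAddCircle, Int.cast_natCast, mul_inv_cancel₀ hq0]
  have : ((1 : ℝ) : UnitAddCircle) = 0 := AddCircle.coe_period 1
  rw [this]
  simp

theorem integral_wave (d : ℂ) {q : ℕ} (hq : 1 ≤ q) : ∫ x, wave d q x = 0 := by
  have h1 : ∫ x : UnitAddCircle, d * (fourier (q : ℤ) x : ℂ) = 0 := by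
    rw [integral_const_mul, integral_fourier_eq_zero (by omega), mul_zero]
  have hInt : Integrable fun x : UnitAddCircle => d * (fourier (q : ℤ) x : ℂ) :=
    Continuous.integrable_of_hasCompactSupport (by fun_prop) (HasCompactSupport.of_compactSpace _)
  have h2 := integral_re hInt
  rw [h1] at h2
  simpa [wave] using h2

/-- The square is `‖d‖ ^ 2 / 2` plus a wave of frequency `2q` with mean zero. -/
theorem integral_wave_sq (d : ℂ) {q : ℕ} (hq : 1 ≤ q) :
    ∫ x, wave d q x ^ 2 = ‖d‖ ^ 2 / 2 := by
  have h1 : ∀ x, wave d q x ^ 2 = ‖d‖ ^ 2 / 2 + wave (d ^ 2 / 2) (2 * q) x := by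
    intro x
    have e1 : (fourier ((2 * q : ℕ) : ℤ) x : ℂ) = fourier (q : ℤ) x ^ 2 := by
      rw [sq, ← fourier_add]; congr 2; push_cast; ring
    set z := d * (fourier (q : ℤ) x : ℂ) with hz
    have e2 : d ^ 2 / 2 * (fourier ((2 * q : ℕ) : ℤ) x : ℂ) = z * z / 2 := by rw [e1]; ring
    have e3 : ‖d‖ ^ 2 = z.re ^ 2 + z.im ^ 2 := by
      have : ‖z‖ = ‖d‖ := by rw [hz, norm_mul, norm_fourier_apply, mul_one]
      rw [← this, Complex.sq_norm, Complex.normSq_apply]; ring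
    have e4 : (z * z / 2).re = (z.re * z.re - z.im * z.im) / 2 := by
      rw [Complex.div_ofNat_re, Complex.mul_re]
    rw [wave, wave, e2, e4, e3]
    ring
  simp_rw [h1]
  rw [integral_add (integrable_const _), integral_wave _ (by omega)]
  · simp [volume_real_univ_unitAddCircle]
  · exact (continuous_wave _ _).integrable_of_hasCompactSupport (HasCompactSupport.of_compactSpace _)

/-- `2 / 9 = 4 / (3! · 3)` is the constant of the cubic Taylor remainder; one factor `|u| ≤ 1` is
given away. -/
theorem norm_cexp_mul_I_sub_le {u : ℝ} (hu : |u| ≤ 1) :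
    ‖Complex.exp (u * Complex.I) - (1 + u * Complex.I - (u : ℂ) ^ 2 / 2)‖ ≤ u ^ 2 * (2 / 9) := by
  have h1 : ‖(u * Complex.I : ℂ)‖ = |u| := by simp
  have := Complex.exp_bound (x := u * Complex.I) (by rw [h1]; exact hu) (n := 3) (by norm_num)
  rw [h1] at this
  have e : ∑ m ∈ Finset.range 3, (u * Complex.I : ℂ) ^ m / (m.factorial : ℂ) =
      1 + u * Complex.I - (u : ℂ) ^ 2 / 2 := by
    simp [Finset.sum_range_succ, Nat.factorial, mul_pow]
    ring
  rw [e] at this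
  refine this.trans ?_
  norm_num [Nat.factorial]
  have h3 : |u| ^ 3 ≤ u ^ 2 := by
    rw [← sq_abs u, pow_succ]
    exact mul_le_of_le_one_right (by positivity) hu
  linarith

/-- The characteristic function of a single oscillation. -/
theorem norm_integral_cexp_wave_le (d : ℂ) {q : ℕ} (hq : 1 ≤ q) (hd : ‖d‖ ≤ 1) :
    ‖∫ x, Complex.exp (wave d q x * Complex.I)‖ ≤ Real.exp (-(‖d‖ ^ 2 / 8)) := by
  have hw := continuous_wave d q
  have hInt : ∀ {f : UnitAddCircle → ℂ}, Continuous f → Integrable f := fun hf =>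
    hf.integrable_of_hasCompactSupport (HasCompactSupport.of_compactSpace _)
  have hintR : ∀ {f : UnitAddCircle → ℝ}, Continuous f → Integrable f := fun hf =>
    hf.integrable_of_hasCompactSupport (HasCompactSupport.of_compactSpace _)
  have hmain : ∫ x, (1 + wave d q x * Complex.I - (wave d q x : ℂ) ^ 2 / 2) =
      ((1 - ‖d‖ ^ 2 / 4 : ℝ) : ℂ) := by
    have h1 : ∫ x, (wave d q x : ℂ) = 0 := by
      rw [integral_complex_ofReal, integral_wave d hq]; simp
    have h2 : ∫ x, (wave d q x : ℂ) ^ 2 = ((‖d‖ ^ 2 / 2 : ℝ) : ℂ) := by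
      rw [← integral_wave_sq d hq, ← integral_complex_ofReal]
      push_cast
      rfl
    rw [integral_sub (hInt (by fun_prop)) (hInt (by fun_prop)),
      integral_add (hInt (by fun_prop)) (hInt (by fun_prop)), integral_mul_const, h1,
      integral_div, h2, integral_const, volume_real_univ_unitAddCircle]
    push_cast
    simp only [one_smul]
    ring
  -- The total `1 - ‖d‖² / 4 + ‖d‖² / 9` is at most `1 - ‖d‖² / 8`.
  have hdiff : ‖(∫ x, Complex.exp (wave d q x * Complex.I)) - ((1 - ‖d‖ ^ 2 / 4 : ℝ) : ℂ)‖ ≤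
      ‖d‖ ^ 2 / 2 * (2 / 9) := by
    rw [← hmain, ← integral_sub (hInt (by fun_prop)) (hInt (by fun_prop)),
      ← integral_wave_sq d hq, ← integral_mul_const]
    refine norm_integral_le_of_norm_le (hintR (by fun_prop)) (ae_of_all _ fun x => ?_)
    exact norm_cexp_mul_I_sub_le ((abs_wave_le d q x).trans hd)
  have h3 : ‖((1 - ‖d‖ ^ 2 / 4 : ℝ) : ℂ)‖ = 1 - ‖d‖ ^ 2 / 4 := by
    rw [Complex.norm_real, Real.norm_of_nonneg]
    nlinarith [norm_nonneg d]
  have h4 := norm_le_norm_add_norm_sub' (∫ x, Complex.exp (wave d q x * Complex.I))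
    ((1 - ‖d‖ ^ 2 / 4 : ℝ) : ℂ)
  have h5 := Real.add_one_le_exp (-(‖d‖ ^ 2 / 8))
  rw [h3] at h4
  nlinarith [sq_nonneg ‖d‖]

end OscillatoryIntegrals

/-! ### Super-lacunary sequences: near independence of waves, and return times. -/

/-- A sequence of denominators of very good rational approximations of `α`. -/
structure SuperLacunary (α : ℝ) (q : ℕ → ℕ) : Prop where
  one_le : ∀ n, 1 ≤ q n
  lt_succ : ∀ n, q n < q (n + 1)
  sq_le : ∀ n, q n ^ 2 ≤ q (n + 1)
  norm_lt : ∀ n, ‖(((q n : ℝ) * α : ℝ) : UnitAddCircle)‖ < 1 / (2 * (q n : ℝ) ^ 2)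
  le_norm : ∀ n, 1 / (2 * (q (n + 1) : ℝ)) ≤ ‖(((q n : ℝ) * α : ℝ) : UnitAddCircle)‖

namespace SuperLacunary

variable {α : ℝ} {q : ℕ → ℕ}

theorem cast_pos (h : SuperLacunary α q) (n : ℕ) : (0 : ℝ) < q n := by
  exact_mod_cast h.one_le n

/-- Squaring gives doubling only from `2` on; for `q n = 1` strict increase does. -/
theorem two_mul_le (h : SuperLacunary α q) (n : ℕ) : 2 * q n ≤ q (n + 1) := by
  have h1 := h.one_le n
  have h2 := h.lt_succ n
  have h3 := h.sq_le n
  rcases Nat.lt_or_ge (q n) 2 with h4 | h4 <;> nlinarith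

theorem two_pow_le (h : SuperLacunary α q) (n : ℕ) : 2 ^ n ≤ q n := by
  induction n with
  | zero => simpa using h.one_le 0
  | succ n ih => have := h.two_mul_le n; rw [pow_succ]; omega

theorem two_pow_mul_le (h : SuperLacunary α q) (n : ℕ) : 2 ^ n * q n ≤ q (n + 1) :=
  (Nat.mul_le_mul_right _ (h.two_pow_le n)).trans ((sq (q n)).symm.le.trans (h.sq_le n))

theorem inv_le (h : SuperLacunary α q) (n : ℕ) : 1 / (q n : ℝ) ≤ (1 / 2) ^ n := by
  rw [one_div_pow]
  exact one_div_le_one_div_of_le (by positivity) (by exact_mod_cast h.two_pow_le n)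

theorem div_succ_le (h : SuperLacunary α q) (n : ℕ) : (q n : ℝ) / q (n + 1) ≤ (1 / 2) ^ n := by
  rw [one_div_pow, div_le_div_iff₀ (h.cast_pos _) (by positivity), one_mul, mul_comm]
  exact_mod_cast h.two_pow_mul_le n

theorem monotone (h : SuperLacunary α q) : Monotone q :=
  monotone_nat_of_le_succ fun n => (h.lt_succ n).le

theorem sum_range_le (h : SuperLacunary α q) (n : ℕ) :
    ∑ i ∈ Finset.range n, q i ≤ q n := by
  induction n with
  | zero => simp
  | succ n ih => rw [Finset.sum_range_succ]; have := h.two_mul_le n; omega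

/-- Up to `2π`, the numerator is a Lipschitz constant for sums of earlier waves of amplitude at most
one, so the quotient is the decorrelation error at frequency `q n`. -/
theorem sum_range_div_le (h : SuperLacunary α q) (n : ℕ) :
    (∑ i ∈ Finset.range n, (q i : ℝ)) / q n ≤ 4 * (1 / 2) ^ n := by
  rcases n with _ | n
  · simp
  · have h1 : ∑ i ∈ Finset.range (n + 1), (q i : ℝ) ≤ 2 * q n := by
      rw [Finset.sum_range_succ]
      have : (∑ i ∈ Finset.range n, (q i : ℝ)) ≤ q n := by exact_mod_cast h.sum_range_le n
      linarith
    calc _ ≤ 2 * (q n : ℝ) / q (n + 1) := by gcongr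
      _ = 2 * ((q n : ℝ) / q (n + 1)) := by ring
      _ ≤ 2 * (1 / 2) ^ n := by gcongr; exact h.div_succ_le n
      _ = _ := by rw [pow_succ]; ring

theorem sum_inv_le (h : SuperLacunary α q) {N M : ℕ} (hNM : N ≤ M) :
    ∑ j ∈ Finset.Ico N M, 1 / (q j : ℝ) ≤ 2 / q N := by
  -- The extra term `2 / q M` makes the induction telescope.
  have key : ∑ j ∈ Finset.Ico N M, 1 / (q j : ℝ) + 2 / q M ≤ 2 / q N := by
    induction M, hNM using Nat.le_induction with
    | base => simp
    | succ M hM ih =>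
      rw [Finset.sum_Ico_succ_top hM]
      have h1 : 2 / (q (M + 1) : ℝ) ≤ 1 / q M := by
        rw [div_le_div_iff₀ (h.cast_pos _) (h.cast_pos _), one_mul]
        exact_mod_cast h.two_mul_le M
      have h2 : 2 / (q M : ℝ) = 1 / q M + 1 / q M := by ring
      linarith
  have : 0 ≤ 2 / (q M : ℝ) := by positivity
  linarith

theorem abs_sum_wave_sub_le (d : ℕ → ℂ) (q : ℕ → ℕ) {N : ℕ} (hd : ∀ n, N ≤ n → ‖d n‖ ≤ 1) (M : ℕ)
    (x y : UnitAddCircle) :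
    |∑ n ∈ Finset.Ico N M, wave (d n) (q n) x - ∑ n ∈ Finset.Ico N M, wave (d n) (q n) y| ≤
      2 * Real.pi * (∑ i ∈ Finset.range M, (q i : ℝ)) * ‖x - y‖ := by
  rw [← Finset.sum_sub_distrib]
  refine (Finset.abs_sum_le_sum_abs _ _).trans ?_
  rw [Finset.mul_sum, Finset.sum_mul]
  refine (Finset.sum_le_sum (g := fun n => 2 * Real.pi * (q n : ℝ) * ‖x - y‖) fun n hn => ?_).trans
    (Finset.sum_le_sum_of_subset_of_nonneg ?_ fun n _ _ => mul_nonneg (by positivity) (norm_nonneg _))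
  · refine (abs_wave_sub_le _ _ _ _).trans ?_
    have h0 : 0 ≤ 2 * Real.pi * (q n : ℝ) := by positivity
    exact mul_le_mul_of_nonneg_right (mul_le_of_le_one_left h0 (hd n (Finset.mem_Ico.1 hn).1))
      (norm_nonneg _)
  · intro n hn
    rw [Finset.mem_range]
    exact (Finset.mem_Ico.1 hn).2

theorem norm_cexp_sub_cexp_le (a b : ℝ) :
    ‖Complex.exp (a * Complex.I) - Complex.exp (b * Complex.I)‖ ≤ |a - b| := by
  have h1 : Complex.exp (a * Complex.I) - Complex.exp (b * Complex.I) =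
      Complex.exp (b * Complex.I) * (Complex.exp (Complex.I * (a - b : ℝ)) - 1) := by
    rw [mul_sub, ← Complex.exp_add, mul_one]
    congr 2
    push_cast
    ring
  rw [h1, norm_mul, Complex.norm_exp_ofReal_mul_I, one_mul]
  exact Real.norm_exp_I_mul_ofReal_sub_one_le

/-- Waves along a super-lacunary sequence are almost independent. -/
theorem norm_integral_cexp_sum_wave_le (h : SuperLacunary α q) {d : ℕ → ℂ} {N : ℕ}
    (hd : ∀ n, N ≤ n → ‖d n‖ ≤ 1) {M : ℕ} (hNM : N ≤ M) :
    ‖∫ x, Complex.exp ((∑ n ∈ Finset.Ico N M, wave (d n) (q n) x : ℝ) * Complex.I)‖ ≤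
      Real.exp (-(∑ n ∈ Finset.Ico N M, ‖d n‖ ^ 2 / 8)) +
        8 * Real.pi * ∑ n ∈ Finset.Ico N M, (1 / 2 : ℝ) ^ n := by
  induction M, hNM using Nat.le_induction with
  | base => simp [volume_real_univ_unitAddCircle]
  | succ M hM ih =>
    have hcont : Continuous fun x => ∑ n ∈ Finset.Ico N M, wave (d n) (q n) x :=
      continuous_finsetSum _ fun n _ => continuous_wave _ _
    have hcw := continuous_wave (d M) (q M)
    have hdec := norm_integral_mul_sub_le
      (A := fun x => Complex.exp ((∑ n ∈ Finset.Ico N M, wave (d n) (q n) x : ℝ) * Complex.I))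
      (B := fun x => Complex.exp (wave (d M) (q M) x * Complex.I))
      (L := 2 * Real.pi * ∑ i ∈ Finset.range M, (q i : ℝ)) (q := q M)
      (by fun_prop) (by fun_prop) (by positivity)
      (fun x y => (norm_cexp_sub_cexp_le _ _).trans (abs_sum_wave_sub_le d q hd M x y))
      (fun x => (Complex.norm_exp_ofReal_mul_I _).le) (h.one_le M)
      (fun x => by simp only [wave_add_inv _ (h.one_le M)])
    have he : ∀ x, Complex.exp ((∑ n ∈ Finset.Ico N (M + 1), wave (d n) (q n) x : ℝ) * Complex.I) =
        Complex.exp ((∑ n ∈ Finset.Ico N M, wave (d n) (q n) x : ℝ) * Complex.I) *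
          Complex.exp (wave (d M) (q M) x * Complex.I) := by
      intro x
      rw [← Complex.exp_add, Finset.sum_Ico_succ_top hM, Complex.ofReal_add, add_mul]
    simp_rw [he]
    have h1 := norm_integral_cexp_wave_le (d M) (h.one_le M) (hd M hM)
    set IA := ∫ x, Complex.exp ((∑ n ∈ Finset.Ico N M, wave (d n) (q n) x : ℝ) * Complex.I)
    set IB := ∫ x, Complex.exp (wave (d M) (q M) x * Complex.I)
    have h2 : 2 * Real.pi * (∑ i ∈ Finset.range M, (q i : ℝ)) / q M ≤
        8 * Real.pi * (1 / 2 : ℝ) ^ M := by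
      have := h.sum_range_div_le M
      rw [mul_div_assoc]
      have hpi := Real.pi_pos
      nlinarith
    have h3 := norm_le_norm_add_norm_sub' (∫ x,
      Complex.exp ((∑ n ∈ Finset.Ico N M, wave (d n) (q n) x : ℝ) * Complex.I) *
          Complex.exp (wave (d M) (q M) x * Complex.I)) (IA * IB)
    rw [norm_mul] at h3
    rw [Finset.sum_Ico_succ_top hM, Finset.sum_Ico_succ_top hM, neg_add, Real.exp_add, mul_add]
    set E := Real.exp (-∑ n ∈ Finset.Ico N M, ‖d n‖ ^ 2 / 8)
    set S := 8 * Real.pi * ∑ n ∈ Finset.Ico N M, (1 / 2 : ℝ) ^ n with hS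
    have hS0 : 0 ≤ S := by positivity
    -- The new factor is at most one, so old errors do not grow and only the new decorrelation error
    -- is added.
    have h4 : ‖IA‖ * ‖IB‖ ≤ (E + S) * Real.exp (-(‖d M‖ ^ 2 / 8)) := by gcongr
    have h5 : Real.exp (-(‖d M‖ ^ 2 / 8)) ≤ 1 := by
      rw [Real.exp_le_one_iff]
      linarith [sq_nonneg ‖d M‖]
    nlinarith

/-- There are return times of the rotation along which all the waves with index in `[N, M)` are
shifted by about half a period. -/
theorem exists_time (h : SuperLacunary α q) {N M : ℕ} (hN : 4 ≤ N) (hNM : N ≤ M) :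
    ∃ t : ℕ, t ≤ 2 * q M ∧ ‖t • (α : UnitAddCircle)‖ ≤ (1 / 2) ^ N ∧
      (∀ n < N, ‖((q n : ℤ)) • (t • (α : UnitAddCircle))‖ ≤ (q n : ℝ) / q N) ∧
      ∀ n, N ≤ n → n < M → 1 / 4 ≤ ‖((q n : ℤ)) • (t • (α : UnitAddCircle))‖ := by
  have hsingle : ∀ j, ∃ s : ℕ, s ≤ q (j + 1) ∧ ‖s • (α : UnitAddCircle)‖ ≤ 1 / (2 * q j) ∧
      1 / 2 - 1 / (2 * q j) ≤ ‖(q j) • (s • (α : UnitAddCircle))‖ := by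
    intro j
    set D := ‖(((q j : ℝ) * α : ℝ) : UnitAddCircle)‖ with hD
    have hq := h.cast_pos j
    have hq' := h.cast_pos (j + 1)
    have hle := h.le_norm j
    have hlt := h.norm_lt j
    have hD0 : 0 < D := lt_of_lt_of_le (by positivity) hle
    -- With `s = r * q j` the point `s α` has size `r D ≤ 1 / (2 q j)`, and multiplying by `q j`
    -- brings it within `q j * D ≤ 1 / (2 q j)` of one half.
    set r := ⌊1 / (2 * (q j : ℝ) * D)⌋₊ with hr
    have hr1 : (r : ℝ) ≤ 1 / (2 * (q j : ℝ) * D) := Nat.floor_le (by positivity)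
    have hr2 : 1 / (2 * (q j : ℝ) * D) < r + 1 := Nat.lt_floor_add_one _
    rw [le_div_iff₀ (by positivity)] at hr1
    rw [div_lt_iff₀ (by positivity)] at hr2
    set y := (q j : ℝ) * α - round ((q j : ℝ) * α) with hy
    have hyD : |y| = D := UnitAddCircle.norm_eq.symm
    have hyc : (((q j : ℝ) * α : ℝ) : UnitAddCircle) = (y : UnitAddCircle) := by
      rw [hy, AddCircle.coe_sub, eq_comm, sub_eq_self]
      exact AddCircle.coe_eq_zero_iff 1 |>.2 ⟨round ((q j : ℝ) * α), by simp⟩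
    have hs : ∀ k : ℕ, (k * (r * q j)) • (α : UnitAddCircle) = ((k * r * y : ℝ) : UnitAddCircle) := by
      intro k
      have e1 : (k * (r * q j)) • (α : UnitAddCircle) =
          ((k * r : ℕ) : ℤ) • (((q j : ℝ) * α : ℝ) : UnitAddCircle) := by
        rw [natCast_zsmul, ← AddCircle.coe_nsmul, ← AddCircle.coe_nsmul]
        congr 1
        simp only [nsmul_eq_mul]
        push_cast
        ring
      rw [e1, hyc, zsmul_coe_unitAddCircle]
      push_cast
      rfl
    refine ⟨r * q j, ?_, ?_, ?_⟩
    · have h1 : (r : ℝ) * q j ≤ q (j + 1) := by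
        rw [div_le_iff₀ (by positivity)] at hle
        by_contra! hcon
        nlinarith
      exact_mod_cast h1
    · have := hs 1
      rw [one_mul] at this
      rw [this]
      refine (unitAddCircle_norm_le _ 0).trans ?_
      rw [Int.cast_zero, sub_zero, abs_mul, hyD, Nat.cast_one, one_mul, Nat.abs_cast,
        le_div_iff₀ (by positivity)]
      linarith
    · rw [smul_smul, hs]
      have hz : |(q j : ℝ) * r * y| = q j * r * D := by
        rw [abs_mul, hyD, abs_of_nonneg (by positivity)]
      have hhalf : |(q j : ℝ) * r * y| ≤ 1 / 2 := by rw [hz]; linarith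
      have hn : ‖(((q j : ℝ) * r * y : ℝ) : UnitAddCircle)‖ = |(q j : ℝ) * r * y| :=
        (AddCircle.norm_coe_eq_abs_iff 1 one_ne_zero).2 (by simpa using hhalf)
      rw [hn, hz]
      rw [lt_div_iff₀ (by positivity)] at hlt
      have : (q j : ℝ) * D ≤ 1 / (2 * q j) := by
        rw [le_div_iff₀ (by positivity)]
        nlinarith
      nlinarith
  choose s hs1 hs2 hs3 using hsingle
  have hsum : ∀ A B, ∑ j ∈ Finset.Ico A B, s j ≤ 2 * q B := by
    intro A B
    calc ∑ j ∈ Finset.Ico A B, s j ≤ ∑ j ∈ Finset.range B, s j :=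
          Finset.sum_le_sum_of_subset fun j hj => Finset.mem_range.2 (Finset.mem_Ico.1 hj).2
      _ ≤ ∑ j ∈ Finset.range B, q (j + 1) := Finset.sum_le_sum fun j _ => hs1 j
      _ ≤ ∑ j ∈ Finset.range (B + 1), q j := by rw [Finset.sum_range_succ']; omega
      _ ≤ 2 * q B := by rw [Finset.sum_range_succ]; have := h.sum_range_le B; omega
  have htail : ∀ {A}, A ≤ M →
      ‖(∑ j ∈ Finset.Ico A M, s j) • (α : UnitAddCircle)‖ ≤ 1 / q A := by
    intro A hA
    rw [Finset.sum_smul]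
    refine (norm_sum_le _ _).trans ((Finset.sum_le_sum fun j _ => hs2 j).trans ?_)
    have := h.sum_inv_le hA
    have e : ∀ j, 1 / (2 * (q j : ℝ)) = 1 / 2 * (1 / q j) := fun j => by ring
    simp_rw [e, ← Finset.mul_sum]
    calc _ ≤ 1 / 2 * (2 / (q A : ℝ)) := by gcongr
      _ = _ := by ring
  -- Each `s j` produces the half turn at frequency `q j` and barely affects the other frequencies,
  -- so their sum serves all of them.
  refine ⟨∑ j ∈ Finset.Ico N M, s j, hsum N M, (htail hNM).trans (h.inv_le N), ?_, ?_⟩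
  · intro n _
    rw [natCast_zsmul]
    refine norm_nsmul_le.trans ?_
    rw [div_eq_mul_one_div]
    gcongr
    exact htail hNM
  · intro n hn hnM
    rw [natCast_zsmul, ← Finset.sum_Ico_consecutive _ hn hnM.le, Finset.sum_eq_sum_Ico_succ_bot hnM]
    set u := ∑ j ∈ Finset.Ico N n, s j with hu
    set v := ∑ j ∈ Finset.Ico (n + 1) M, s j
    -- Summands before `n` contribute at most `1 / q n`, those after at most `2⁻ⁿ`. As `n ≥ 4`, at
    -- least `1/2 - (5/2) / 16 > 1/4` remains.
    rw [show q n • ((u + (s n + v)) • (α : UnitAddCircle)) =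
      q n • s n • (α : UnitAddCircle) + (u • q n • (α : UnitAddCircle) +
        q n • v • (α : UnitAddCircle)) by
      rw [add_smul, add_smul, smul_add, smul_add, smul_comm (q n) u]; abel]
    have hq := h.cast_pos n
    have h1 : ‖u • q n • (α : UnitAddCircle)‖ ≤ 1 / q n := by
      refine norm_nsmul_le.trans ?_
      have e : q n • (α : UnitAddCircle) = (((q n : ℝ) * α : ℝ) : UnitAddCircle) := by
        rw [← AddCircle.coe_nsmul, nsmul_eq_mul]
      rw [e]
      have hu' : (u : ℝ) ≤ 2 * q n := by exact_mod_cast hsum N n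
      calc _ ≤ 2 * (q n : ℝ) * (1 / (2 * (q n : ℝ) ^ 2)) := by
            gcongr
            exact (h.norm_lt n).le
        _ = _ := by field_simp
    have h2 : ‖q n • v • (α : UnitAddCircle)‖ ≤ (1 / 2) ^ n := by
      refine norm_nsmul_le.trans (le_trans ?_ (h.div_succ_le n))
      rw [div_eq_mul_one_div]
      gcongr
      exact htail hnM
    have h3 := hs3 n
    have h4 := h.inv_le n
    have h5 : (1 / 2 : ℝ) ^ n ≤ (1 / 2) ^ 4 :=
      pow_le_pow_of_le_one (by norm_num) (by norm_num) (hN.trans hn)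
    have h6 : 1 / (2 * (q n : ℝ)) = 1 / 2 * (1 / q n) := by ring
    have h7 := norm_add_le (u • q n • (α : UnitAddCircle)) (q n • v • (α : UnitAddCircle))
    have h8 := norm_sub_le_norm_add (q n • s n • (α : UnitAddCircle))
      (u • q n • (α : UnitAddCircle) + q n • v • (α : UnitAddCircle))
    norm_num at h5
    linarith

end SuperLacunary

open scoped ENNReal

/-! ### Lacunary cocycles without unimodular transfer function. -/

theorem measurePreserving_add_right_unitAddCircle (θ : UnitAddCircle) :
    MeasurePreserving (fun x : UnitAddCircle => x + θ) volume volume :=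
  measurePreserving_add_right volume θ

/-- Continuity of translations in `L²`, for unimodular functions. -/
theorem exists_le_norm_integral_translate {ψ : UnitAddCircle → ℂ} (hψ : Measurable ψ)
    (hψ1 : ∀ᵐ x, ‖ψ x‖ = 1) :
    ∃ δ > 0, ∀ θ : UnitAddCircle, ‖θ‖ < δ →
      3 / 4 ≤ ‖∫ x, ψ (x + θ) * starRingEnd ℂ (ψ x)‖ := by
  have hmem : MemLp ψ 2 (volume : Measure UnitAddCircle) :=
    MemLp.of_bound hψ.aestronglyMeasurable 1 (hψ1.mono fun x hx => hx.le)
  set f : Lp ℂ 2 (volume : Measure UnitAddCircle) := hmem.toLp ψ with hf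
  let g : C(UnitAddCircle, C(UnitAddCircle, UnitAddCircle)) :=
    ContinuousMap.curry ⟨fun p => p.2 + p.1, by fun_prop⟩
  have hg : ∀ θ, MeasurePreserving (g θ) (volume : Measure UnitAddCircle) volume :=
    measurePreserving_add_right_unitAddCircle
  have hcont : Continuous fun θ => Lp.compMeasurePreserving (g θ) (hg θ) f :=
    Continuous.compMeasurePreservingLp continuous_const g.continuous hg (by simp)
  have hinner : ∀ θ, inner ℂ f (Lp.compMeasurePreserving (g θ) (hg θ) f) =
      ∫ x, ψ (x + θ) * starRingEnd ℂ (ψ x) := by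
    intro θ
    rw [L2.inner_def]
    refine integral_congr_ae ?_
    filter_upwards [hmem.coeFn_toLp, Lp.coeFn_compMeasurePreserving f (hg θ),
      (hg θ).quasiMeasurePreserving.ae hmem.coeFn_toLp] with x h1 h2 h3
    rw [h2, h1, RCLike.inner_apply, Function.comp_apply, h3]
    rfl
  have h0 : ∫ x, ψ (x + 0) * starRingEnd ℂ (ψ x) = 1 := by
    have : ∀ᵐ x, ψ (x + 0) * starRingEnd ℂ (ψ x) = 1 := by
      filter_upwards [hψ1] with x hx
      rw [add_zero, Complex.mul_conj, Complex.normSq_eq_norm_sq, hx]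
      simp
    rw [integral_congr_ae this]
    simp [volume_real_univ_unitAddCircle]
  have hc : Continuous fun θ : UnitAddCircle => ‖∫ x, ψ (x + θ) * starRingEnd ℂ (ψ x)‖ := by
    simp_rw [← hinner]
    exact (continuous_const.inner hcont).norm
  have hev : ∀ᶠ θ in 𝓝 (0 : UnitAddCircle),
      3 / 4 < ‖∫ x, ψ (x + θ) * starRingEnd ℂ (ψ x)‖ := by
    refine hc.continuousAt.eventually_const_lt ?_
    simp only [h0]
    norm_num
  obtain ⟨δ, hδ, hball⟩ := Metric.eventually_nhds_iff.1 hev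
  exact ⟨δ, hδ, fun θ hθ => (hball (by rwa [dist_zero_right])).le⟩

theorem wave_add_left (a b : ℂ) (q : ℕ) (x : UnitAddCircle) :
    wave (a + b) q x = wave a q x + wave b q x := by
  rw [wave, add_mul, Complex.add_re, wave, wave]

theorem wave_apply_add (d : ℂ) (q : ℕ) (x y : UnitAddCircle) :
    wave d q (x + y) = wave (d * fourier (q : ℤ) y) q x := by
  rw [wave, wave, fourier_apply_add]
  congr 1
  ring

namespace SuperLacunary

variable {α : ℝ} {q : ℕ → ℕ} {b : ℕ → ℂ} {K : ℝ}

/-- The comparison constants of `norm_fourier_one_sub_one` have ratio `2π / 4 ≤ 2`. -/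
theorem norm_mul_fourier_sub_one_le_mul (b : ℂ) (m : ℤ) (t : ℕ) (z : UnitAddCircle) :
    ‖b * (fourier m (t • z) - 1)‖ ≤ 2 * t * ‖b * (fourier m z - 1)‖ := by
  rw [norm_mul, norm_mul, fourier_eq_fourier_one m z, fourier_eq_fourier_one m (t • z),
    smul_comm m t z]
  have h1 := (norm_fourier_one_sub_one (t • m • z)).2
  have h2 := (norm_fourier_one_sub_one (m • z)).1
  have h3 : ‖t • m • z‖ ≤ t * ‖m • z‖ := norm_nsmul_le
  have h4 : 2 * Real.pi * ‖t • m • z‖ ≤ 8 * (t * ‖m • z‖) := by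
    have := Real.pi_le_four
    have := norm_nonneg (t • m • z)
    nlinarith
  have h5 : (t : ℝ) * (4 * ‖m • z‖) ≤ t * ‖(fourier 1 (m • z) : ℂ) - 1‖ := by gcongr
  have h6 : ‖(fourier 1 (t • m • z) : ℂ) - 1‖ ≤ 2 * t * ‖(fourier 1 (m • z) : ℂ) - 1‖ := by
    linarith
  calc _ ≤ ‖b‖ * (2 * t * ‖(fourier 1 (m • z) : ℂ) - 1‖) := by gcongr
    _ = _ := by ring

theorem summable_norm_jump (h : SuperLacunary α q)
    (hK : ∀ n, ‖b n * (fourier (q n : ℤ) (α : UnitAddCircle) - 1)‖ ≤ K / (q n : ℝ) ^ 3) (t : ℕ) :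
    Summable fun n => ‖b n * (fourier (q n : ℤ) (t • (α : UnitAddCircle)) - 1)‖ := by
  have hK0 : 0 ≤ K := by
    have := (norm_nonneg _).trans (hK 0)
    have hq := h.cast_pos 0
    rw [le_div_iff₀ (by positivity)] at this
    linarith
  refine Summable.of_nonneg_of_le (fun n => norm_nonneg _)
    (fun n => (norm_mul_fourier_sub_one_le_mul (b n) (q n) t α).trans ?_)
    (summable_geometric_two.mul_left (2 * t * K))
  rw [mul_assoc (2 * (t : ℝ))]
  gcongr
  refine (hK n).trans ?_
  rw [div_eq_mul_one_div]
  gcongr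
  refine le_trans ?_ (h.inv_le n)
  have hq : (1 : ℝ) ≤ q n := by exact_mod_cast h.one_le n
  exact one_div_le_one_div_of_le (h.cast_pos n) (le_self_pow₀ hq (by norm_num))

theorem summable_wave {d : ℕ → ℂ} (hd : Summable fun n => ‖d n‖) (q : ℕ → ℕ) (x : UnitAddCircle) :
    Summable fun n => wave (d n) (q n) x :=
  Summable.of_norm_bounded hd fun _ => abs_wave_le _ _ _

/-- Frequency by frequency, `e(q(t+1)α) - 1` is `e(qtα) - 1` plus `e(qtα)(e(qα) - 1)`. -/
theorem cocycle_iterate (h : SuperLacunary α q)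
    (hK : ∀ n, ‖b n * (fourier (q n : ℤ) (α : UnitAddCircle) - 1)‖ ≤ K / (q n : ℝ) ^ 3)
    {c : ℝ} {ψ : UnitAddCircle → ℂ}
    (hcoc : ∀ᵐ x, ψ (x + (α : UnitAddCircle)) = Complex.exp ((c + ∑' n,
      wave (b n * (fourier (q n : ℤ) (α : UnitAddCircle) - 1)) (q n) x : ℝ) * Complex.I) * ψ x)
    (t : ℕ) :
    ∀ᵐ x, ψ (x + t • (α : UnitAddCircle)) = Complex.exp ((t * c + ∑' n,
      wave (b n * (fourier (q n : ℤ) (t • (α : UnitAddCircle)) - 1)) (q n) x : ℝ) *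
        Complex.I) * ψ x := by
  induction t with
  | zero => simp [wave]
  | succ t ih =>
    filter_upwards [ih, (measurePreserving_add_right_unitAddCircle
      (t • (α : UnitAddCircle))).quasiMeasurePreserving.ae hcoc] with x h1 h2
    have h3 := summable_wave (h.summable_norm_jump hK t) q x
    have h4 := summable_wave (h.summable_norm_jump hK 1) q (x + t • (α : UnitAddCircle))
    rw [one_smul] at h4
    have h5 := h3.tsum_add h4
    have h6 : ∀ n, wave (b n * (fourier (q n : ℤ) ((t + 1) • (α : UnitAddCircle)) - 1)) (q n) x =
        wave (b n * (fourier (q n : ℤ) (t • (α : UnitAddCircle)) - 1)) (q n) x +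
        wave (b n * (fourier (q n : ℤ) (α : UnitAddCircle) - 1)) (q n)
          (x + t • (α : UnitAddCircle)) := by
      intro n
      rw [wave_apply_add, ← wave_add_left, add_smul, one_smul, fourier_apply_add]
      congr 1
      ring
    simp_rw [h6]
    rw [h5, add_smul, one_smul, ← add_assoc, h2, h1, ← mul_assoc, ← Complex.exp_add]
    congr 2
    push_cast
    ring

/-- As `u ↦ exp(iu)` is 1-Lipschitz, low and high frequencies can be discarded at the cost of their
total amplitude. -/
theorem norm_integral_cexp_tsum_wave_le {d : ℕ → ℂ} (hd : Summable fun n => ‖d n‖) (q : ℕ → ℕ)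
    {N M : ℕ} (hNM : N ≤ M) :
    ‖∫ x, Complex.exp ((∑' n, wave (d n) (q n) x : ℝ) * Complex.I)‖ ≤
      ‖∫ x, Complex.exp ((∑ n ∈ Finset.Ico N M, wave (d n) (q n) x : ℝ) * Complex.I)‖ +
        (∑ n ∈ Finset.range N, ‖d n‖ + ∑' n, ‖d (n + M)‖) := by
  have hcont : Continuous fun x => ∑' n, wave (d n) (q n) x :=
    continuous_tsum (fun n => continuous_wave _ _) hd fun n x => abs_wave_le _ _ _
  have hcont' : Continuous fun x => ∑ n ∈ Finset.Ico N M, wave (d n) (q n) x :=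
    continuous_finsetSum _ fun n _ => continuous_wave _ _
  have hInt : ∀ {f : UnitAddCircle → ℂ}, Continuous f → Integrable f := fun hf =>
    hf.integrable_of_hasCompactSupport (HasCompactSupport.of_compactSpace _)
  refine (norm_le_norm_add_norm_sub' _
    (∫ x, Complex.exp ((∑ n ∈ Finset.Ico N M, wave (d n) (q n) x : ℝ) * Complex.I))).trans ?_
  gcongr
  rw [← integral_sub (hInt (by fun_prop)) (hInt (by fun_prop))]
  refine (norm_integral_le_of_norm_le_const (C := ∑ n ∈ Finset.range N, ‖d n‖ + ∑' n, ‖d (n + M)‖)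
    (ae_of_all _ fun x => (norm_cexp_sub_cexp_le _ _).trans ?_)).trans ?_
  · rw [← (summable_wave hd q x).sum_add_tsum_nat_add M, ← Finset.sum_range_add_sum_Ico _ hNM]
    rw [add_right_comm, add_sub_cancel_right]
    refine (abs_add_le _ _).trans (add_le_add ?_ ?_)
    · exact (Finset.abs_sum_le_sum_abs _ _).trans (Finset.sum_le_sum fun n _ => abs_wave_le _ _ _)
    · exact tsum_of_norm_bounded (f := fun n => wave (d (n + M)) (q (n + M)) x)
        ((summable_nat_add_iff M).2 hd).hasSum fun n => abs_wave_le _ _ _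
  · rw [volume_real_univ_unitAddCircle, mul_one]

/-- The cocycle `exp (i (c + ∑ wave))` is not a coboundary if the formal transfer function is not
square integrable. -/
theorem not_cocycle (h : SuperLacunary α q)
    (hK : ∀ n, ‖b n * (fourier (q n : ℤ) (α : UnitAddCircle) - 1)‖ ≤ K / (q n : ℝ) ^ 3)
    (hb : Tendsto b atTop (𝓝 0)) (hb2 : ¬ Summable fun n => ‖b n‖ ^ 2) (c : ℝ)
    {ψ : UnitAddCircle → ℂ} (hψ : Measurable ψ) (hψ1 : ∀ᵐ x, ‖ψ x‖ = 1) :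
    ¬ ∀ᵐ x, ψ (x + (α : UnitAddCircle)) = Complex.exp ((c + ∑' n,
      wave (b n * (fourier (q n : ℤ) (α : UnitAddCircle) - 1)) (q n) x : ℝ) * Complex.I) * ψ x := by
  intro hcoc
  have hK0 : 0 ≤ K := by
    have := (norm_nonneg _).trans (hK 0)
    have hq := h.cast_pos 0
    rw [le_div_iff₀ (by positivity)] at this
    linarith
  obtain ⟨δ, hδ, hcorr⟩ := exists_le_norm_integral_translate hψ hψ1
  obtain ⟨B, hB⟩ : ∃ B, ∀ n, ‖b n‖ ≤ B := by
    obtain ⟨B, hB⟩ := hb.norm.bddAbove_range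
    exact ⟨B, fun n => hB ⟨n, rfl⟩⟩
  have hB0 : 0 ≤ B := (norm_nonneg _).trans (hB 0)
  have hgeo : Tendsto (fun n : ℕ => (1 / 2 : ℝ) ^ n) atTop (𝓝 0) :=
    tendsto_pow_atTop_nhds_zero_of_lt_one (by norm_num) (by norm_num)
  have hgeo' : Tendsto (fun n : ℕ => (16 * Real.pi + 8 * Real.pi * B + 8 * K) * (1 / 2 : ℝ) ^ n)
      atTop (𝓝 0) := by simpa using hgeo.const_mul (16 * Real.pi + 8 * Real.pi * B + 8 * K)
  have hb' : ∀ᶠ N in atTop, ∀ n, N ≤ n → ‖b n‖ < 1 / 2 := by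
    have := (hb.norm.eventually_lt_const (show ‖(0 : ℂ)‖ < 1 / 2 by simp))
    exact eventually_forall_ge_atTop.2 this
  -- `N` makes all errors small uniformly in `M`; then `M` is chosen from the divergence of `∑ ‖b
  -- n‖²`, and `t` last. The bound `1 / 2` on `‖b n‖` keeps `‖d n‖ ≤ 1`.
  obtain ⟨N, hN4, hNδ, hNe, hNb⟩ := ((eventually_ge_atTop 4).and
    ((hgeo.eventually_lt_const hδ).and ((hgeo'.eventually_lt_const
      (show (0 : ℝ) < 1 / 4 by norm_num)).and hb'))).exists
  obtain ⟨M, hNM, hM⟩ : ∃ M, N ≤ M ∧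
      Real.exp (-(∑ n ∈ Finset.Ico N M, ‖b n‖ ^ 2 / 8)) ≤ 1 / 4 := by
    have h1 : Tendsto (fun M => ∑ n ∈ Finset.range M, ‖b n‖ ^ 2) atTop atTop :=
      (not_summable_iff_tendsto_nat_atTop_of_nonneg fun n => by positivity).1 hb2
    have h2 := (h1.eventually_ge_atTop
      (∑ n ∈ Finset.range N, ‖b n‖ ^ 2 - 8 * Real.log (1 / 4))).and (eventually_ge_atTop N)
    obtain ⟨M, hM1, hM2⟩ := h2.exists
    refine ⟨M, hM2, ?_⟩
    rw [← Finset.sum_range_add_sum_Ico _ hM2] at hM1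
    rw [← Finset.sum_div, ← Real.le_log_iff_exp_le (by norm_num)]
    linarith
  obtain ⟨t, ht1, ht2, ht3, ht4⟩ := h.exists_time hN4 hNM
  set d : ℕ → ℂ := fun n => b n * (fourier (q n : ℤ) (t • (α : UnitAddCircle)) - 1) with hd
  have hdsum : Summable fun n => ‖d n‖ := h.summable_norm_jump hK t
  have hcorr' := hcorr _ (ht2.trans_lt hNδ)
  have hInt : ∫ x, ψ (x + t • (α : UnitAddCircle)) * starRingEnd ℂ (ψ x) =
      Complex.exp ((t * c : ℝ) * Complex.I) *
        ∫ x, Complex.exp ((∑' n, wave (d n) (q n) x : ℝ) * Complex.I) := by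
    rw [← integral_const_mul]
    refine integral_congr_ae ?_
    filter_upwards [h.cocycle_iterate hK hcoc t, hψ1] with x h1 h2
    rw [h1, mul_assoc, Complex.mul_conj, Complex.normSq_eq_norm_sq, h2, ← Complex.exp_add]
    push_cast
    rw [add_mul]
    ring
  rw [hInt, norm_mul, Complex.norm_exp_ofReal_mul_I, one_mul] at hcorr'
  have hd1 : ∀ n, N ≤ n → ‖d n‖ ≤ 1 := by
    intro n hn
    have h1 : ‖(fourier (q n : ℤ) (t • (α : UnitAddCircle)) : ℂ) - 1‖ ≤ 2 := by
      refine (norm_sub_le _ _).trans ?_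
      rw [norm_fourier_apply, norm_one]
      norm_num
    rw [hd, norm_mul]
    have := (hNb n hn).le
    calc _ ≤ 1 / 2 * (2 : ℝ) := by gcongr
      _ = 1 := by norm_num
  have hd2 : ∀ n ∈ Finset.Ico N M, ‖b n‖ ^ 2 / 8 ≤ ‖d n‖ ^ 2 / 8 := by
    intro n hn
    obtain ⟨hn1, hn2⟩ := Finset.mem_Ico.1 hn
    have h1 := (norm_fourier_one_sub_one ((q n : ℤ) • (t • (α : UnitAddCircle)))).1
    rw [← fourier_eq_fourier_one] at h1
    have h2 := ht4 n hn1 hn2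
    gcongr
    rw [hd, norm_mul]
    -- `‖e(q_n tα) - 1‖ ≥ 4 · (1/4) = 1`, so amplitudes are not reduced.
    exact le_mul_of_one_le_right (norm_nonneg _) (by linarith)
  have hmain := h.norm_integral_cexp_sum_wave_le hd1 hNM
  have happ := norm_integral_cexp_tsum_wave_le hdsum q hNM
  have hexp : Real.exp (-(∑ n ∈ Finset.Ico N M, ‖d n‖ ^ 2 / 8)) ≤ 1 / 4 :=
    le_trans (Real.exp_le_exp.2 (neg_le_neg (Finset.sum_le_sum hd2))) hM
  have hgsum : ∑ n ∈ Finset.Ico N M, (1 / 2 : ℝ) ^ n ≤ 2 * (1 / 2) ^ N := by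
    have := geom_sum_Ico_le_of_lt_one (x := (1 / 2 : ℝ)) (m := N) (n := M) (by norm_num)
      (by norm_num)
    refine this.trans_eq ?_
    ring
  have hlow : ∑ n ∈ Finset.range N, ‖d n‖ ≤ 8 * Real.pi * B * (1 / 2) ^ N := by
    have h1 : ∀ n ∈ Finset.range N, ‖d n‖ ≤ 2 * Real.pi * B * ((q n : ℝ) / q N) := by
      intro n hn
      have h1 := (norm_fourier_one_sub_one ((q n : ℤ) • (t • (α : UnitAddCircle)))).2
      rw [← fourier_eq_fourier_one] at h1
      have h2 := ht3 n (Finset.mem_range.1 hn)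
      rw [hd, norm_mul]
      have := hB n
      calc _ ≤ B * (2 * Real.pi * ((q n : ℝ) / q N)) := by
            gcongr
            exact h1.trans (by gcongr)
        _ = _ := by ring
    refine (Finset.sum_le_sum h1).trans ?_
    rw [← Finset.mul_sum, ← Finset.sum_div]
    have h2 := h.sum_range_div_le N
    calc _ ≤ 2 * Real.pi * B * (4 * (1 / 2) ^ N) := by gcongr
      _ = _ := by ring
  -- The time costs a factor `2t ≤ 4 q_M`, absorbed by the decay `K / q³` at frequencies `q ≥ q_M`.
  have hhigh : ∑' n, ‖d (n + M)‖ ≤ 8 * K * (1 / 2) ^ N := by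
    have h1 : ∀ n, ‖d (n + M)‖ ≤ 4 * K * (1 / 2) ^ M * (1 / 2) ^ n := by
      intro n
      refine (norm_mul_fourier_sub_one_le_mul (b (n + M)) (q (n + M)) t α).trans ?_
      have h2 : (t : ℝ) ≤ 2 * q M := by exact_mod_cast ht1
      have h3 : (q M : ℝ) ≤ q (n + M) := by exact_mod_cast h.monotone (Nat.le_add_left M n)
      have h4 := h.inv_le (n + M)
      have hq : (1 : ℝ) ≤ q (n + M) := by exact_mod_cast h.one_le (n + M)
      have h5 := hK (n + M)
      calc _ ≤ 2 * (2 * q (n + M)) * (K / (q (n + M) : ℝ) ^ 3) := by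
            gcongr
            linarith
        _ = 4 * K * (1 / (q (n + M) : ℝ) * (1 / (q (n + M) : ℝ))) := by
            field_simp
            ring
        _ ≤ 4 * K * ((1 / 2) ^ (n + M) * 1) := by
            gcongr
            rw [div_le_one (by linarith)]
            exact hq
        _ = _ := by rw [pow_add]; ring
    have h2 := tsum_of_norm_bounded (hasSum_geometric_two.mul_left (4 * K * (1 / 2) ^ M))
      (f := fun n => ‖d (n + M)‖) (by simpa using h1)
    refine (le_abs_self _).trans (h2.trans ?_)
    have h3 : (1 / 2 : ℝ) ^ M ≤ (1 / 2) ^ N :=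
      pow_le_pow_of_le_one (by norm_num) (by norm_num) hNM
    nlinarith
  have hpi := Real.pi_pos
  have hgsum' : 8 * Real.pi * ∑ n ∈ Finset.Ico N M, (1 / 2 : ℝ) ^ n ≤
      16 * Real.pi * (1 / 2) ^ N := by nlinarith
  -- The correlation is at least `3/4`, while the main term and the errors contribute at most `1/4`
  -- each.
  linarith

end SuperLacunary

/-! ### Excluding eigenfunctions under the given roof. -/

section Conclusion

variable {α : ℝ} {φ : UnitAddCircle → ℝ}

theorem continuous_of_continuous_comp_coe (hφ : Continuous fun x : ℝ => φ (x : UnitAddCircle)) :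
    Continuous φ :=
  isQuotientMap_quotient_mk'.continuous_iff.2 hφ

theorem superLacunary_nth (hinf : (goodDenominators α).Infinite) :
    SuperLacunary α (Nat.nth (· ∈ goodDenominators α)) := by
  have hmem : ∀ n, Nat.nth (· ∈ goodDenominators α) n ∈ goodDenominators α :=
    Nat.nth_mem_of_infinite hinf
  have hlt : ∀ n, Nat.nth (· ∈ goodDenominators α) n < Nat.nth (· ∈ goodDenominators α) (n + 1) :=
    fun n => Nat.nth_strictMono hinf n.lt_succ_self
  exact {
    one_le := fun n => (hmem n).1
    lt_succ := hlt
    sq_le := fun n => (goodDenominators_separation (hmem n) (hmem _) (hlt n)).1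
    norm_lt := fun n => norm_lt_of_mem_goodDenominators (hmem n)
    le_norm := fun n => (goodDenominators_separation (hmem n) (hmem _) (hlt n)).2 }

/-- The functional equation for eigenfunctions has no unimodular solution. -/
theorem not_eigenfunction_equation (hα : Irrational α) (hφ : Continuous φ) {K : ℝ}
    (hK : ∀ m : ℤ, m ≠ 0 → ‖roofCoeff φ m‖ ≤ K / |(m : ℝ)| ^ 3)
    (hS : Summable fun m : ℕ =>
      (goodDenominators α)ᶜ.indicator (fun m : ℕ => coeffRatio α φ m ^ 2) m)
    (hP : ¬ Summable fun m : ℕ =>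
      (goodDenominators α).indicator (fun m : ℕ => coeffRatio α φ m ^ 2) m)
    (hlim : Tendsto (fun m : ℕ => coeffRatio α φ m) atTop (𝓝 0))
    {ν : ℝ} (hν : ν ≠ 0) {ψ : UnitAddCircle → ℂ} (hψ : Measurable ψ) (hψ1 : ∀ᵐ x, ‖ψ x‖ = 1) :
    ¬ ∀ᵐ x, ψ (x + (α : UnitAddCircle)) = Complex.exp (ν * φ x * Complex.I) * ψ x := by
  intro heq
  obtain ⟨W, hWm, hW⟩ := exists_cohomologous_lacunary hα hφ hK (summable_coeffRatio_sq_int hS)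
  have hinf : (goodDenominators α).Infinite := by
    intro hfin
    refine hP (summable_of_hasFiniteSupport (hfin.subset fun m hm => ?_))
    exact Set.mem_of_indicator_ne_zero hm
  set q := Nat.nth (· ∈ goodDenominators α) with hq
  have hL : SuperLacunary α q := superLacunary_nth hinf
  have hinj : Function.Injective q := Nat.nth_injective hinf
  have hmem : ∀ n, q n ∈ goodDenominators α := Nat.nth_mem_of_infinite hinf
  have hrange : ∀ m ∉ Set.range q, m ∉ goodDenominators α := fun m hm hm' =>
    hm ((Nat.range_nth_of_infinite (p := (· ∈ goodDenominators α)) hinf).symm ▸ hm')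
  -- Coefficients of the formal transfer function; the `2` comes from pairing the frequencies `±q
  -- n`.
  set b : ℕ → ℂ := fun n => 2 * ν * roofCoeff φ (q n : ℤ) /
    (fourier (q n : ℤ) (α : UnitAddCircle) - 1) with hb
  have hbounds : ∀ n, 4 * ‖(((q n : ℝ) * α : ℝ) : UnitAddCircle)‖ ≤
      ‖(fourier (q n : ℤ) (α : UnitAddCircle) : ℂ) - 1‖ ∧
      ‖(fourier (q n : ℤ) (α : UnitAddCircle) : ℂ) - 1‖ ≤
        2 * Real.pi * ‖(((q n : ℝ) * α : ℝ) : UnitAddCircle)‖ := by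
    intro n
    have := norm_fourier_sub_one (q n : ℤ) α
    rwa [Int.cast_natCast] at this
  have hpos : ∀ n, 0 < ‖(((q n : ℝ) * α : ℝ) : UnitAddCircle)‖ := fun n =>
    norm_nat_mul_pos hα (hmem n).1
  have hpos' : ∀ n, 0 < ‖(fourier (q n : ℤ) (α : UnitAddCircle) : ℂ) - 1‖ := fun n =>
    lt_of_lt_of_le (mul_pos (by norm_num) (hpos n)) (hbounds n).1
  have hbmul : ∀ n, b n * (fourier (q n : ℤ) (α : UnitAddCircle) - 1) =
      2 * ν * roofCoeff φ (q n : ℤ) := fun n => div_mul_cancel₀ _ (norm_pos_iff.1 (hpos' n))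
  have hbnorm : ∀ n, ‖b n‖ = 2 * |ν| * ‖roofCoeff φ (q n : ℤ)‖ /
      ‖(fourier (q n : ℤ) (α : UnitAddCircle) : ℂ) - 1‖ := by
    intro n
    rw [hb]
    simp
  have hble : ∀ n, ‖b n‖ ≤ |ν| * coeffRatio α φ (q n) := by
    intro n
    rw [hbnorm, coeffRatio_natCast, ← mul_div_assoc]
    have h1 := (hbounds n).1
    have h2 := hpos n
    rw [div_le_div_iff₀ (hpos' n) h2]
    have h3 : 0 ≤ |ν| * ‖roofCoeff φ (q n : ℤ)‖ := by positivity
    nlinarith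
  have hbge : ∀ n, |ν| / Real.pi * coeffRatio α φ (q n) ≤ ‖b n‖ := by
    intro n
    rw [hbnorm, coeffRatio_natCast, div_mul_div_comm]
    have h1 := (hbounds n).2
    have h2 := hpos n
    have hpi := Real.pi_pos
    rw [div_le_div_iff₀ (by positivity) (hpos' n)]
    have h3 : 0 ≤ |ν| * ‖roofCoeff φ (q n : ℤ)‖ := by positivity
    nlinarith
  -- Multiplying `ψ` by `exp(-iνW)` absorbs the coboundary and leaves a purely lacunary cocycle.
  refine hL.not_cocycle (b := b) (K := 2 * |ν| * K) ?_ ?_ ?_ (ν * (roofCoeff φ 0).re)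
    (ψ := fun x => ψ x * Complex.exp ((-(ν * W x) : ℝ) * Complex.I)) ?_ ?_ ?_
  · intro n
    have hne : ((q n : ℕ) : ℤ) ≠ 0 := by have := (hmem n).1; omega
    have h1 := hK (q n) hne
    rw [Int.cast_natCast, Nat.abs_cast] at h1
    rw [hbmul, norm_mul, norm_mul, Complex.norm_real, Real.norm_eq_abs, mul_div_assoc]
    simp only [Complex.norm_ofNat]
    gcongr
  · refine squeeze_zero_norm hble ?_
    have hqt : Tendsto q atTop atTop := (Nat.nth_strictMono hinf).tendsto_atTop
    simpa only [mul_zero] using! (hlim.comp hqt).const_mul |ν|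
  · intro hsum
    apply hP
    rw [← hinj.summable_iff fun m hm => Set.indicator_of_notMem (hrange m hm) _]
    refine Summable.of_nonneg_of_le (fun n => ?_) (fun n => ?_)
      (hsum.mul_left ((Real.pi / |ν|) ^ 2))
    · exact Set.indicator_nonneg (f := fun m : ℕ => coeffRatio α φ m ^ 2)
        (fun m _ => sq_nonneg _) (q n)
    · rw [Function.comp_apply, Set.indicator_of_mem (hmem n), ← mul_pow]
      have hν' := abs_pos.2 hν
      refine pow_le_pow_left₀ (coeffRatio_nonneg _) ?_ 2
      have h1 := hbge n
      calc coeffRatio α φ (q n) = Real.pi / |ν| * (|ν| / Real.pi * coeffRatio α φ (q n)) := by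
            field_simp
        _ ≤ _ := by gcongr
  · fun_prop
  · filter_upwards [hψ1] with x hx
    rw [norm_mul, hx, Complex.norm_exp_ofReal_mul_I, one_mul]
  · filter_upwards [heq, hW] with x h1 h2
    have h3 : ∑' n, wave (b n * (fourier (q n : ℤ) (α : UnitAddCircle) - 1)) (q n) x =
        ν * ∑' m : ℕ, (goodDenominators α).indicator
          (fun m : ℕ => 2 * (roofCoeff φ m * fourier (m : ℤ) x).re) m := by
      rw [← hinj.tsum_eq (f := (goodDenominators α).indicator _), ← tsum_mul_left]
      · refine tsum_congr fun n => ?_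
        rw [hbmul, Set.indicator_of_mem (hmem n), wave, mul_assoc,
          show (2 : ℂ) * ν = ((2 * ν : ℝ) : ℂ) by push_cast; rfl, Complex.re_ofReal_mul]
        ring
      · intro m hm
        by_contra hcon
        exact hm (Set.indicator_of_notMem (hrange m hcon) _)
    rw [h3]
    set S := ∑' m : ℕ, (goodDenominators α).indicator
          (fun m : ℕ => 2 * (roofCoeff φ m * fourier (m : ℤ) x).re) m
    simp only [h1]
    rw [mul_right_comm, ← Complex.exp_add, mul_comm (ψ x), ← mul_assoc, ← Complex.exp_add, h2]
    congr 2
    push_cast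
    ring

end Conclusion

theorem proposition4p2 (φ : UnitAddCircle → ℝ) (hpos : ∀ x, 0 < φ x)
    (hφ : ContDiff ℝ 3 (fun x : ℝ => φ (x : UnitAddCircle)))
    (hreg : RegularCoeffs (roofCoeff φ))
    (α : ℝ) (hα : Irrational α)
    (hlim : Tendsto (fun m : ℕ =>
      ‖roofCoeff φ (m : ℤ)‖ / ‖((((m : ℝ) * α : ℝ)) : UnitAddCircle)‖) atTop (𝓝 0))
    (hsum : ¬ Summable (fun m : {m : ℤ // m ≠ 0} =>
      (‖roofCoeff φ (m : ℤ)‖ / ‖(((((m : ℤ) : ℝ) * α : ℝ)) : UnitAddCircle)‖) ^ 2)) :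
    IsWeakMixingFlow (specialMeasure φ) (specialFlow α φ) := by
  have hcont : Continuous φ := continuous_of_continuous_comp_coe hφ.continuous
  obtain ⟨K, -, hK⟩ := exists_roofCoeff_le hφ
  have hlim' : Tendsto (fun m : ℕ => coeffRatio α φ m) atTop (𝓝 0) := by
    simpa only [coeffRatio_natCast] using hlim
  obtain ⟨B, hB⟩ := hlim'.bddAbove_range
  have hS := summable_coeffRatio_sq hα hK hreg fun m => hB ⟨m, rfl⟩
  exact isWeakMixingFlow_specialFlow hcont hpos hα fun ν ψ hν hψ hψ1 =>
    not_eigenfunction_equation hα hcont hK hS (not_summable_coeffRatio_sq hS hsum) hlim' hν hψ hψ1
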